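/- An \emph{ordered graph} is a finite simple graph with a fixed linear order of its vertices. Let $aabb$ be the ordered graph with vertices $1<2<3<4$ and exactly the two edges $12$ and $34$. An ordered graph $G$ is \emph{$aabb$-free} if it does not contain $aabb$ as an ordered induced subgraph, i.e. if there are no vertices $x_1\prec x_2\prec x_3\prec x_4$ of $G$ such that $x_1x_2$ and $x_3x_4$ are the only edges of $G$ among them. In the problem \textsc{Maximum Weight Independent Set} (MWIS) we are given a graph $G$ together with a weight function $\mathfrak{w}\colon V(G)\to\mathbb{Q}_{>0}$, and we ask for an independent set of $G$ of maximum total weight. Running times are measured on a random access machine on which every computation on weights (addition, subtraction, comparison) takes constant time. \textbf{Theorem.} MWIS in $n$-vertex $aabb$-free ordered graphs can be solved in time $n^{\mathcal{O}(\log n)}$: there are an algorithm and a constant $c$ such that, given an $aabb$-free ordered graph $G$ with $n$ vertices and weights $\mathfrak{w}\colon V(G)\to\mathbb{Q}_{>0}$, the algorithm always halts and returns an independent set of $G$ of maximum total weight, its running time is bounded by a function of $n$ alone, and for $n\ge 2$ this running time is at most $n^{c\log_2 n}$. -/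

import Mathlib

/-! ### Ordered graphs

An ordered graph is a simple graph whose vertex type carries a linear order. -/

/-- `G` contains `H` as an ordered induced subgraph: there is an order-preserving injection of the
vertices of `H` into those of `G` under which adjacency is preserved and reflected. -/
def OrderedContains {W V : Type*} [LinearOrder W] [LinearOrder V]
    (H : SimpleGraph W) (G : SimpleGraph V) : Prop :=
  ∃ f : W ↪o V, ∀ a b : W, G.Adj (f a) (f b) ↔ H.Adj a b

/-- `G` is `H`-free, as an ordered graph. -/
def OrderedFree {W V : Type*} [LinearOrder W] [LinearOrder V]
    (H : SimpleGraph W) (G : SimpleGraph V) : Prop :=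
  ¬ OrderedContains H G

/-- The ordered graph `aabb`: four vertices `0 < 1 < 2 < 3`, and exactly the two edges `01`
and `23`. -/
def aabb : SimpleGraph (Fin 4) :=
  SimpleGraph.fromEdgeSet {s(0, 1), s(2, 3)}

/-- `S` is an independent set of `G` of maximum total weight. -/
def IsMaxWeightIndepSet {V : Type*} (G : SimpleGraph V) (w : V → ℚ) (S : Finset V) : Prop :=
  G.IsIndepSet (S : Set V) ∧
    ∀ T : Finset V, G.IsIndepSet (T : Set V) → ∑ v ∈ T, w v ≤ ∑ v ∈ S, w v

/-! ### The machine model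

A random access machine with structured programs.  Its memory consists of arrays of natural
numbers and arrays of weights (rational numbers), both indexed by natural numbers; a program names
only finitely many arrays, and a scalar variable is an array of which only cell `0` is used.
Natural numbers can be added, subtracted (with truncation at `0`), compared, and used as indices.
Weights can be added, subtracted and compared, and nothing else; so a weight influences natural
numbers only through the outcomes of comparisons.  Every elementary operation, on numbers as on
weights, takes one unit of time. -/

namespace WeightRAM

/-- A memory state: the contents of cell `i` of the number array `a` is `nat a i`, and the
contents of cell `i` of the weight array `a` is `wt a i`. -/
@[ext] structure State where
  nat : ℕ → ℕ → ℕ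
  wt : ℕ → ℕ → ℚ

/-- Expressions for natural numbers. `get a i` reads cell `i` of the number array `a`. -/
inductive NExp where
  | const (k : ℕ)
  | get (a : ℕ) (i : NExp)
  | add (e₁ e₂ : NExp)
  | sub (e₁ e₂ : NExp)

/-- Expressions for weights. `get a i` reads cell `i` of the weight array `a`. -/
inductive WExp where
  | zero
  | get (a : ℕ) (i : NExp)
  | add (e₁ e₂ : WExp)
  | sub (e₁ e₂ : WExp)

/-- Conditions: comparisons of numbers, comparisons of weights, Boolean combinations. -/
inductive Cond where
  | le (e₁ e₂ : NExp)
  | wle (e₁ e₂ : WExp)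
  | not (b : Cond)
  | and (b₁ b₂ : Cond)

/-- Programs. `store a i e` writes the value of `e` to cell `i` of the number array `a`;
`wstore a i e` does the same for the weight array `a`. -/
inductive Prog where
  | skip
  | store (a : ℕ) (i : NExp) (e : NExp)
  | wstore (a : ℕ) (i : NExp) (e : WExp)
  | seq (p q : Prog)
  | ite (b : Cond) (p q : Prog)
  | loop (b : Cond) (p : Prog)

/-- The value of a number expression. -/
def NExp.eval (s : State) : NExp → ℕ
  | .const k => k
  | .get a i => s.nat a (i.eval s)
  | .add e₁ e₂ => e₁.eval s + e₂.eval s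
  | .sub e₁ e₂ => e₁.eval s - e₂.eval s

/-- The time to evaluate a number expression: one unit per operation. -/
def NExp.cost : NExp → ℕ
  | .const _ => 1
  | .get _ i => i.cost + 1
  | .add e₁ e₂ => e₁.cost + e₂.cost + 1
  | .sub e₁ e₂ => e₁.cost + e₂.cost + 1

/-- The value of a weight expression. -/
def WExp.eval (s : State) : WExp → ℚ
  | .zero => 0
  | .get a i => s.wt a (i.eval s)
  | .add e₁ e₂ => e₁.eval s + e₂.eval s
  | .sub e₁ e₂ => e₁.eval s - e₂.eval s

/-- The time to evaluate a weight expression: one unit per operation. -/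
def WExp.cost : WExp → ℕ
  | .zero => 1
  | .get _ i => i.cost + 1
  | .add e₁ e₂ => e₁.cost + e₂.cost + 1
  | .sub e₁ e₂ => e₁.cost + e₂.cost + 1

/-- The truth of a condition. -/
def Cond.Holds (s : State) : Cond → Prop
  | .le e₁ e₂ => e₁.eval s ≤ e₂.eval s
  | .wle e₁ e₂ => e₁.eval s ≤ e₂.eval s
  | .not b => ¬ b.Holds s
  | .and b₁ b₂ => b₁.Holds s ∧ b₂.Holds s

/-- The time to evaluate a condition: one unit per operation. -/
def Cond.cost : Cond → ℕ
  | .le e₁ e₂ => e₁.cost + e₂.cost + 1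
  | .wle e₁ e₂ => e₁.cost + e₂.cost + 1
  | .not b => b.cost + 1
  | .and b₁ b₂ => b₁.cost + b₂.cost + 1

/-- Write `x` to cell `i` of the number array `a`. -/
def State.setNat (s : State) (a i x : ℕ) : State :=
  { s with nat := Function.update s.nat a (Function.update (s.nat a) i x) }

/-- Write `x` to cell `i` of the weight array `a`. -/
def State.setWt (s : State) (a i : ℕ) (x : ℚ) : State :=
  { s with wt := Function.update s.wt a (Function.update (s.wt a) i x) }

/-- `Runs p s s' t`: the program `p`, started in the memory state `s`, halts in the memory state
`s'` after exactly `t` units of time. -/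
inductive Runs : Prog → State → State → ℕ → Prop where
  | skip (s : State) : Runs .skip s s 1
  | store (s : State) (a : ℕ) (i e : NExp) :
      Runs (.store a i e) s (s.setNat a (i.eval s) (e.eval s)) (i.cost + e.cost + 1)
  | wstore (s : State) (a : ℕ) (i : NExp) (e : WExp) :
      Runs (.wstore a i e) s (s.setWt a (i.eval s) (e.eval s)) (i.cost + e.cost + 1)
  | seq {p q : Prog} {s s' s'' : State} {t t' : ℕ} :
      Runs p s s' t → Runs q s' s'' t' → Runs (.seq p q) s s'' (t + t')
  | ite_true {b : Cond} {p q : Prog} {s s' : State} {t : ℕ} :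
      b.Holds s → Runs p s s' t → Runs (.ite b p q) s s' (b.cost + t)
  | ite_false {b : Cond} {p q : Prog} {s s' : State} {t : ℕ} :
      ¬ b.Holds s → Runs q s s' t → Runs (.ite b p q) s s' (b.cost + t)
  | loop_true {b : Cond} {p : Prog} {s s' s'' : State} {t t' : ℕ} :
      b.Holds s → Runs p s s' t → Runs (.loop b p) s' s'' t' →
      Runs (.loop b p) s s'' (b.cost + t + t')
  | loop_false {b : Cond} {p : Prog} {s : State} :
      ¬ b.Holds s → Runs (.loop b p) s s b.cost

/-- Programs are deterministic: the final state and the running time are determined by the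
program and the initial state. -/
theorem Runs.deterministic {p : Prog} {s s₁ s₂ : State} {t₁ t₂ : ℕ}
    (h₁ : Runs p s s₁ t₁) (h₂ : Runs p s s₂ t₂) : s₁ = s₂ ∧ t₁ = t₂ := by
  induction h₁ generalizing s₂ t₂ with
  | skip | store | wstore => cases h₂; exact ⟨rfl, rfl⟩
  | seq _ _ ih ih' =>
    cases h₂ with
    | seq k k' =>
      obtain ⟨rfl, rfl⟩ := ih k
      obtain ⟨rfl, rfl⟩ := ih' k'
      exact ⟨rfl, rfl⟩
  | ite_true hb _ ih =>
    cases h₂ with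
    | ite_true _ k => obtain ⟨rfl, rfl⟩ := ih k; exact ⟨rfl, rfl⟩
    | ite_false hb' _ => exact absurd hb hb'
  | ite_false hb _ ih =>
    cases h₂ with
    | ite_true hb' _ => exact absurd hb' hb
    | ite_false _ k => obtain ⟨rfl, rfl⟩ := ih k; exact ⟨rfl, rfl⟩
  | loop_true hb _ _ ih ih' =>
    cases h₂ with
    | loop_true _ k k' =>
      obtain ⟨rfl, rfl⟩ := ih k
      obtain ⟨rfl, rfl⟩ := ih' k'
      exact ⟨rfl, rfl⟩
    | loop_false hb' => exact absurd hb hb'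
  | loop_false hb =>
    cases h₂ with
    | loop_true hb' _ _ => exact absurd hb' hb
    | loop_false _ => exact ⟨rfl, rfl⟩

/-! ### Maximum weight independent set on the machine -/

open Classical in
/-- The initial memory for a weighted ordered graph on the vertices `0 < 1 < ⋯ < n - 1`:
cell `0` of the number array `0` holds `n`; the number array `1` holds the adjacency matrix, row by
row, with entry `(u, v)` in cell `u * n + v`; cell `v` of the weight array `0` holds the weight
of `v`; all other cells hold `0`. -/
noncomputable def inputState {n : ℕ} (G : SimpleGraph (Fin n)) (w : Fin n → ℚ) : State where
  nat a i :=
    if a = 0 ∧ i = 0 then n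
    else if a = 1 ∧ ∃ u v : Fin n, i = (u : ℕ) * n + v ∧ G.Adj u v then 1
    else 0
  wt a i := if h : a = 0 ∧ i < n then w ⟨i, h.2⟩ else 0

/-- The set of vertices that a final memory state describes: `v` belongs to it if and only if
cell `v` of the number array `2` is not `0`. -/
def outputSet (n : ℕ) (s : State) : Finset (Fin n) :=
  Finset.univ.filter fun v => s.nat 2 v ≠ 0

/-- The program `p` solves maximum weight independent set, with positive rational weights, on the
class `C` of ordered graphs, within `T n` units of time on `n`-vertex graphs. -/
def SolvesMWISInTime (C : ∀ n : ℕ, SimpleGraph (Fin n) → Prop) (p : Prog) (T : ℕ → ℕ) : Prop :=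
  ∀ (n : ℕ) (G : SimpleGraph (Fin n)) (w : Fin n → ℚ), C n G → (∀ v, 0 < w v) →
    ∃ (s : State) (t : ℕ), Runs p (inputState G w) s t ∧ t ≤ T n ∧
      IsMaxWeightIndepSet G w (outputSet n s)

end WeightRAM

/-! Call edges ab and cd with a < b ≤ c < d a separated pair. Let a₀b₀ be an edge inside the current
vertex set X whose right end is smallest. In every separated pair of X the second edge cd starts at
or after b₀. Either c = b₀, or `aabb`-freeness gives an edge between {a₀, b₀} and {c, d}. So each
pair is destroyed by deleting N[a₀] or by deleting N[b₀], and one of the two deletions at least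
halves the number of pairs (`exists_halving`).

Fix an independent set I and branch on such halving vertices v: if v ∈ I, take v and delete N[v];
otherwise delete v alone. There are at most n⁴ pairs, so at most 1 + 4 log₂ n vertices are taken.
Once no pair is left, all remaining edges cross a single cut p of the vertex order
(`exists_cut_of_sepCount_eq_zero`). The remaining graph is then bipartite, and a minimum cut of a
network yields its heaviest independent set.

No recursion is needed: the run guided by I is reproduced by the set K of taken vertices alone
(`foldl_branchStep_congr`), so it suffices to try all K of logarithmic size. For each guess, each
cut p and each height threshold a candidate is formed, tested for independence, and kept if it is
the heaviest so far. Soundness comes from that test; optimality only needs one round of the search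
to reach the weight of I (`exists_candidate`).

Minimum cuts are found by the push-relabel method, whose number of steps is bounded in terms of n
whatever the weights are, and which only adds, subtracts and compares weights. Excess that cannot
reach the sink is left at the maximal height; a level free of vertices then gives a saturated cut
(`Preflow.exists_saturated_cut`), which is minimal by duality (`Preflow.Valid.cutCapacity_le`).

On the machine, all loops are bounded and no loop may change a bound. Termination and a polynomial
time bound in the largest loop bound (`exists_cost_le`) follow by structural induction. The only
superpolynomial loop bound is the number of guesses, (n + 1) ^ (4 k) with 2 ^ k ≤ 2 n + 1. -/

namespace WeightRAM

/-! ### Programs with bounded loops -/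

/-- Programs all of whose loops are bounded. `forLoop a b p` runs `p` with cell `0` of the number
array `a` counting up from `0` to the value of cell `0` of the number array `b`. -/
inductive ForProg where
  | skip
  | store (a : ℕ) (i e : NExp)
  | wstore (a : ℕ) (i : NExp) (e : WExp)
  | seq (p q : ForProg)
  | ite (b : Cond) (p q : ForProg)
  | forLoop (a b : ℕ) (p : ForProg)

namespace ForProg

/-- Translation into the language of the machine. -/
def compile : ForProg → Prog
  | skip => .skip
  | store a i e => .store a i e
  | wstore a i e => .wstore a i e
  | seq p q => .seq p.compile q.compile
  | ite b p q => .ite b p.compile q.compile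
  | forLoop a b p =>
    .seq (.store a (.const 0) (.const 0))
      (.loop (.not (.le (.get b (.const 0)) (.get a (.const 0))))
        (.seq p.compile (.store a (.const 0) (.add (.get a (.const 0)) (.const 1)))))

open Classical in
/-- The final memory state. -/
noncomputable def run : ForProg → State → State
  | skip, s => s
  | store a i e, s => s.setNat a (i.eval s) (e.eval s)
  | wstore a i e, s => s.setWt a (i.eval s) (e.eval s)
  | seq p q, s => q.run (p.run s)
  | ite b p q, s => if b.Holds s then p.run s else q.run s
  | forLoop a b p, s =>
    Nat.rec (s.setNat a 0 0) (fun i s' => (p.run s').setNat a 0 (i + 1)) (s.nat b 0)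

/-- The number arrays that a program may write to. -/
def natWrites : ForProg → List ℕ
  | skip => []
  | store a _ _ => [a]
  | wstore _ _ _ => []
  | seq p q => p.natWrites ++ q.natWrites
  | ite _ p q => p.natWrites ++ q.natWrites
  | forLoop a _ p => a :: p.natWrites

/-- The weight arrays that a program may write to. -/
def wtWrites : ForProg → List ℕ
  | skip => []
  | store _ _ _ => []
  | wstore a _ _ => [a]
  | seq p q => p.wtWrites ++ q.wtWrites
  | ite _ p q => p.wtWrites ++ q.wtWrites
  | forLoop _ _ p => p.wtWrites

/-- `p.wellFormed F`: the program `p` does not write to the arrays in `F`, all loop bounds are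
in `F`, and no loop counter is overwritten in the loop. -/
def wellFormed : ForProg → List ℕ → Bool
  | skip, _ => true
  | store a _ _, F => !F.elem a
  | wstore _ _ _, _ => true
  | seq p q, F => p.wellFormed F && q.wellFormed F
  | ite _ p q, F => p.wellFormed F && q.wellFormed F
  | forLoop a b p, F => !F.elem a && F.elem b && p.wellFormed (a :: F)

/-- A bound for the running time if all loop bounds are at most `B`. -/
def cost : ForProg → ℕ → ℕ
  | skip, _ => 1
  | store _ i e, _ => i.cost + e.cost + 1
  | wstore _ i e, _ => i.cost + e.cost + 1
  | seq p q, B => p.cost B + q.cost B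
  | ite b p q, B => b.cost + p.cost B + q.cost B
  | forLoop _ _ p, B => 9 + B * (p.cost B + 12)

@[simp] theorem run_skip (s : State) : run skip s = s := rfl
@[simp] theorem run_store (a : ℕ) (i e : NExp) (s : State) :
    run (store a i e) s = s.setNat a (i.eval s) (e.eval s) := rfl
@[simp] theorem run_wstore (a : ℕ) (i : NExp) (e : WExp) (s : State) :
    run (wstore a i e) s = s.setWt a (i.eval s) (e.eval s) := rfl
@[simp] theorem run_seq (p q : ForProg) (s : State) : run (seq p q) s = q.run (p.run s) := rfl
open Classical in
@[simp] theorem run_ite (b : Cond) (p q : ForProg) (s : State) :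
    run (ite b p q) s = if b.Holds s then p.run s else q.run s := rfl

end ForProg

/-! ### Reading memory after a write -/

@[simp] theorem State.setNat_nat (s : State) (a i x b j : ℕ) :
    (s.setNat a i x).nat b j = if b = a ∧ j = i then x else s.nat b j := by
  unfold State.setNat
  by_cases h : b = a
  · subst h
    by_cases h' : j = i <;> simp [h']
  · simp [h]

theorem State.setNat_nat_of_ne (s : State) {a b : ℕ} (i x : ℕ) (h : b ≠ a) :
    (s.setNat a i x).nat b = s.nat b := by
  simp [State.setNat, h]

@[simp] theorem State.setNat_wt (s : State) (a i x : ℕ) : (s.setNat a i x).wt = s.wt := rfl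

@[simp] theorem State.setWt_wt (s : State) (a i : ℕ) (x : ℚ) (b j : ℕ) :
    (s.setWt a i x).wt b j = if b = a ∧ j = i then x else s.wt b j := by
  unfold State.setWt
  by_cases h : b = a
  · subst h
    by_cases h' : j = i <;> simp [h']
  · simp [h]

theorem State.setWt_wt_of_ne (s : State) {a b : ℕ} (i : ℕ) (x : ℚ) (h : b ≠ a) :
    (s.setWt a i x).wt b = s.wt b := by
  simp [State.setWt, h]

@[simp] theorem State.setWt_nat (s : State) (a i : ℕ) (x : ℚ) : (s.setWt a i x).nat = s.nat := rfl

/-! ### Frame properties, halting and running time -/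

namespace ForProg

theorem run_nat_of_notMem (p : ForProg) (s : State) {a : ℕ} (h : a ∉ p.natWrites) :
    (p.run s).nat a = s.nat a := by
  induction p generalizing s with
  | skip => rfl
  | store b i e =>
    simp only [natWrites, List.mem_singleton] at h
    exact State.setNat_nat_of_ne _ _ _ h
  | wstore b i e => rfl
  | seq p q ihp ihq =>
    simp only [natWrites, List.mem_append, not_or] at h
    rw [run_seq, ihq _ h.2, ihp _ h.1]
  | ite b p q ihp ihq =>
    simp only [natWrites, List.mem_append, not_or] at h
    rw [run_ite]
    split_ifs
    · exact ihp _ h.1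
    · exact ihq _ h.2
  | forLoop c b p ih =>
    simp only [natWrites, List.mem_cons, not_or] at h
    simp only [run]
    induction s.nat b 0 with
    | zero => exact State.setNat_nat_of_ne _ _ _ h.1
    | succ m ihm =>
      exact (State.setNat_nat_of_ne _ _ _ h.1).trans ((ih _ h.2).trans ihm)

theorem run_wt_of_notMem (p : ForProg) (s : State) {a : ℕ} (h : a ∉ p.wtWrites) :
    (p.run s).wt a = s.wt a := by
  induction p generalizing s with
  | skip => rfl
  | store b i e => rfl
  | wstore b i e =>
    simp only [wtWrites, List.mem_singleton] at h
    exact State.setWt_wt_of_ne _ _ _ h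
  | seq p q ihp ihq =>
    simp only [wtWrites, List.mem_append, not_or] at h
    rw [run_seq, ihq _ h.2, ihp _ h.1]
  | ite b p q ihp ihq =>
    simp only [wtWrites, List.mem_append, not_or] at h
    rw [run_ite]
    split_ifs
    · exact ihp _ h.1
    · exact ihq _ h.2
  | forLoop c b p ih =>
    simp only [wtWrites] at h
    simp only [run]
    induction s.nat b 0 with
    | zero => rfl
    | succ m ihm => exact (ih _ h).trans ihm

theorem notMem_natWrites_of_wellFormed {p : ForProg} {F : List ℕ} (h : p.wellFormed F = true)
    {a : ℕ} (ha : a ∈ F) : a ∉ p.natWrites := by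
  induction p generalizing F with
  | skip => simp [natWrites]
  | store b i e =>
    simp only [wellFormed, Bool.not_eq_true', List.elem_eq_mem, decide_eq_false_iff_not] at h
    simp only [natWrites, List.mem_singleton]
    rintro rfl
    exact h ha
  | wstore b i e => simp [natWrites]
  | seq p q ihp ihq =>
    simp only [wellFormed, Bool.and_eq_true] at h
    simp [natWrites, ihp h.1 ha, ihq h.2 ha]
  | ite b p q ihp ihq =>
    simp only [wellFormed, Bool.and_eq_true] at h
    simp [natWrites, ihp h.1 ha, ihq h.2 ha]
  | forLoop c b p ih =>
    simp only [wellFormed, Bool.and_eq_true, Bool.not_eq_true', List.elem_eq_mem,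
      decide_eq_false_iff_not] at h
    have := ih h.2 (List.mem_cons_of_mem _ ha)
    simp only [natWrites, List.mem_cons, not_or]
    refine ⟨?_, this⟩
    rintro rfl
    exact h.1.1 ha

/-- The translation of a well-formed program halts, within the given time. -/
theorem runs_compile {p : ForProg} {F : List ℕ} (h : p.wellFormed F = true) {s : State} {B : ℕ}
    (hB : ∀ a ∈ F, s.nat a 0 ≤ B) :
    ∃ t, Runs p.compile s (p.run s) t ∧ t ≤ p.cost B := by
  induction p generalizing F s with
  | skip => exact ⟨_, .skip s, le_rfl⟩
  | store b i e => exact ⟨_, .store s b i e, le_rfl⟩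
  | wstore b i e => exact ⟨_, .wstore s b i e, le_rfl⟩
  | seq p q ihp ihq =>
    simp only [wellFormed, Bool.and_eq_true] at h
    obtain ⟨t, ht, ht'⟩ := ihp h.1 hB
    obtain ⟨u, hu, hu'⟩ := ihq (s := p.run s) h.2 fun a ha => by
      rw [run_nat_of_notMem _ _ (notMem_natWrites_of_wellFormed h.1 ha)]; exact hB a ha
    exact ⟨_, .seq ht hu, add_le_add ht' hu'⟩
  | ite b p q ihp ihq =>
    simp only [wellFormed, Bool.and_eq_true] at h
    rw [run_ite]
    split_ifs with hb
    · obtain ⟨t, ht, ht'⟩ := ihp h.1 hB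
      exact ⟨_, .ite_true hb ht, by simp only [cost]; omega⟩
    · obtain ⟨t, ht, ht'⟩ := ihq h.2 hB
      exact ⟨_, .ite_false hb ht, by simp only [cost]; omega⟩
  | forLoop c b p ih =>
    simp only [wellFormed, Bool.and_eq_true, Bool.not_eq_true', List.elem_eq_mem,
      decide_eq_false_iff_not, decide_eq_true_eq] at h
    obtain ⟨⟨hc, hb⟩, hp⟩ := h
    have hbc : b ≠ c := fun e => hc (e ▸ hb)
    set m := s.nat b 0 with hm
    -- `σ i` is the memory before round i, with the counter already set to i.
    set σ : ℕ → State := fun i =>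
      Nat.rec (s.setNat c 0 0) (fun i s' => (p.run s').setNat c 0 (i + 1)) i with hσ
    have σ0 : σ 0 = s.setNat c 0 0 := rfl
    have σs : ∀ i, σ (i + 1) = (p.run (σ i)).setNat c 0 (i + 1) := fun i => rfl
    have hfr : ∀ i, ∀ a ∈ F, (σ i).nat a = s.nat a := by
      intro i a ha
      have hac : a ≠ c := fun e => hc (e ▸ ha)
      induction i with
      | zero => rw [σ0]; exact State.setNat_nat_of_ne _ _ _ hac
      | succ i ih' =>
        rw [σs, State.setNat_nat_of_ne _ _ _ hac, run_nat_of_notMem, ih']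
        exact notMem_natWrites_of_wellFormed hp (List.mem_cons_of_mem _ ha)
    have hctr : ∀ i, (σ i).nat c 0 = i := by
      intro i
      cases i with
      | zero => simp [σ0]
      | succ i => simp [σs]
    have hmB : m ≤ B := hB b hb
    -- Here j is the number of rounds still to run. The failing last test costs 6; a round costs 6
    -- for its test and 6 for the increment, besides the body.
    have key : ∀ j i, i + j = m → ∃ t, Runs
        (.loop (.not (.le (.get b (.const 0)) (.get c (.const 0))))
          (.seq p.compile (.store c (.const 0) (.add (.get c (.const 0)) (.const 1)))))
        (σ i) (σ m) t ∧ t ≤ 6 + j * (p.cost B + 12) := by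
      intro j
      induction j with
      | zero =>
        intro i hi
        obtain rfl : i = m := by omega
        refine ⟨_, .loop_false ?_, by simp [Cond.cost, NExp.cost]⟩
        simp [Cond.Holds, NExp.eval, hctr, hfr _ b hb, hm]
      | succ j ihj =>
        intro i hi
        -- The body is well-formed relative to `c :: F`, and the counter's value i is below m ≤ B.
        obtain ⟨t, ht, ht'⟩ := ih (s := σ i) hp (by
          intro a ha
          rcases List.mem_cons.1 ha with rfl | ha
          · rw [hctr]; omega
          · rw [hfr i a ha]; exact hB a ha)
        obtain ⟨u, hu, hu'⟩ := ihj (i + 1) (by omega)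
        have hst : Runs (.store c (.const 0) (.add (.get c (.const 0)) (.const 1)))
            (p.run (σ i)) (σ (i + 1)) 6 := by
          have := Runs.store (p.run (σ i)) c (.const 0) (.add (.get c (.const 0)) (.const 1))
          have hcc : (p.run (σ i)).nat c 0 = i := by
            rw [run_nat_of_notMem _ _ (notMem_natWrites_of_wellFormed hp List.mem_cons_self), hctr]
          simpa [NExp.eval, hcc, σs, NExp.cost] using this
        refine ⟨_, .loop_true ?_ (.seq ht hst) hu, ?_⟩
        · simp only [Cond.Holds, NExp.eval, hctr, hfr _ b hb]; omega
        · simp only [Cond.cost, NExp.cost]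
          rw [add_mul]; omega
    obtain ⟨t, ht, ht'⟩ := key m 0 (by omega)
    refine ⟨_, .seq (.store s c (.const 0) (.const 0)) ht, ?_⟩
    have : m * (p.cost B + 12) ≤ B * (p.cost B + 12) := Nat.mul_le_mul_right _ hmB
    simp only [NExp.cost, cost]
    omega

/-- A loop multiplies the cost of its body by B, up to constants, so the cost is polynomial in the
largest loop bound, with a degree that depends on the program only. -/
theorem exists_cost_le (p : ForProg) :
    ∃ C D : ℕ, ∀ B, 1 ≤ B → p.cost B ≤ C * B ^ D := by
  induction p with
  | skip => exact ⟨1, 0, fun B _ => by simp [cost]⟩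
  | store a i e => exact ⟨i.cost + e.cost + 1, 0, fun B _ => by simp [cost]⟩
  | wstore a i e => exact ⟨i.cost + e.cost + 1, 0, fun B _ => by simp [cost]⟩
  | seq p q ihp ihq =>
    obtain ⟨C, D, h⟩ := ihp
    obtain ⟨C', D', h'⟩ := ihq
    refine ⟨C + C', D + D', fun B hB => ?_⟩
    have h1 : B ^ D ≤ B ^ (D + D') := Nat.pow_le_pow_right hB (by omega)
    have h2 : B ^ D' ≤ B ^ (D + D') := Nat.pow_le_pow_right hB (by omega)
    calc p.cost B + q.cost B ≤ C * B ^ D + C' * B ^ D' := add_le_add (h B hB) (h' B hB)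
      _ ≤ C * B ^ (D + D') + C' * B ^ (D + D') := by gcongr
      _ = _ := by ring
  | ite b p q ihp ihq =>
    obtain ⟨C, D, h⟩ := ihp
    obtain ⟨C', D', h'⟩ := ihq
    refine ⟨b.cost + C + C', D + D', fun B hB => ?_⟩
    have h0 : 1 ≤ B ^ (D + D') := Nat.one_le_pow _ _ hB
    have h1 : B ^ D ≤ B ^ (D + D') := Nat.pow_le_pow_right hB (by omega)
    have h2 : B ^ D' ≤ B ^ (D + D') := Nat.pow_le_pow_right hB (by omega)
    calc b.cost + p.cost B + q.cost B ≤ b.cost * 1 + C * B ^ D + C' * B ^ D' := by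
          rw [mul_one]; exact add_le_add (add_le_add le_rfl (h B hB)) (h' B hB)
      _ ≤ b.cost * B ^ (D + D') + C * B ^ (D + D') + C' * B ^ (D + D') := by gcongr
      _ = _ := by ring
  | forLoop a b p ih =>
    obtain ⟨C, D, h⟩ := ih
    -- 21 = 9 + 12: the cost of entering and leaving the loop, and the overhead of one round.
    refine ⟨C + 21, D + 1, fun B hB => ?_⟩
    have h0 : 1 ≤ B ^ (D + 1) := Nat.one_le_pow _ _ hB
    have h1 : B ≤ B ^ (D + 1) := Nat.le_self_pow (by omega) _
    calc 9 + B * (p.cost B + 12) = 9 * 1 + B * p.cost B + 12 * B := by ring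
      _ ≤ 9 * B ^ (D + 1) + B * (C * B ^ D) + 12 * B ^ (D + 1) := by
          gcongr; exact h B hB
      _ = _ := by ring

/-! ### Reasoning about loops -/

/-- The states `s` and `s'` differ at most in the number arrays in `N` and the weight arrays
in `W`. -/
structure Agree (N W : List ℕ) (s s' : State) : Prop where
  nat : ∀ c, c ∉ N → s'.nat c = s.nat c
  wt : ∀ c, c ∉ W → s'.wt c = s.wt c

theorem agree_run (p : ForProg) (s : State) : Agree p.natWrites p.wtWrites s (p.run s) :=
  ⟨fun _ => p.run_nat_of_notMem s, fun _ => p.run_wt_of_notMem s⟩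

/-- The frame hypothesis compares the state before a round with the state before the whole loop, so
the invariant need not mention arrays that the body leaves alone. -/
theorem forLoop_induction {a b : ℕ} {p : ForProg} {s : State} {m : ℕ} (hm : s.nat b 0 = m)
    (I : ℕ → State → Prop)
    (h0 : I 0 (s.setNat a 0 0))
    (hs : ∀ i s', i < m → Agree (a :: p.natWrites) p.wtWrites s s' → s'.nat a 0 = i →
      I i s' → I (i + 1) ((p.run s').setNat a 0 (i + 1))) :
    I m ((forLoop a b p).run s) := by
  subst hm
  simp only [run]
  set σ : ℕ → State := fun i =>
    Nat.rec (s.setNat a 0 0) (fun i s' => (p.run s').setNat a 0 (i + 1)) i with hσ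
  have hfr : ∀ i, Agree (a :: p.natWrites) p.wtWrites s (σ i) := by
    intro i
    induction i with
    | zero =>
      refine ⟨fun c hc => ?_, fun c hc => rfl⟩
      exact State.setNat_nat_of_ne _ _ _ (List.ne_of_not_mem_cons hc)
    | succ i ih =>
      refine ⟨fun c hc => ?_, fun c hc => ?_⟩
      · refine (State.setNat_nat_of_ne _ _ _ (List.ne_of_not_mem_cons hc)).trans ?_
        exact (p.run_nat_of_notMem _ (List.not_mem_of_not_mem_cons hc)).trans (ih.nat c hc)
      · exact (p.run_wt_of_notMem _ hc).trans (ih.wt c hc)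
  have hctr : ∀ i, (σ i).nat a 0 = i := by
    intro i
    cases i with
    | zero => simp [hσ]
    | succ i => simp [hσ]
  have : ∀ i, i ≤ s.nat b 0 → I i (σ i) := by
    intro i
    induction i with
    | zero => exact fun _ => h0
    | succ i ih => exact fun hi => hs i _ (by omega) (hfr i) (hctr i) (ih (by omega))
  exact this _ le_rfl

/-- A loop that, in each round, adds to a fixed cell of a number array. -/
theorem forLoop_nat_sum {a b c : ℕ} {p : ForProg} {s : State} {m : ℕ} (hm : s.nat b 0 = m) (F : ℕ → ℕ) (hca : c ≠ a)
    (h : ∀ i s', i < m → Agree (a :: p.natWrites) p.wtWrites s s' → s'.nat a 0 = i →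
      (p.run s').nat c 0 = s'.nat c 0 + F i) :
    ((forLoop a b p).run s).nat c 0 = s.nat c 0 + ∑ i ∈ Finset.range m, F i := by
  subst hm
  refine forLoop_induction rfl (I := fun i s' => s'.nat c 0 = s.nat c 0 + ∑ i ∈ Finset.range i, F i)
    (by simp [hca]) fun i s' hi hA hc hI => ?_
  rw [Finset.sum_range_succ, ← add_assoc, ← hI]
  simpa [hca] using h i s' hi hA hc

/-- A loop that, in each round, adds to a fixed cell of a weight array. -/
theorem forLoop_wt_sum {a b c : ℕ} {p : ForProg} {s : State} {m : ℕ} (hm : s.nat b 0 = m) (F : ℕ → ℚ)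
    (h : ∀ i s', i < m → Agree (a :: p.natWrites) p.wtWrites s s' → s'.nat a 0 = i →
      (p.run s').wt c 0 = s'.wt c 0 + F i) :
    ((forLoop a b p).run s).wt c 0 = s.wt c 0 + ∑ i ∈ Finset.range m, F i := by
  subst hm
  refine forLoop_induction rfl (I := fun i s' => s'.wt c 0 = s.wt c 0 + ∑ i ∈ Finset.range i, F i)
    (by simp) fun i s' hi hA hc hI => ?_
  rw [Finset.sum_range_succ, ← add_assoc, ← hI]
  simpa using h i s' hi hA hc

/-- A loop that, in round `i`, writes `F i` to cell `i` of a number array. -/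
theorem forLoop_nat_map {a b c : ℕ} {p : ForProg} {s : State} {m : ℕ} (hm : s.nat b 0 = m) (F : ℕ → ℕ) (hca : c ≠ a)
    (h : ∀ i s', i < m → Agree (a :: p.natWrites) p.wtWrites s s' → s'.nat a 0 = i →
      ∀ j, (p.run s').nat c j = if j = i then F i else s'.nat c j) (j : ℕ) :
    ((forLoop a b p).run s).nat c j = if j < m then F j else s.nat c j := by
  subst hm
  refine forLoop_induction rfl (I := fun i s' => s'.nat c j = if j < i then F j else s.nat c j)
    (by simp [hca]) fun i s' hi hA hc hI => ?_
  have := h i s' hi hA hc j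
  simp only [State.setNat_nat, hca, false_and, if_false, this, hI]
  split_ifs <;> first | rfl | omega | (subst_vars; rfl)

/-- A loop that, in round `i`, writes `F i` to cell `i` of a weight array, up to a shift. -/
theorem forLoop_wt_map {a b c : ℕ} {p : ForProg} {s : State} {m : ℕ} (hm : s.nat b 0 = m) (F : ℕ → ℚ) (k : ℕ)
    (h : ∀ i s', i < m → Agree (a :: p.natWrites) p.wtWrites s s' → s'.nat a 0 = i →
      ∀ j, (p.run s').wt c j = if j = k + i then F i else s'.wt c j) (j : ℕ) :
    ((forLoop a b p).run s).wt c j =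
      if k ≤ j ∧ j < k + m then F (j - k) else s.wt c j := by
  subst hm
  refine forLoop_induction rfl
    (I := fun i s' => s'.wt c j = if k ≤ j ∧ j < k + i then F (j - k) else s.wt c j)
    (by
      rw [if_neg (by omega)]; rfl) fun i s' hi hA hc hI => ?_
  have := h i s' hi hA hc j
  simp only [State.setNat_wt, this, hI]
  split_ifs <;> first | rfl | omega | (subst_vars; simp)

end ForProg

end WeightRAM

/-! ### Iterating maps that fix a point or decrease a measure -/

section ShrinkingMaps

variable {α β : Type*} {V : α → Prop} {M : α → ℕ}

/-- The measure never goes up again, so a fold that loses nothing has not moved at all. Stability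
under a whole pass thus becomes stability under each of its steps. -/
theorem foldl_shrinks {f : α → β → α}
    (h : ∀ b x, V x → V (f x b) ∧ (f x b = x ∨ M (f x b) < M x)) (l : List β) (x : α)
    (hx : V x) :
    V (l.foldl f x) ∧ ((l.foldl f x = x ∧ ∀ b ∈ l, f x b = x) ∨ M (l.foldl f x) < M x) := by
  induction l generalizing x with
  | nil => exact ⟨hx, Or.inl ⟨rfl, by simp⟩⟩
  | cons b l ih =>
    obtain ⟨hV, h1⟩ := h b x hx
    obtain ⟨hV', h2⟩ := ih _ hV
    refine ⟨hV', ?_⟩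
    rw [List.foldl_cons]
    rcases h1 with h1 | h1
    · rw [h1] at h2 ⊢
      rcases h2 with h2 | h2
      · exact Or.inl ⟨h2.1, by simpa [h1] using h2.2⟩
      · exact Or.inr h2
    · rcases h2 with h2 | h2
      · exact Or.inr (by rw [h2.1]; exact h1)
      · exact Or.inr (h2.trans h1)

/-- Until a fixed point is reached, each iteration costs at least one unit of the measure. -/
theorem iterate_stable {g : α → α} (hg : ∀ x, V x → V (g x) ∧ (g x = x ∨ M (g x) < M x))
    {m : ℕ} {x : α} (hx : V x) (hm : M x < m) : V (g^[m] x) ∧ g (g^[m] x) = g^[m] x := by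
  have key : ∀ k, V (g^[k] x) ∧ (g (g^[k] x) = g^[k] x ∨ M (g^[k] x) + k ≤ M x) := by
    intro k
    induction k with
    | zero => exact ⟨hx, Or.inr le_rfl⟩
    | succ k ih =>
      rw [Function.iterate_succ_apply']
      obtain ⟨h1, h2⟩ := ih
      obtain ⟨h3, h4⟩ := hg _ h1
      refine ⟨h3, ?_⟩
      rcases h2 with h2 | h2
      · left; rw [h2, h2]
      · rcases h4 with h4 | h4
        · left; rw [h4, h4]
        · right; omega
  obtain ⟨h1, h2 | h2⟩ := key m
  · exact ⟨h1, h2⟩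
  · omega

theorem foldl_range_const (g : α → α) (m : ℕ) (x : α) :
    (List.range m).foldl (fun y _ => g y) x = g^[m] x := by
  induction m with
  | zero => rfl
  | succ m ih => rw [List.range_succ, List.foldl_append, ih, Function.iterate_succ_apply']; rfl

end ShrinkingMaps

/-- Data refinement: `abs` forgets how the memory represents a mathematical object. It is used for
the pair of sets in the branching and for preflows. -/
theorem WeightRAM.ForProg.forLoop_foldl {α : Type*} {a b : ℕ} {p : ForProg} {s : State}
    {m : ℕ} (hm : s.nat b 0 = m) (abs : State → α) (f : α → ℕ → α) (habs : ∀ s' x, abs (s'.setNat a 0 x) = abs s')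
    (h : ∀ i s', i < m → Agree (a :: p.natWrites) p.wtWrites s s' → s'.nat a 0 = i →
      abs (p.run s') = f (abs s') i) :
    abs ((forLoop a b p).run s) = (List.range m).foldl f (abs s) := by
  subst hm
  refine forLoop_induction rfl (I := fun i s' => abs s' = (List.range i).foldl f (abs s))
    (by simp [habs]) fun i s' hi hA hc hI => ?_
  rw [habs, h i s' hi hA hc, hI, List.range_succ, List.foldl_append]
  rfl

/-! ### Separated pairs of edges -/

section SeparatedPairs

open Finset

/-- The graph on the natural numbers below `n` has no two separated edges without an edge
between them. -/
def SepFree (adj : ℕ → ℕ → Prop) : Prop :=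
  ∀ a b c d, a < b → b < c → c < d → adj a b → adj c d →
    adj a c ∨ adj a d ∨ adj b c ∨ adj b d

/-- `a b` and `c d` are edges in `X`, and the first ends no later than the second starts. -/
def SepPair (adj : ℕ → ℕ → Prop) (X : Finset ℕ) (a b c d : ℕ) : Prop :=
  (a < b ∧ b ≤ c ∧ c < d) ∧ (adj a b ∧ adj c d) ∧ (a ∈ X ∧ b ∈ X ∧ c ∈ X ∧ d ∈ X)

open Classical in
/-- The number of separated pairs of edges. -/
noncomputable def sepCount (adj : ℕ → ℕ → Prop) (n : ℕ) (X : Finset ℕ) : ℕ :=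
  ∑ a ∈ range n, ∑ b ∈ range n, ∑ c ∈ range n, ∑ d ∈ range n,
    if SepPair adj X a b c d then 1 else 0

open Classical in
/-- Removal of the closed neighbourhood of `v`. -/
noncomputable def removeNbhd (adj : ℕ → ℕ → Prop) (X : Finset ℕ) (v : ℕ) : Finset ℕ :=
  X.filter fun u => u ≠ v ∧ ¬ adj u v

theorem mem_removeNbhd {adj : ℕ → ℕ → Prop} {X : Finset ℕ} {u v : ℕ} :
    u ∈ removeNbhd adj X v ↔ u ∈ X ∧ u ≠ v ∧ ¬ adj u v := by
  simp [removeNbhd]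

theorem removeNbhd_subset {adj : ℕ → ℕ → Prop} {X : Finset ℕ} {v : ℕ} :
    removeNbhd adj X v ⊆ X := fun _ h => (mem_removeNbhd.1 h).1

theorem sepCount_le (adj : ℕ → ℕ → Prop) (n : ℕ) (X : Finset ℕ) : sepCount adj n X ≤ n ^ 4 := by
  calc sepCount adj n X
      ≤ ∑ a ∈ range n, ∑ b ∈ range n, ∑ c ∈ range n, ∑ d ∈ range n, 1 := by
        unfold sepCount
        gcongr
        split_ifs <;> simp
    _ = n ^ 4 := by simp; ring

theorem sepCount_mono (adj : ℕ → ℕ → Prop) (n : ℕ) {X Y : Finset ℕ} (h : X ⊆ Y) :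
    sepCount adj n X ≤ sepCount adj n Y := by
  unfold sepCount
  gcongr with a _ b _ c _ d _
  split_ifs with h1 h2 <;> first | rfl | skip
  · exact absurd ⟨h1.1, h1.2.1, h h1.2.2.1, h h1.2.2.2.1, h h1.2.2.2.2.1, h h1.2.2.2.2.2⟩ h2
  · simp

theorem SepPair.sepCount_pos {adj : ℕ → ℕ → Prop} {n : ℕ} {X : Finset ℕ} {a b c d : ℕ}
    (h : SepPair adj X a b c d) (hX : X ⊆ range n) : 0 < sepCount adj n X := by
  classical
  have h1 : ∀ d' ∈ range n, 0 ≤ if SepPair adj X a b c d' then 1 else 0 := fun _ _ => zero_le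
  have hh := h
  obtain ⟨-, -, ha, hb, hc, hd⟩ := h
  unfold sepCount
  refine lt_of_lt_of_le ?_ (single_le_sum (fun _ _ => zero_le) (hX ha))
  refine lt_of_lt_of_le ?_ (single_le_sum (fun _ _ => zero_le) (hX hb))
  refine lt_of_lt_of_le ?_ (single_le_sum (fun _ _ => zero_le) (hX hc))
  refine lt_of_lt_of_le ?_ (single_le_sum (fun _ _ => zero_le) (hX hd))
  rw [if_pos hh]
  exact one_pos

theorem exists_sepPair {adj : ℕ → ℕ → Prop} {n : ℕ} {X : Finset ℕ} (h : 0 < sepCount adj n X) :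
    ∃ a b c d, SepPair adj X a b c d := by
  by_contra! hc
  simp [sepCount, hc] at h

theorem exists_first_right_end {adj : ℕ → ℕ → Prop} {X : Finset ℕ}
    (h : ∃ a b, a < b ∧ adj a b ∧ a ∈ X ∧ b ∈ X) :
    ∃ a b, (a < b ∧ adj a b ∧ a ∈ X ∧ b ∈ X) ∧
      ∀ a' b', a' < b' → adj a' b' → a' ∈ X → b' ∈ X → b ≤ b' := by
  classical
  have h' : ∃ b a, a < b ∧ adj a b ∧ a ∈ X ∧ b ∈ X := by
    obtain ⟨a, b, h⟩ := h
    exact ⟨b, a, h⟩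
  obtain ⟨a, ha⟩ := Nat.find_spec h'
  exact ⟨a, Nat.find h', ha, fun a' b' h1 h2 h3 h4 => Nat.find_min' h' ⟨a', h1, h2, h3, h4⟩⟩

/-- The vertex is one of the two ends of an edge whose right end comes first. -/
theorem exists_halving {adj : ℕ → ℕ → Prop} (hsymm : ∀ u v, adj u v → adj v u)
    (hfree : SepFree adj) {n : ℕ} {X : Finset ℕ} (h : 0 < sepCount adj n X) :
    ∃ v ∈ X, 2 * sepCount adj n (removeNbhd adj X v) ≤ sepCount adj n X := by
  classical
  obtain ⟨a₁, b₁, c₁, d₁, h₁⟩ := exists_sepPair h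
  obtain ⟨a₀, b₀, ⟨hab, hadj, ha, hb⟩, hmin⟩ := exists_first_right_end
    ⟨a₁, b₁, h₁.1.1, h₁.2.1.1, h₁.2.2.1, h₁.2.2.2.1⟩
  -- Term by term: a separated pair of X survives at most one of the two deletions.
  have key : sepCount adj n (removeNbhd adj X a₀) + sepCount adj n (removeNbhd adj X b₀) ≤
      sepCount adj n X := by
    unfold sepCount
    simp only [← sum_add_distrib]
    gcongr with a _ b _ c _ d _
    by_cases hX : SepPair adj X a b c d
    · rw [if_pos hX]
      have : ¬ (SepPair adj (removeNbhd adj X a₀) a b c d ∧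
          SepPair adj (removeNbhd adj X b₀) a b c d) := by
        rintro ⟨⟨-, -, -, -, hc1, hd1⟩, ⟨-, -, -, -, hc2, hd2⟩⟩
        rw [mem_removeNbhd] at hc1 hd1 hc2 hd2
        obtain ⟨⟨h1, h2, h3⟩, ⟨h4, h5⟩, h6, h7, h8, h9⟩ := hX
        have hle : b₀ ≤ b := hmin a b h1 h4 h6 h7
        -- The case c = b₀ is excluded because b₀ itself is deleted along with its neighbours. Now
        -- a₀ < b₀ < c < d, as `SepFree` requires.
        have hlt : b₀ < c := lt_of_le_of_ne (hle.trans h2) (Ne.symm hc2.2.1)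
        rcases hfree a₀ b₀ c d hab hlt h3 hadj h5 with e | e | e | e
        · exact hc1.2.2 (hsymm _ _ e)
        · exact hd1.2.2 (hsymm _ _ e)
        · exact hc2.2.2 (hsymm _ _ e)
        · exact hd2.2.2 (hsymm _ _ e)
      split_ifs <;> simp_all
    · have hsub : ∀ v, ¬ SepPair adj (removeNbhd adj X v) a b c d := fun v hv =>
        hX ⟨hv.1, hv.2.1, removeNbhd_subset hv.2.2.1, removeNbhd_subset hv.2.2.2.1,
          removeNbhd_subset hv.2.2.2.2.1, removeNbhd_subset hv.2.2.2.2.2⟩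
      simp [hsub]
  by_cases h2 : 2 * sepCount adj n (removeNbhd adj X a₀) ≤ sepCount adj n X
  · exact ⟨a₀, ha, h2⟩
  · exact ⟨b₀, hb, by omega⟩

/-- The cut is the smallest right end b₀. An edge that starts at or after b₀ would form a separated
pair with the edge ending at b₀; this is why separated pairs are allowed to share the vertex b = c.
-/
theorem exists_cut_of_sepCount_eq_zero {adj : ℕ → ℕ → Prop} {n : ℕ} {X : Finset ℕ}
    (hX : X ⊆ range n) (h : sepCount adj n X = 0) :
    ∃ p ≤ n, ∀ u v, u ∈ X → v ∈ X → u < v → adj u v → u < p ∧ p ≤ v := by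
  by_cases he : ∃ a b, a < b ∧ adj a b ∧ a ∈ X ∧ b ∈ X
  · obtain ⟨a₀, b₀, ⟨hab, hadj, ha, hb⟩, hmin⟩ := exists_first_right_end he
    refine ⟨b₀, (mem_range.1 (hX hb)).le, fun u v hu hv huv hadj' => ⟨?_, hmin u v huv hadj' hu hv⟩⟩
    by_contra! hle
    have : SepPair adj X a₀ b₀ u v := ⟨⟨hab, hle, huv⟩, ⟨hadj, hadj'⟩, ha, hb, hu, hv⟩
    exact (this.sepCount_pos hX).ne' h
  · refine ⟨0, Nat.zero_le _, fun u v hu hv huv hadj => ?_⟩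
    exact absurd ⟨u, v, huv, hadj, hu, hv⟩ he

/-! ### Greedy branching -/

/-- `v` is to be branched on. -/
def Branches (adj : ℕ → ℕ → Prop) (n : ℕ) (X : Finset ℕ) (v : ℕ) : Prop :=
  v ∈ X ∧ 0 < sepCount adj n X ∧ 2 * sepCount adj n (removeNbhd adj X v) ≤ sepCount adj n X

open Classical in
/-- One branching step: `x.1` is the set of vertices that are left, `x.2` is the set of vertices
that have been taken, and `K` tells which vertices to take. -/
noncomputable def branchStep (adj : ℕ → ℕ → Prop) (n : ℕ) (K : Set ℕ)
    (x : Finset ℕ × Finset ℕ) (v : ℕ) : Finset ℕ × Finset ℕ :=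
  if Branches adj n x.1 v then
    if v ∈ K then (removeNbhd adj x.1 v, insert v x.2) else (x.1.erase v, x.2)
  else x

/-- A pass over all vertices. -/
noncomputable def branchPass (adj : ℕ → ℕ → Prop) (n : ℕ) (K : Set ℕ)
    (x : Finset ℕ × Finset ℕ) : Finset ℕ × Finset ℕ :=
  (List.range n).foldl (branchStep adj n K) x

variable {adj : ℕ → ℕ → Prop} {n : ℕ}

theorem branchStep_shrinks (K : Set ℕ) (v : ℕ) (x : Finset ℕ × Finset ℕ) :
    (¬ Branches adj n x.1 v ∧ branchStep adj n K x v = x) ∨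
      (branchStep adj n K x v).1.card < x.1.card := by
  unfold branchStep
  split_ifs with h1 h2
  · right
    refine card_lt_card ⟨removeNbhd_subset, fun hs => ?_⟩
    exact (mem_removeNbhd.1 (hs h1.1)).2.1 rfl
  · right
    exact card_lt_card (erase_ssubset h1.1)
  · exact Or.inl ⟨h1, rfl⟩

/-- This holds for every guide K, right or wrong. A pass that is not idle loses one of at most n
vertices, so `n + 1` passes reach a fixed point; there the count vanishes, as otherwise
`exists_halving` supplies a vertex to branch on. -/
theorem sepCount_iterate_branchPass (hsymm : ∀ u v, adj u v → adj v u) (hfree : SepFree adj)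
    (K : Set ℕ) {x : Finset ℕ × Finset ℕ} (hx : x.1 ⊆ range n) :
    sepCount adj n ((branchPass adj n K)^[n + 1] x).1 = 0 ∧
      ((branchPass adj n K)^[n + 1] x).1 ⊆ range n := by
  have h1 : ∀ v (x : Finset ℕ × Finset ℕ), x.1 ⊆ range n →
      (branchStep adj n K x v).1 ⊆ range n ∧
      (branchStep adj n K x v = x ∨ (branchStep adj n K x v).1.card < x.1.card) := by
    intro v x hx
    refine ⟨?_, (branchStep_shrinks K v x).imp_left And.right⟩
    unfold branchStep
    split_ifs
    · exact removeNbhd_subset.trans hx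
    · exact (erase_subset _ _).trans hx
    · exact hx
  have h2 := foldl_shrinks (V := fun x : Finset ℕ × Finset ℕ => x.1 ⊆ range n)
    (M := fun x => x.1.card) h1 (List.range n)
  obtain ⟨h3, h4⟩ := iterate_stable (g := branchPass adj n K)
    (V := fun x : Finset ℕ × Finset ℕ => x.1 ⊆ range n) (M := fun x => x.1.card)
    (fun x hx => ⟨(h2 x hx).1, (h2 x hx).2.imp_left And.left⟩) hx (m := n + 1)
    (Nat.lt_succ_of_le (by simpa using card_le_card hx))
  refine ⟨?_, h3⟩
  set y := (branchPass adj n K)^[n + 1] x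
  by_contra hne
  obtain ⟨v, hv, hv'⟩ := exists_halving hsymm hfree (Nat.pos_of_ne_zero hne)
  rcases (h2 y h3).2 with h5 | h5
  · have := h5.2 v (by simpa using h3 hv)
    rcases branchStep_shrinks (adj := adj) (n := n) K v y with h6 | h6
    · exact h6.1 ⟨hv, Nat.pos_of_ne_zero hne, hv'⟩
    · rw [this] at h6; exact lt_irrefl _ h6
  · have h4' : (List.range n).foldl (branchStep adj n K) y = y := h4
    rw [h4'] at h5; exact lt_irrefl _ h5

/-- The invariant of the branching for a fixed independent set `I`. -/
structure BranchInv (adj : ℕ → ℕ → Prop) (n : ℕ) (I : Finset ℕ) (x : Finset ℕ × Finset ℕ) :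
    Prop where
  taken_subset : x.2 ⊆ I
  subset_union : I ⊆ x.2 ∪ x.1
  disjoint : Disjoint x.2 x.1
  not_adj : ∀ u ∈ x.2, ∀ v ∈ x.1, ¬ adj u v
  count : sepCount adj n x.1 * 2 ^ x.2.card ≤ n ^ 4
  card : 2 ^ x.2.card ≤ 2 * n ^ 4

/-- Taking v at least halves the count and doubles 2 ^ |taken|, so their product does not grow. The
count is positive at that moment, so 2 ^ |taken| is at most n⁴ before the step and at most 2 n⁴
after it. -/
theorem BranchInv.step (hsymm : ∀ u v, adj u v → adj v u) {I : Finset ℕ}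
    (hI : ∀ u ∈ I, ∀ v ∈ I, ¬ adj u v) {x : Finset ℕ × Finset ℕ}
    (hx : BranchInv adj n I x) (v : ℕ) : BranchInv adj n I (branchStep adj n (↑I) x v) := by
  unfold branchStep
  split_ifs with h1 h2
  · rw [mem_coe] at h2
    have hv : v ∉ x.2 := fun h => disjoint_left.1 hx.disjoint h h1.1
    have hc := hx.count
    constructor
    · exact insert_subset h2 hx.taken_subset
    · intro u hu
      rcases mem_union.1 (hx.subset_union hu) with h | h
      · simp [h]
      · by_cases huv : u = v
        · simp [huv]
        · simp [mem_removeNbhd, h, huv, hI u hu v h2]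
    · rw [disjoint_left]
      intro u hu hu'
      rw [mem_removeNbhd] at hu'
      rcases mem_insert.1 hu with h | h
      · exact hu'.2.1 h
      · exact disjoint_left.1 hx.disjoint h hu'.1
    · intro u hu u' hu' h
      rw [mem_removeNbhd] at hu'
      rcases mem_insert.1 hu with rfl | hu
      · exact hu'.2.2 (hsymm _ _ h)
      · exact hx.not_adj u hu u' hu'.1 h
    · simp only [card_insert_of_notMem hv, pow_succ]
      calc _ = 2 * sepCount adj n (removeNbhd adj x.1 v) * 2 ^ x.2.card := by ring
        _ ≤ sepCount adj n x.1 * 2 ^ x.2.card := Nat.mul_le_mul_right _ h1.2.2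
        _ ≤ _ := hc
    · simp only [card_insert_of_notMem hv, pow_succ]
      have : 1 * 2 ^ x.2.card ≤ sepCount adj n x.1 * 2 ^ x.2.card :=
        Nat.mul_le_mul_right _ h1.2.1
      linarith
  · rw [mem_coe] at h2
    constructor
    · exact hx.taken_subset
    · intro u hu
      rcases mem_union.1 (hx.subset_union hu) with h | h
      · simp [h]
      · have : u ≠ v := fun e => h2 (e ▸ hu)
        simp [h, this]
    · exact hx.disjoint.mono_right (erase_subset _ _)
    · exact fun u hu w hw => hx.not_adj u hu w (mem_of_mem_erase hw)
    · exact (Nat.mul_le_mul_right _ (sepCount_mono _ _ (erase_subset _ _))).trans hx.count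
    · exact hx.card
  · exact hx

theorem taken_subset_foldl_branchStep (K : Set ℕ) (l : List ℕ) (x : Finset ℕ × Finset ℕ) :
    x.2 ⊆ (l.foldl (branchStep adj n K) x).2 := by
  induction l generalizing x with
  | nil => exact Subset.rfl
  | cons v l ih =>
    refine Subset.trans ?_ (ih _)
    unfold branchStep
    split_ifs
    · exact subset_insert _ _
    · exact Subset.rfl
    · exact Subset.rfl

/-- The guide is consulted only at vertices that are branched on. Such a vertex is taken if it lies
in I, and is then in K; if it is not in I, it is not in K ⊆ I either. -/
theorem foldl_branchStep_congr {I K : Finset ℕ} (l : List ℕ) (x : Finset ℕ × Finset ℕ)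
    (hKI : K ⊆ I) (hK : (l.foldl (branchStep adj n (↑I)) x).2 ⊆ K) :
    l.foldl (branchStep adj n (↑K)) x = l.foldl (branchStep adj n (↑I)) x := by
  induction l generalizing x with
  | nil => rfl
  | cons v l ih =>
    have : branchStep adj n (↑K) x v = branchStep adj n (↑I) x v := by
      have hs := (taken_subset_foldl_branchStep (↑I) l (branchStep adj n (↑I) x v)).trans hK
      by_cases hb : Branches adj n x.1 v
      · by_cases hv : v ∈ I
        · have : v ∈ K := by
            apply hs
            simp [branchStep, hb, hv]
          simp [branchStep, hb, hv, this]
        · have : v ∉ K := fun h => hv (hKI h)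
          simp [branchStep, hb, hv, this]
      · simp [branchStep, hb]
    rw [List.foldl_cons, List.foldl_cons, this]
    exact ih _ hK

/-- All passes become a single fold, to which the comparison `foldl_branchStep_congr` applies. -/
theorem iterate_branchPass_eq_foldl (K : Set ℕ) (m : ℕ) (x : Finset ℕ × Finset ℕ) :
    (branchPass adj n K)^[m] x =
      (List.replicate m (List.range n)).flatten.foldl (branchStep adj n K) x := by
  induction m generalizing x with
  | zero => rfl
  | succ m ih =>
    rw [Function.iterate_succ_apply, ih, List.replicate_succ, List.flatten_cons,
      List.foldl_append]
    rfl

/-- Some set `K` of logarithmic size guides the branching towards the independent set `I`. -/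
theorem exists_guide (hsymm : ∀ u v, adj u v → adj v u) {I : Finset ℕ}
    (hI : ∀ u ∈ I, ∀ v ∈ I, ¬ adj u v) (hn : I ⊆ range n) (hn0 : 0 < n) :
    ∃ K ⊆ I, 2 ^ K.card ≤ 2 * n ^ 4 ∧
      BranchInv adj n I ((branchPass adj n (↑K))^[n + 1] (range n, ∅)) := by
  have h0 : BranchInv adj n I (range n, ∅) := by
    constructor
    · simp
    · simpa using hn
    · simp
    · simp
    · simpa using sepCount_le adj n (range n)
    · have : 1 ≤ n ^ 4 := Nat.one_le_pow _ _ hn0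
      simp only [card_empty, pow_zero]
      linarith
  have h1 : ∀ (l : List ℕ) x, BranchInv adj n I x →
      BranchInv adj n I (l.foldl (branchStep adj n (↑I)) x) := by
    intro l
    induction l with
    | nil => exact fun x hx => hx
    | cons v l ih => exact fun x hx => ih _ (hx.step hsymm hI v)
  set y := (branchPass adj n (↑I))^[n + 1] (range n, ∅) with hy
  have hyI : BranchInv adj n I y := by
    rw [hy, iterate_branchPass_eq_foldl]
    exact h1 _ _ h0
  -- The guide K consists of the vertices taken in the run guided by I itself.
  refine ⟨y.2, hyI.taken_subset, hyI.card, ?_⟩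
  rw [iterate_branchPass_eq_foldl, foldl_branchStep_congr (I := I), ← iterate_branchPass_eq_foldl]
  · exact hyI
  · exact hyI.taken_subset
  · rw [← iterate_branchPass_eq_foldl]

end SeparatedPairs

/-! ### Preflows -/

section Preflow

open Finset

/-- A preflow, in residual form: excesses, residual capacities and heights. -/
@[ext] structure Preflow (V : Type*) where
  ex : V → ℚ
  res : V → V → ℚ
  ht : V → ℕ

namespace Preflow

variable {V : Type*} [Fintype V] [DecidableEq V]

set_option linter.unusedSectionVars false

/-- The arc from `u` to `v` is residual and leads downhill by one. -/
def Admissible (x : Preflow V) (u v : V) : Prop := 0 < x.res u v ∧ x.ht u = x.ht v + 1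

/-- Send `d` units from `u` to `v`. -/
def send (x : Preflow V) (u v : V) (d : ℚ) : Preflow V where
  ex z := x.ex z - (if z = u then d else 0) + (if z = v then d else 0)
  res a b := x.res a b - (if a = u ∧ b = v then d else 0) + (if a = v ∧ b = u then d else 0)
  ht := x.ht

open Classical in
/-- Push as much as possible from `u` to `v`. -/
noncomputable def push (u : V) (x : Preflow V) (v : V) : Preflow V :=
  if 0 < x.ex u ∧ x.Admissible u v then x.send u v (min (x.ex u) (x.res u v)) else x

open Classical in
/-- Lift `u`, if it has positive excess and no push from it is possible. -/
noncomputable def relabel (t : V) (x : Preflow V) (u : V) : Preflow V :=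
  if u ≠ t ∧ 0 < x.ex u ∧ x.ht u < Fintype.card V ∧ ∀ v, ¬ x.Admissible u v then
    { x with ht := fun z => if z = u then x.ht u + 1 else x.ht z }
  else x

/-- The invariants of the push-relabel method. -/
structure Valid (c : V → V → ℚ) (e : V → ℚ) (t : V) (x : Preflow V) : Prop where
  res_nonneg : ∀ u v, 0 ≤ x.res u v
  ex_nonneg : ∀ u, 0 ≤ x.ex u
  res_add : ∀ u v, x.res u v + x.res v u = c u v + c v u
  balance : ∀ u, x.ex u + ∑ v, (c u v - x.res u v) = e u
  steep : ∀ u v, 0 < x.res u v → x.ht u ≤ x.ht v + 1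
  ht_sink : x.ht t = 0
  ht_le : ∀ u, x.ht u ≤ Fintype.card V

open Classical in
/-- The number of admissible arcs. -/
noncomputable def admCount (x : Preflow V) : ℕ :=
  (univ.filter fun z : V × V => x.Admissible z.1 z.2).card

/-- The total height of the vertices with positive excess. -/
def activeHeight (x : Preflow V) : ℕ := ∑ u, if 0 < x.ex u then x.ht u else 0

/-- The total distance of the heights from the maximal height. -/
def depth (x : Preflow V) : ℕ := ∑ u, (Fintype.card V - x.ht u)

/-- A number that decreases with each push and each lift. -/
noncomputable def measure (x : Preflow V) : ℕ :=
  x.depth * (Fintype.card V ^ 2 + 1) ^ 2 + x.admCount * (Fintype.card V ^ 2 + 1) + x.activeHeight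

theorem depth_le (x : Preflow V) : x.depth ≤ Fintype.card V ^ 2 := by
  calc x.depth ≤ ∑ _u : V, Fintype.card V := sum_le_sum fun u _ => Nat.sub_le _ _
    _ = _ := by simp [sq]

theorem admCount_le (x : Preflow V) : x.admCount ≤ Fintype.card V ^ 2 := by
  calc x.admCount ≤ Fintype.card (V × V) := card_le_univ _
    _ = _ := by simp [sq]

variable {c : V → V → ℚ} {e : V → ℚ} {t : V} {x : Preflow V}

theorem Valid.activeHeight_le (hx : Valid c e t x) : x.activeHeight ≤ Fintype.card V ^ 2 := by
  calc x.activeHeight ≤ ∑ _u : V, Fintype.card V := sum_le_sum fun u _ => by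
        split_ifs
        · exact hx.ht_le u
        · exact Nat.zero_le _
    _ = _ := by simp [sq]

theorem Valid.measure_lt (hx : Valid c e t x) :
    x.measure < (Fintype.card V ^ 2 + 1) ^ 3 := by
  have h1 := x.depth_le
  have h2 := x.admCount_le
  have h3 := hx.activeHeight_le
  unfold measure
  set q := Fintype.card V ^ 2
  calc _ ≤ q * (q + 1) ^ 2 + q * (q + 1) + q := by gcongr
    _ < _ := by ring_nf; omega

/-- Only the reverse arc gains residual capacity, and it leads uphill, so no residual arc becomes
too steep. -/
theorem Valid.send (hx : Valid c e t x) {u v : V} (hadm : x.Admissible u v) {d : ℚ}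
    (hd : 0 ≤ d) (h1 : d ≤ x.ex u) (h2 : d ≤ x.res u v) : Valid c e t (x.send u v d) := by
  have huv : u ≠ v := by
    rintro rfl
    exact absurd hadm.2 (by omega)
  constructor
  · intro a b
    have := hx.res_nonneg a b
    simp only [Preflow.send]
    split_ifs with h3 h4 h4
    · linarith
    · obtain ⟨rfl, rfl⟩ := h3; linarith
    · linarith
    · linarith
  · intro a
    have := hx.ex_nonneg a
    simp only [Preflow.send]
    split_ifs with h3 h4 h4
    · linarith
    · subst h3; linarith
    · linarith
    · linarith
  · intro a b
    rw [← hx.res_add a b]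
    simp only [Preflow.send, and_comm (a := b = u), and_comm (a := b = v)]
    ring
  · intro a
    rw [← hx.balance a]
    simp only [Preflow.send, sum_sub_distrib, sum_add_distrib, ite_and]
    have h3 : ∀ (z y : V), (∑ b, if a = z then if b = y then d else 0 else 0) =
        if a = z then d else 0 := by
      intro z y
      split_ifs <;> simp
    rw [h3, h3]
    ring
  · intro a b hab
    simp only [Preflow.send] at hab ⊢
    by_cases h3 : a = v ∧ b = u
    · obtain ⟨rfl, rfl⟩ := h3
      have := hadm.2
      omega
    · refine hx.steep a b (lt_of_lt_of_le hab ?_)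
      rw [if_neg h3]
      split_ifs <;> linarith
  · exact hx.ht_sink
  · exact hx.ht_le

/-- A push keeps all heights and creates no admissible arc. If it saturates its arc, that arc stops
being admissible, which outweighs any growth of `activeHeight`. Otherwise it empties u, and only v,
which is one lower, can become active in exchange. -/
theorem push_shrinks (hx : Valid c e t x) (u v : V) :
    Valid c e t (push u x v) ∧
      ((¬ (0 < x.ex u ∧ x.Admissible u v) ∧ push u x v = x) ∨
        (push u x v).measure < x.measure) := by
  classical
  by_cases hp : 0 < x.ex u ∧ x.Admissible u v
  swap
  · rw [push, if_neg hp]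
    exact ⟨hx, Or.inl ⟨hp, rfl⟩⟩
  rw [push, if_pos hp]
  obtain ⟨hex, hadm⟩ := hp
  have huv : u ≠ v := by
    rintro rfl
    exact absurd hadm.2 (by omega)
  set d := min (x.ex u) (x.res u v) with hd
  have hd0 : 0 < d := lt_min hex hadm.1
  have hV := hx.send hadm hd0.le (min_le_left _ _) (min_le_right _ _)
  refine ⟨hV, Or.inr ?_⟩
  have hsub : ∀ a b, (x.send u v d).Admissible a b → x.Admissible a b := by
    rintro a b ⟨h1, h2⟩
    refine ⟨?_, h2⟩
    simp only [Preflow.send] at h1 h2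
    have h3 : ¬ (a = v ∧ b = u) := by
      rintro ⟨rfl, rfl⟩
      have := hadm.2
      omega
    rw [if_neg h3] at h1
    split_ifs at h1 <;> linarith
  have hadmle : (x.send u v d).admCount ≤ x.admCount := by
    refine card_le_card fun z hz => ?_
    simp only [mem_filter, mem_univ, true_and] at hz ⊢
    exact hsub _ _ hz
  have hdepth : (x.send u v d).depth = x.depth := rfl
  have hact := hV.activeHeight_le
  unfold measure
  rw [hdepth]
  by_cases hsat : x.res u v ≤ x.ex u
  · have hlt : (x.send u v d).admCount < x.admCount := by
      refine card_lt_card ⟨fun z hz => ?_, fun hs => ?_⟩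
      · simp only [mem_filter, mem_univ, true_and] at hz ⊢
        exact hsub _ _ hz
      · have := @hs (u, v) (by simpa using hadm)
        simp only [mem_filter, mem_univ, true_and] at this
        have h1 := this.1
        simp [Preflow.send, huv, hd, min_eq_right hsat] at h1
    have : ((x.send u v d).admCount + 1) * (Fintype.card V ^ 2 + 1) ≤
        x.admCount * (Fintype.card V ^ 2 + 1) := Nat.mul_le_mul_right _ hlt
    rw [add_mul] at this
    omega
  · have hdex : d = x.ex u := min_eq_left (le_of_not_ge hsat)
    have h1 : (x.send u v d).activeHeight + x.ht u ≤ x.activeHeight + x.ht v := by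
      have h2 : ∑ z, ((if 0 < (x.send u v d).ex z then (x.send u v d).ht z else 0) +
          if z = u then x.ht u else 0) ≤
          ∑ z, ((if 0 < x.ex z then x.ht z else 0) + if z = v then x.ht v else 0) := by
        refine sum_le_sum fun z _ => ?_
        by_cases hzu : z = u
        · subst hzu
          simp [Preflow.send, huv, hdex, hex]
        · by_cases hzv : z = v
          · subst hzv
            simp only [Preflow.send, hzu, if_true, if_false]
            split_ifs <;> omega
          · simp [Preflow.send, hzu, hzv]
      simpa [sum_add_distrib, activeHeight] using h2
    have h3 := hadm.2
    have h4 : (x.send u v d).admCount * (Fintype.card V ^ 2 + 1) ≤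
        x.admCount * (Fintype.card V ^ 2 + 1) := Nat.mul_le_mul_right _ hadmle
    omega

/-- Without admissible arcs out of u, no residual arc out of u leads downhill, so u can be lifted by
one. This lowers `depth`, whose factor in `measure` outweighs any growth of the other two terms. -/
theorem relabel_shrinks (hx : Valid c e t x) (u : V) :
    Valid c e t (relabel t x u) ∧
      ((¬ (u ≠ t ∧ 0 < x.ex u ∧ x.ht u < Fintype.card V ∧ ∀ v, ¬ x.Admissible u v) ∧
          relabel t x u = x) ∨
        (relabel t x u).measure < x.measure) := by
  classical
  by_cases hp : u ≠ t ∧ 0 < x.ex u ∧ x.ht u < Fintype.card V ∧ ∀ v, ¬ x.Admissible u v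
  swap
  · rw [relabel, if_neg hp]
    exact ⟨hx, Or.inl ⟨hp, rfl⟩⟩
  rw [relabel, if_pos hp]
  obtain ⟨hut, hex, hlt, hadm⟩ := hp
  set y : Preflow V := { x with ht := fun z => if z = u then x.ht u + 1 else x.ht z } with hy
  have hV : Valid c e t y := by
    refine ⟨hx.res_nonneg, hx.ex_nonneg, hx.res_add, hx.balance, ?_, ?_, ?_⟩
    · intro a b hab
      have h1 : 0 < x.res a b := hab
      have h2 := hx.steep a b h1
      simp only [hy]
      split_ifs with h3 h4 h4
      · omega
      · subst h3
        have h5 : x.ht a ≠ x.ht b + 1 := fun h => hadm b ⟨h1, h⟩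
        omega
      · subst h4; omega
      · exact h2
    · simp [hy, hut.symm, hx.ht_sink]
    · intro z
      simp only [hy]
      split_ifs with h
      · omega
      · exact hx.ht_le z
  refine ⟨hV, Or.inr ?_⟩
  have h1 : y.depth < x.depth := by
    refine sum_lt_sum (fun z _ => ?_) ⟨u, mem_univ _, ?_⟩
    · simp only [hy]
      split_ifs with h
      · subst h; omega
      · exact le_rfl
    · simp only [hy, if_true]
      omega
  have h2 := hV.activeHeight_le
  have h3 := y.admCount_le
  unfold measure
  set q := Fintype.card V ^ 2
  have h4 : (y.depth + 1) * (q + 1) ^ 2 ≤ x.depth * (q + 1) ^ 2 := Nat.mul_le_mul_right _ h1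
  have h5 : y.admCount * (q + 1) ≤ q * (q + 1) := Nat.mul_le_mul_right _ h3
  calc _ ≤ y.depth * (q + 1) ^ 2 + q * (q + 1) + q := by gcongr
    _ < (y.depth + 1) * (q + 1) ^ 2 := by ring_nf; omega
    _ ≤ _ := h4
    _ ≤ _ := by rw [add_assoc]; exact Nat.le_add_right _ _

/-- Push from `u` to all vertices, then lift `u` if necessary. -/
noncomputable def discharge (t : V) (l : List V) (x : Preflow V) (u : V) : Preflow V :=
  relabel t (l.foldl (push u) x) u

/-- Discharge all vertices of a list. -/
noncomputable def pass (t : V) (l l' : List V) (x : Preflow V) : Preflow V :=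
  l'.foldl (discharge t l) x

theorem discharge_shrinks (hx : Valid c e t x) (l : List V) (u : V) :
    Valid c e t (discharge t l x u) ∧
      ((discharge t l x u = x ∧ (∀ v ∈ l, push u x v = x) ∧ relabel t x u = x) ∨
        (discharge t l x u).measure < x.measure) := by
  obtain ⟨h1, h2⟩ := foldl_shrinks (V := Valid c e t) (M := measure) (f := push u)
    (fun v x hx => ⟨(push_shrinks hx u v).1, (push_shrinks hx u v).2.imp_left And.right⟩) l x hx
  obtain ⟨h3, h4⟩ := relabel_shrinks h1 u
  refine ⟨h3, ?_⟩
  unfold discharge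
  rcases h2 with ⟨h2, h5⟩ | h2
  · rw [h2] at h4 ⊢
    rcases h4 with h4 | h4
    · exact Or.inl ⟨h4.2, h5, h4.2⟩
    · exact Or.inr h4
  · rcases h4 with h4 | h4
    · exact Or.inr (by rw [h4.2]; exact h2)
    · exact Or.inr (h4.trans h2)

/-- After sufficiently many passes, all remaining excess sits at the sink or at height
`card V`. -/
theorem iterate_pass {l l' : List V} (hl : ∀ v, v ∈ l) (hl' : ∀ u, u ≠ t → u ∈ l')
    (hx : Valid c e t x) {m : ℕ} (hm : (Fintype.card V ^ 2 + 1) ^ 3 ≤ m) :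
    Valid c e t ((pass t l l')^[m] x) ∧
      ∀ u, u ≠ t → 0 < ((pass t l l')^[m] x).ex u →
        Fintype.card V ≤ ((pass t l l')^[m] x).ht u := by
  have h1 := foldl_shrinks (V := Valid c e t) (M := measure) (f := discharge t l)
    (fun u x hx => ⟨(discharge_shrinks hx l u).1, (discharge_shrinks hx l u).2.imp_left And.left⟩) l'
  obtain ⟨h2, h3⟩ := iterate_stable (V := Valid c e t) (M := measure) (g := pass t l l')
    (fun x hx => ⟨(h1 x hx).1, (h1 x hx).2.imp_left And.left⟩) hx (hx.measure_lt.trans_le hm)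
  refine ⟨h2, fun u hu hex => ?_⟩
  set y := (pass t l l')^[m] x
  have h3' : l'.foldl (discharge t l) y = y := h3
  have h4 : ∀ u ∈ l', discharge t l y u = y := by
    rcases (h1 y h2).2 with h4 | h4
    · exact h4.2
    · rw [h3'] at h4; exact absurd h4 (lt_irrefl _)
  rcases (discharge_shrinks h2 l u).2 with h5 | h5
  swap
  · rw [h4 u (hl' u hu)] at h5; exact absurd h5 (lt_irrefl _)
  obtain ⟨-, h6, h7⟩ := h5
  -- An active vertex below the maximal height could be lifted, or else pushed from, contrary to
  -- stability.
  by_contra! hlt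
  rcases (relabel_shrinks h2 u).2 with h8 | h8
  swap
  · rw [h7] at h8; exact absurd h8 (lt_irrefl _)
  refine h8.1 ⟨hu, hex, hlt, fun v hv => ?_⟩
  rcases (push_shrinks h2 u v).2 with h9 | h9
  · exact h9.1 ⟨hex, hv⟩
  · rw [h6 v (hl v)] at h9; exact absurd h9 (lt_irrefl _)

/-- Some height occurs nowhere, and the vertices above it form a saturated cut. -/
theorem exists_saturated_cut (hx : Valid c e t x)
    (hterm : ∀ u, u ≠ t → 0 < x.ex u → Fintype.card V ≤ x.ht u) :
    ∃ k < Fintype.card V, (∀ u v, k < x.ht u → ¬ k < x.ht v → x.res u v = 0) ∧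
      ∀ u, u ≠ t → ¬ k < x.ht u → x.ex u = 0 := by
  -- The vertices other than the sink are too few to occupy all the levels 1, …, card V, and the
  -- sink has height 0.
  have h1 : ((univ.erase t).image x.ht).card < (Icc 1 (Fintype.card V)).card := by
    have hpos : 0 < Fintype.card V := Fintype.card_pos_iff.2 ⟨t⟩
    calc _ ≤ (univ.erase t).card := card_image_le
      _ < _ := by
        rw [card_erase_of_mem (mem_univ _), card_univ, Nat.card_Icc]
        omega
  obtain ⟨k, hk, hk'⟩ := exists_mem_notMem_of_card_lt_card h1
  rw [mem_Icc] at hk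
  have h2 : ∀ u, x.ht u ≠ k := by
    intro u hu
    by_cases hut : u = t
    · rw [hut, hx.ht_sink] at hu
      omega
    · exact hk' (mem_image.2 ⟨u, by simp [hut], hu⟩)
  -- Level k is empty, so the vertices above k - 1 are above k, and an arc leaving this set drops by
  -- at least two. Remaining excess sits at height card V ≥ k, inside the set, or at the sink.
  refine ⟨k - 1, by omega, fun u v hu hv => ?_, fun u hut hu => ?_⟩
  · by_contra hne
    have h3 := hx.steep u v (lt_of_le_of_ne (hx.res_nonneg u v) (Ne.symm hne))
    have := h2 u
    omega
  · by_contra hne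
    have h3 := hterm u hut (lt_of_le_of_ne (hx.ex_nonneg u) (Ne.symm hne))
    omega

/-! ### Cuts and duality -/

theorem sum_symm_mul_antisymm (s f : V → V → ℚ) (hs : ∀ u v, s u v = s v u)
    (hf : ∀ u v, f u v = - f v u) : ∑ u, ∑ v, s u v * f u v = 0 := by
  have h : ∑ u, ∑ v, s u v * f u v = - ∑ u, ∑ v, s u v * f u v := by
    conv_lhs => rw [sum_comm]
    rw [← sum_neg_distrib]
    refine sum_congr rfl fun u _ => ?_
    rw [← sum_neg_distrib]
    refine sum_congr rfl fun v _ => ?_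
    rw [hs v u, hf v u]
    ring
  linarith

open Classical in
/-- The capacity of the cut between `U` and its complement. -/
noncomputable def cutCapacity (c : V → V → ℚ) (e : V → ℚ) (U : V → Prop) : ℚ :=
  ∑ u, if U u then ∑ v, (if U v then 0 else c u v) else e u

open Classical in
-- Sum the balance over the complement of U: net flow inside the complement cancels, and its
-- supplies and the net flow arriving from U remain.
theorem Valid.sum_ex_eq (hx : Valid c e t x) (U : V → Prop) :
    (∑ u, if U u then 0 else x.ex u) =
      ∑ u, if U u then ∑ v, (if U v then 0 else c u v - x.res u v) else e u := by
  set k : V → ℚ := fun u => if U u then 0 else 1 with hk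
  have hanti : ∀ u v, c u v - x.res u v = - (c v u - x.res v u) := fun u v => by
    have := hx.res_add u v
    linarith
  -- With k the indicator of the complement of U, the symmetric weight is 1 on the pairs that are
  -- not both in U, and 0 on the others.
  have h0 := sum_symm_mul_antisymm (fun u v => k u + k v - k u * k v)
    (fun u v => c u v - x.res u v) (fun u v => by ring) hanti
  have h1 : ∀ u, (if U u then 0 else x.ex u) =
      (if U u then ∑ v, (if U v then 0 else c u v - x.res u v) else e u) -
        ∑ v, (k u + k v - k u * k v) * (c u v - x.res u v) := by
    intro u
    by_cases hu : U u
    · simp only [hk, hu, if_true, zero_add, zero_mul, sub_zero]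
      rw [eq_comm, sub_eq_zero]
      refine sum_congr rfl fun v _ => ?_
      split_ifs <;> simp
    · have := hx.balance u
      simp only [hk, hu, if_false, one_mul, add_sub_cancel_right]
      linarith
  rw [sum_congr rfl fun u _ => h1 u, sum_sub_distrib, h0, sub_zero]

/-- A saturated cut is minimal. -/
theorem Valid.cutCapacity_le (hx : Valid c e t x) {U U' : V → Prop} (hU : ¬ U t) (hU' : ¬ U' t)
    (hsat : ∀ u v, U u → ¬ U v → x.res u v = 0) (hex : ∀ u, u ≠ t → ¬ U u → x.ex u = 0) :
    cutCapacity c e U ≤ cutCapacity c e U' := by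
  classical
  -- The excess at the sink plays the role of the flow value: the saturated cut attains it, and
  -- every cut bounds it from above.
  have h1 : cutCapacity c e U = x.ex t := by
    have h2 := hx.sum_ex_eq U
    have h3 : (∑ u, if U u then 0 else x.ex u) = x.ex t := by
      rw [sum_eq_single t (fun u _ hu => ?_) (by simp), if_neg hU]
      split_ifs with h
      · rfl
      · exact hex u hu h
    rw [← h3, h2]
    refine sum_congr rfl fun u _ => ?_
    split_ifs with hu
    · refine sum_congr rfl fun v _ => ?_
      split_ifs with hv
      · rfl
      · rw [hsat u v hu hv, sub_zero]
    · rfl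
  have h2 : x.ex t ≤ cutCapacity c e U' := by
    calc x.ex t = if U' t then 0 else x.ex t := by rw [if_neg hU']
      _ ≤ ∑ u, if U' u then 0 else x.ex u :=
        single_le_sum (f := fun u => if U' u then 0 else x.ex u) (fun u _ => by
          split_ifs
          · exact le_rfl
          · exact hx.ex_nonneg u) (mem_univ t)
      _ = _ := hx.sum_ex_eq U'
      _ ≤ cutCapacity c e U' := by
        refine sum_le_sum fun u _ => ?_
        split_ifs
        · refine sum_le_sum fun v _ => ?_
          have := hx.res_nonneg u v
          split_ifs <;> linarith
        · exact le_rfl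
  exact h1.trans_le h2

/-! ### Bipartite graphs -/

variable {left right : V → Prop} {adj : V → V → Prop} {w : V → ℚ}

open Classical in
/-- The network of a vertex-weighted bipartite graph. -/
noncomputable def bipCapacity (left right : V → Prop) (adj : V → V → Prop) (w : V → ℚ) (t u v : V) :
    ℚ :=
  if left u ∧ right v ∧ adj u v then w u + w u else if right u ∧ v = t then w u else 0

open Classical in
/-- The supplies of a vertex-weighted bipartite graph. -/
noncomputable def bipSupply (left : V → Prop) (w : V → ℚ) (u : V) : ℚ := if left u then w u else 0

/-- The starting point of the push-relabel method for a vertex-weighted bipartite graph. -/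
noncomputable def bipStart (left right : V → Prop) (adj : V → V → Prop) (w : V → ℚ) (t : V) :
    Preflow V where
  ex := bipSupply left w
  res := bipCapacity left right adj w t
  ht _ := 0

theorem bipCapacity_nonneg (hw : ∀ u, 0 ≤ w u) (u v : V) :
    0 ≤ bipCapacity left right adj w t u v := by
  have := hw u
  unfold bipCapacity
  split_ifs <;> linarith

theorem valid_bipStart (hw : ∀ u, 0 ≤ w u) :
    Valid (bipCapacity left right adj w t) (bipSupply left w) t
      (bipStart left right adj w t) := by
  refine ⟨bipCapacity_nonneg hw, fun u => ?_, fun u v => rfl, fun u => ?_, fun u v _ => ?_, rfl,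
    fun u => Nat.zero_le _⟩
  · simp only [bipStart, bipSupply]
    split_ifs
    · exact hw u
    · exact le_rfl
  · simp [bipStart]
  · simp [bipStart]

variable (hlr : ∀ u, left u → ¬ right u) (hlt : ¬ left t) (hrt : ¬ right t)
  (hcov : ∀ u, u ≠ t → left u ∨ right u) (hw : ∀ u, 0 ≤ w u)

include hlr hlt in
/-- No edge of the graph crosses a saturated cut, except at vertices of weight zero. -/
theorem Valid.not_adj_of_cut
    (hx : Valid (bipCapacity left right adj w t) (bipSupply left w) t x) {U : V → Prop}
    (hsat : ∀ u v, U u → ¬ U v → x.res u v = 0) {a b : V} (ha : left a) (hb : right b)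
    (haU : U a) (hbU : ¬ U b) (hwa : 0 < w a) : ¬ adj a b := by
  intro hab
  have h1 := hx.balance a
  have h2 := hx.ex_nonneg a
  -- The network has no arc into a left vertex, so the net flow from a to any v is nonnegative.
  have h3 : ∀ v, 0 ≤ bipCapacity left right adj w t a v - x.res a v := by
    intro v
    have h4 := hx.res_add a v
    have h5 := hx.res_nonneg v a
    have h6 : bipCapacity left right adj w t v a = 0 := by
      unfold bipCapacity
      rw [if_neg (fun h => hlr a ha h.2.1), if_neg]
      rintro ⟨-, rfl⟩
      exact hlt ha
    linarith
  have h4 : bipCapacity left right adj w t a b - x.res a b ≤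
      ∑ v, (bipCapacity left right adj w t a v - x.res a v) :=
    single_le_sum (f := fun v => bipCapacity left right adj w t a v - x.res a v)
      (fun v _ => h3 v) (mem_univ b)
  -- A saturated arc from a to b would carry 2 w(a), although a has only w(a) to send. The doubled
  -- capacity thus acts as an infinite one as soon as w(a) > 0.
  rw [hsat a b haU hbU] at h4
  simp only [bipCapacity, bipSupply, ha, hb, hab, and_self, if_true] at h1 h4
  linarith

include hlr hlt hrt hcov hw in
open Classical in
/-- A saturated cut yields an independent set of maximum weight. -/
theorem Valid.sum_le_of_cut
    (hx : Valid (bipCapacity left right adj w t) (bipSupply left w) t x) {U : V → Prop}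
    (hU : ¬ U t) (hsat : ∀ u v, U u → ¬ U v → x.res u v = 0)
    (hex : ∀ u, u ≠ t → ¬ U u → x.ex u = 0) {T : V → Prop} (hT : ¬ T t)
    (hind : ∀ a b, T a → T b → left a → right b → ¬ adj a b) :
    (∑ u, if T u then w u else 0) ≤
      ∑ u, if (left u ∧ U u) ∨ (right u ∧ ¬ U u) then w u else 0 := by
  -- The competitor T becomes a cut: left vertices in T and right vertices outside T. Its capacity
  -- is at most the weight outside T.
  have h1 := hx.cutCapacity_le (U' := fun u => (left u ∧ T u) ∨ (right u ∧ ¬ T u)) hU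
    (by simp [hlt, hrt]) hsat hex
  -- The capacity of U pays for every vertex left out: a left vertex outside U by its supply, a
  -- right vertex in U by its arc to t.
  have h2 : (∑ u, if u = t ∨ (left u ∧ U u) ∨ (right u ∧ ¬ U u) then 0 else w u) ≤
      cutCapacity (bipCapacity left right adj w t) (bipSupply left w) U := by
    refine sum_le_sum fun u _ => ?_
    by_cases hut : u = t
    · simp [hut, hU, bipSupply, hlt]
    · rcases hcov u hut with hu | hu
      · by_cases hUu : U u
        · simp only [hu, hUu, and_self, true_or, or_true, if_true]
          refine sum_nonneg fun v _ => ?_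
          split_ifs
          · exact le_rfl
          · exact bipCapacity_nonneg hw u v
        · simp [hut, hUu, hu, hlr u hu, bipSupply]
      · have hnl : ¬ left u := fun h => hlr u h hu
        by_cases hUu : U u
        · simp only [hu, hUu, hnl, hut, not_true, and_true, true_and, or_false, if_true,
            if_false]
          refine le_trans ?_ (single_le_sum (f := fun v => if U v then 0 else
            bipCapacity left right adj w t u v) (fun v _ => ?_) (mem_univ t))
          · simp [hU, bipCapacity, hu, hnl]
          · split_ifs
            · exact le_rfl
            · exact bipCapacity_nonneg hw u v
        · simp [hu, hUu, bipSupply, hnl]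
  have h3 : cutCapacity (bipCapacity left right adj w t) (bipSupply left w)
      (fun u => (left u ∧ T u) ∨ (right u ∧ ¬ T u)) ≤
      ∑ u, if u = t ∨ T u then 0 else w u := by
    refine sum_le_sum fun u _ => ?_
    by_cases hut : u = t
    · simp [hut, hlt, hrt, bipSupply]
    · rcases hcov u hut with hu | hu
      · by_cases hTu : T u
        · simp only [hu, hTu, hut, and_self, true_or, if_true, or_true]
          -- An arc from u in T to a right vertex outside the cut would be an edge inside T.
          refine sum_nonpos fun v _ => ?_
          split_ifs with hv
          · exact le_rfl
          · unfold bipCapacity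
            rw [if_neg, if_neg]
            · exact fun h => hlr u hu h.1
            · rintro ⟨-, h5, h6⟩
              refine hind u v hTu ?_ hu h5 h6
              by_contra h7
              exact hv (Or.inr ⟨h5, h7⟩)
        · simp [hu, hTu, hlr u hu, bipSupply, hut]
      · have hnl : ¬ left u := fun h => hlr u h hu
        by_cases hTu : T u
        · simp [hnl, hTu, bipSupply]
        · simp only [hu, hTu, hnl, hut, not_false_eq_true, false_and, true_and, or_true, if_true,
            or_false, if_false]
          refine (sum_le_sum (g := fun v => if v = t then w u else 0) fun v _ => ?_).trans
            (by simp)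
          split_ifs with h4 h5 h5
          · exact hw u
          · exact le_rfl
          · simp [bipCapacity, hnl, h5, hu]
          · simp [bipCapacity, hnl, h5]
  have h4 : ∀ S : V → Prop, ¬ S t → (∑ u, if S u then w u else 0) +
      (∑ u, if u = t ∨ S u then 0 else w u) = ∑ u, if u = t then 0 else w u := by
    intro S hS
    rw [← sum_add_distrib]
    refine sum_congr rfl fun u _ => ?_
    by_cases hut : u = t
    · simp [hut, hS]
    · by_cases hSu : S u <;> simp [hut, hSu]
  have h5 := h4 T hT
  have h6 : (∑ u, if (left u ∧ U u) ∨ (right u ∧ ¬ U u) then w u else 0) +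
      (∑ u, if u = t ∨ (left u ∧ U u) ∨ (right u ∧ ¬ U u) then 0 else w u) =
      ∑ u, if u = t then 0 else w u := by
    convert h4 (fun u => (left u ∧ U u) ∨ (right u ∧ ¬ U u)) (by simp [hlt, hrt])
  linarith

end Preflow

end Preflow

namespace WeightRAM

/-! ### Abbreviations for expressions and conditions -/

/-- The scalar variable `a`. -/
abbrev NExp.var (a : ℕ) : NExp := .get a (.const 0)

/-- The scalar variable `a`. -/
abbrev WExp.var (a : ℕ) : WExp := .get a (.const 0)

/-- `e₁ < e₂`. -/
abbrev Cond.lt (e₁ e₂ : NExp) : Cond := .not (.le e₂ e₁)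

/-- `e₁ = e₂`. -/
abbrev Cond.eq (e₁ e₂ : NExp) : Cond := .and (.le e₁ e₂) (.le e₂ e₁)

/-- `e₁ < e₂`, for weights. -/
abbrev Cond.wlt (e₁ e₂ : WExp) : Cond := .not (.wle e₂ e₁)

/-- Disjunction. -/
abbrev Cond.or (b₁ b₂ : Cond) : Cond := .not (.and (.not b₁) (.not b₂))

/-- Cell `e` of the number array `X` is not `0`. -/
abbrev Cond.mem (X : ℕ) (e : NExp) : Cond := .le (.const 1) (.get X e)

/-- Adjacency in the input graph; the array `4` holds the starting points of the rows. -/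
abbrev Cond.adj (e₁ e₂ : NExp) : Cond := .le (.const 1) (.get 1 (.add (.get 4 e₁) e₂))

@[simp] theorem NExp.eval_const (s : State) (k : ℕ) : (NExp.const k).eval s = k := rfl
@[simp] theorem NExp.eval_get (s : State) (a : ℕ) (i : NExp) :
    (NExp.get a i).eval s = s.nat a (i.eval s) := rfl
@[simp] theorem NExp.eval_add (s : State) (e₁ e₂ : NExp) :
    (NExp.add e₁ e₂).eval s = e₁.eval s + e₂.eval s := rfl
@[simp] theorem WExp.eval_zero (s : State) : WExp.zero.eval s = 0 := rfl
@[simp] theorem WExp.eval_get (s : State) (a : ℕ) (i : NExp) :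
    (WExp.get a i).eval s = s.wt a (i.eval s) := rfl
@[simp] theorem WExp.eval_add (s : State) (e₁ e₂ : WExp) :
    (WExp.add e₁ e₂).eval s = e₁.eval s + e₂.eval s := rfl
@[simp] theorem WExp.eval_sub (s : State) (e₁ e₂ : WExp) :
    (WExp.sub e₁ e₂).eval s = e₁.eval s - e₂.eval s := rfl
@[simp] theorem Cond.holds_le (s : State) (e₁ e₂ : NExp) :
    (Cond.le e₁ e₂).Holds s ↔ e₁.eval s ≤ e₂.eval s := Iff.rfl
@[simp] theorem Cond.holds_wle (s : State) (e₁ e₂ : WExp) :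
    (Cond.wle e₁ e₂).Holds s ↔ e₁.eval s ≤ e₂.eval s := Iff.rfl
@[simp] theorem Cond.holds_not (s : State) (b : Cond) : (Cond.not b).Holds s ↔ ¬ b.Holds s :=
  Iff.rfl
@[simp] theorem Cond.holds_and (s : State) (b₁ b₂ : Cond) :
    (Cond.and b₁ b₂).Holds s ↔ b₁.Holds s ∧ b₂.Holds s := Iff.rfl

/-! ### The memory layout

Number arrays: `0` number of vertices, `1` adjacency matrix, `2` best independent set so far,
`3` number of vertices plus one, `4` and `5` starting points of the rows of matrices with `n` and
`n + 1` columns, `6` number of guessed vertices, `7` number of guesses, `8` an exponent, `9` number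
of push-relabel passes, `10` the current guess as a sequence, `11` the current guess as a set,
`12` the vertices that are left, `13` the vertices that have been taken, `14` the vertices left
after the removal of a neighbourhood, `15`, `16` numbers of separated pairs, `17` heights, `18` a
flag, `19` a candidate, `20` a flag, `21` the carry, `22` a temporary variable, `30` to `45` loop
counters.

Weight arrays: `0` weights, `1` best weight so far, `2` excesses, `3` residual capacities,
`4` the amount of a push, `5` the weight of a candidate, `6` weights of the vertices that are
left. -/

/-- The part of the memory that is never changed after the initialization. -/
structure Env (n : ℕ) (adj : ℕ → ℕ → Prop) (w : ℕ → ℚ) (s : State) : Prop where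
  n_eq : s.nat 0 0 = n
  adj_iff : ∀ u < n, ∀ v < n, 1 ≤ s.nat 1 (u * n + v) ↔ adj u v
  n_succ : s.nat 3 0 = n + 1
  row : ∀ u < n, s.nat 4 u = u * n
  row_succ : ∀ u < n + 1, s.nat 5 u = u * (n + 1)
  w_eq : s.wt 0 = w

theorem Env.of_agree {n : ℕ} {adj : ℕ → ℕ → Prop} {w : ℕ → ℚ} {s s' : State} {N W : List ℕ}
    (h : Env n adj w s) (hA : ForProg.Agree N W s s')
    (hN : ∀ c ∈ [0, 1, 3, 4, 5], c ∉ N) (hW : 0 ∉ W) : Env n adj w s' := by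
  have h0 := hA.nat 0 (hN 0 (by simp))
  have h1 := hA.nat 1 (hN 1 (by simp))
  have h3 := hA.nat 3 (hN 3 (by simp))
  have h4 := hA.nat 4 (hN 4 (by simp))
  have h5 := hA.nat 5 (hN 5 (by simp))
  have h6 := hA.wt 0 hW
  exact ⟨by rw [h0]; exact h.n_eq, by rw [h1]; exact h.adj_iff, by rw [h3]; exact h.n_succ,
    by rw [h4]; exact h.row, by rw [h5]; exact h.row_succ, by rw [h6]; exact h.w_eq⟩

/-- The set of numbers below `n` at which an array is not `0`. -/
def support (n : ℕ) (f : ℕ → ℕ) : Finset ℕ := (Finset.range n).filter fun v => 1 ≤ f v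

theorem mem_support {n : ℕ} {f : ℕ → ℕ} {v : ℕ} : v ∈ support n f ↔ v < n ∧ 1 ≤ f v := by
  simp [support]

theorem support_subset (n : ℕ) (f : ℕ → ℕ) : support n f ⊆ Finset.range n :=
  Finset.filter_subset _ _

variable {n : ℕ} {adj : ℕ → ℕ → Prop} {w : ℕ → ℚ} {s : State}

theorem Env.holds_adj (h : Env n adj w s) {e₁ e₂ : NExp} (h₁ : e₁.eval s < n)
    (h₂ : e₂.eval s < n) : (Cond.adj e₁ e₂).Holds s ↔ adj (e₁.eval s) (e₂.eval s) := by
  simp only [Cond.adj, Cond.holds_le, NExp.eval_const, NExp.eval_get, NExp.eval_add, h.row _ h₁,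
    h.adj_iff _ h₁ _ h₂]

theorem one_le_ite {p : Prop} [Decidable p] : (1 ≤ if p then 1 else 0) ↔ p := by
  split_ifs with h <;> simp [h]

namespace ForProg

/-! ### Counting separated pairs -/

/-- The variables `30` to `33` form a separated pair of edges in the set `X`. -/
def sepPairCond (X : ℕ) : Cond :=
  .and (.and (.lt (.var 30) (.var 31)) (.and (.le (.var 31) (.var 32)) (.lt (.var 32) (.var 33))))
    (.and (.and (.adj (.var 30) (.var 31)) (.adj (.var 32) (.var 33)))
      (.and (.mem X (.var 30)) (.and (.mem X (.var 31))
        (.and (.mem X (.var 32)) (.mem X (.var 33))))))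

/-- Innermost loop of `sepCountProg`. -/
def sepCountLoop (X c : ℕ) : ForProg :=
  .forLoop 33 0 (.ite (sepPairCond X) (.store c (.const 0) (.add (.var c) (.const 1))) .skip)

/-- Count the separated pairs of edges in the set `X`. -/
def sepCountProg (X c : ℕ) : ForProg :=
  .seq (.store c (.const 0) (.const 0))
    (.forLoop 30 0 (.forLoop 31 0 (.forLoop 32 0 (sepCountLoop X c))))

section

-- These ranges keep c apart from X, from the arrays of `Env` and from the loop counters.
variable {X c : ℕ} (hX : X < 15) (hc : 15 ≤ c) (hc' : c < 30)

include hX hc hc'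

open Classical in
theorem run_sepCountLoop (hs : Env n adj w s) (h0 : s.nat 30 0 < n) (h1 : s.nat 31 0 < n)
    (h2 : s.nat 32 0 < n) :
    ((sepCountLoop X c).run s).nat c 0 = s.nat c 0 + ∑ d ∈ Finset.range n,
      if SepPair adj (support n (s.nat X)) (s.nat 30 0) (s.nat 31 0) (s.nat 32 0) d
        then 1 else 0 := by
  refine forLoop_nat_sum hs.n_eq _ (by omega) fun i s' hi hA hctr => ?_
  have hs' : Env n adj w s' := hs.of_agree hA (by simp [natWrites]; omega) (by simp [wtWrites])
  have e0 : s'.nat 30 = s.nat 30 := hA.nat _ (by simp [natWrites]; omega)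
  have e1 : s'.nat 31 = s.nat 31 := hA.nat _ (by simp [natWrites]; omega)
  have e2 : s'.nat 32 = s.nat 32 := hA.nat _ (by simp [natWrites]; omega)
  have eX : s'.nat X = s.nat X := hA.nat _ (by simp [natWrites]; omega)
  have hiff : (sepPairCond X).Holds s' ↔
      SepPair adj (support n (s.nat X)) (s.nat 30 0) (s.nat 31 0) (s.nat 32 0) i := by
    have a1 := hs'.holds_adj (e₁ := .var 30) (e₂ := .var 31) (by simpa [e0] using h0)
      (by simpa [e1] using h1)
    have a2 := hs'.holds_adj (e₁ := .var 32) (e₂ := .var 33) (by simpa [e2] using h2)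
      (by simpa [hctr] using hi)
    unfold sepPairCond SepPair
    simp only [Cond.holds_and, a1, a2]
    simp [e0, e1, e2, eX, hctr, mem_support, h0, h1, h2, hi]
  rw [run_ite]
  simp only [hiff]
  split_ifs <;> simp

theorem run_sepCountProg (hs : Env n adj w s) :
    ((sepCountProg X c).run s).nat c 0 = sepCount adj n (support n (s.nat X)) := by
  classical
  rw [sepCountProg, run_seq]
  set s₀ := (store c (.const 0) (.const 0)).run s with hs₀
  have hA₀ := agree_run (store c (.const 0) (.const 0)) s
  have hs₀' : Env n adj w s₀ := hs.of_agree hA₀ (by simp [natWrites]; omega) (by simp [wtWrites])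
  have eX₀ : s₀.nat X = s.nat X := hA₀.nat _ (by simp [natWrites]; omega)
  have hc0 : s₀.nat c 0 = 0 := by simp [hs₀]
  rw [← eX₀]
  have main : ((ForProg.forLoop 30 0 (.forLoop 31 0 (.forLoop 32 0 (sepCountLoop X c)))).run s₀).nat
      c 0 = s₀.nat c 0 + ∑ a ∈ Finset.range n, ∑ b ∈ Finset.range n,
        ∑ c ∈ Finset.range n, ∑ d ∈ Finset.range n,
          if SepPair adj (support n (s₀.nat X)) a b c d then 1 else 0 := by
    refine forLoop_nat_sum hs₀'.n_eq _ (by omega) fun a s₁ ha hA₁ hctr₁ => ?_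
    have hs₁ : Env n adj w s₁ := hs₀'.of_agree hA₁ (by simp [natWrites, sepCountLoop]; omega)
      (by simp [wtWrites, sepCountLoop])
    have eX₁ : s₁.nat X = s₀.nat X := hA₁.nat _ (by simp [natWrites, sepCountLoop]; omega)
    rw [← eX₁]
    refine forLoop_nat_sum hs₁.n_eq _ (by omega) fun b s₂ hb hA₂ hctr₂ => ?_
    have hs₂ : Env n adj w s₂ := hs₁.of_agree hA₂ (by simp [natWrites, sepCountLoop]; omega)
      (by simp [wtWrites, sepCountLoop])
    have eX₂ : s₂.nat X = s₁.nat X := hA₂.nat _ (by simp [natWrites, sepCountLoop]; omega)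
    have e30 : s₂.nat 30 = s₁.nat 30 := hA₂.nat _ (by simp [natWrites, sepCountLoop]; omega)
    rw [← eX₂]
    refine forLoop_nat_sum hs₂.n_eq _ (by omega) fun c' s₃ hc' hA₃ hctr₃ => ?_
    have hs₃ : Env n adj w s₃ := hs₂.of_agree hA₃ (by simp [natWrites, sepCountLoop]; omega)
      (by simp [wtWrites, sepCountLoop])
    have eX₃ : s₃.nat X = s₂.nat X := hA₃.nat _ (by simp [natWrites, sepCountLoop]; omega)
    have e30' : s₃.nat 30 = s₂.nat 30 := hA₃.nat _ (by simp [natWrites, sepCountLoop]; omega)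
    have e31 : s₃.nat 31 = s₂.nat 31 := hA₃.nat _ (by simp [natWrites, sepCountLoop]; omega)
    have h30 : s₃.nat 30 0 = a := by rw [e30', e30, hctr₁]
    have h31 : s₃.nat 31 0 = b := by rw [e31, hctr₂]
    rw [run_sepCountLoop hX hc (by assumption) hs₃ (by omega) (by omega) (by omega), h30, h31,
      hctr₃, eX₃]
  rw [main, hc0, zero_add]
  rfl

end

/-! ### Branching -/

/-- Compute the set of vertices that are left after the removal of the closed neighbourhood of the
vertex in the variable `34`. -/
def reduceProg : ForProg :=
  .forLoop 35 0
    (.ite (.and (.mem 12 (.var 35))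
        (.and (.not (.eq (.var 35) (.var 34))) (.not (.adj (.var 35) (.var 34)))))
      (.store 14 (.var 35) (.const 1)) (.store 14 (.var 35) (.const 0)))

/-- Branch on the vertex in the variable `34`, if this is appropriate. -/
def branchStepProg : ForProg :=
  .seq reduceProg (.seq (sepCountProg 12 15) (.seq (sepCountProg 14 16)
    (.ite (.and (.mem 12 (.var 34))
        (.and (.le (.const 1) (.var 15)) (.le (.add (.var 16) (.var 16)) (.var 15))))
      (.ite (.mem 11 (.var 34))
        (.seq (.store 13 (.var 34) (.const 1))
          (.forLoop 35 0 (.store 12 (.var 35) (.get 14 (.var 35)))))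
        (.store 12 (.var 34) (.const 0)))
      .skip)))

/-- The branching stage. -/
def branchProg : ForProg :=
  .seq (.forLoop 34 0 (.seq (.store 12 (.var 34) (.const 1)) (.store 13 (.var 34) (.const 0))))
    (.forLoop 36 3 (.forLoop 34 0 branchStepProg))

theorem run_reduceProg (hs : Env n adj w s) (hv : s.nat 34 0 < n) :
    support n ((reduceProg.run s).nat 14) =
      removeNbhd adj (support n (s.nat 12)) (s.nat 34 0) := by
  classical
  have h := forLoop_nat_map (a := 35) (b := 0) (c := 14) (s := s) hs.n_eq
    (fun u => if 1 ≤ s.nat 12 u ∧ u ≠ s.nat 34 0 ∧ ¬ adj u (s.nat 34 0) then 1 else 0)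
    (p := (.ite (.and (.mem 12 (.var 35))
        (.and (.not (.eq (.var 35) (.var 34))) (.not (.adj (.var 35) (.var 34)))))
      (.store 14 (.var 35) (.const 1)) (.store 14 (.var 35) (.const 0))))
    (by decide) fun i s' hi hA hctr j => by
      have hs' : Env n adj w s' := hs.of_agree hA (by decide) (by decide)
      have e34 : s'.nat 34 = s.nat 34 := hA.nat _ (by decide)
      have e12 : s'.nat 12 = s.nat 12 := hA.nat _ (by decide)
      have a1 := hs'.holds_adj (e₁ := .var 35) (e₂ := .var 34) (by simpa [hctr] using hi)
        (by simpa [e34] using hv)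
      simp only [NExp.eval_get, NExp.eval_const, hctr, e34] at a1
      rw [run_ite]
      simp only [Cond.holds_and, Cond.holds_not, a1]
      simp only [Cond.holds_le, NExp.eval_const, NExp.eval_get, hctr, e34, e12,
        ← le_antisymm_iff, ne_eq]
      split_ifs <;> simp_all
  ext u
  rw [mem_support, mem_removeNbhd, mem_support, reduceProg, h]
  by_cases hu : u < n
  · simp [hu, one_le_ite]
  · simp [hu]

theorem run_copy {a b c d m : ℕ} (hcd : c ≠ d) (hca : c ≠ a) (hda : d ≠ a) (hm : s.nat b 0 = m)
    (j : ℕ) : ((forLoop a b (.store c (.var a) (.get d (.var a)))).run s).nat c j =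
      if j < m then s.nat d j else s.nat c j := by
  refine forLoop_nat_map hm _ hca (fun i s' hi hA hctr j => ?_) j
  have ed : s'.nat d = s.nat d := hA.nat _ (by simp [natWrites]; omega)
  simp [hctr, ed]

theorem support_copy {a b c d : ℕ} (hcd : c ≠ d) (hca : c ≠ a) (hda : d ≠ a)
    (hm : s.nat b 0 = n) :
    support n (((forLoop a b (.store c (.var a) (.get d (.var a)))).run s).nat c) =
      support n (s.nat d) := by
  ext u
  rw [mem_support, mem_support, run_copy hcd hca hda hm]
  by_cases hu : u < n <;> simp [hu]

theorem support_store_one {X v : ℕ} {e : NExp} (he : e.eval s = v) (hv : v < n) :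
    support n (((store X e (.const 1)).run s).nat X) = insert v (support n (s.nat X)) := by
  ext u
  simp only [mem_support, run_store, State.setNat_nat, he, Finset.mem_insert, true_and,
    NExp.eval_const]
  split_ifs with h
  · simp [h, hv]
  · simp [h]

theorem support_store_zero {X v : ℕ} {e : NExp} (he : e.eval s = v) :
    support n (((store X e (.const 0)).run s).nat X) = (support n (s.nat X)).erase v := by
  ext u
  simp only [mem_support, run_store, State.setNat_nat, he, Finset.mem_erase, true_and,
    NExp.eval_const]
  split_ifs with h
  · simp [h]
  · simp [h]

/-- The reduced set is built separately in array `14`, since its count decides whether to branch at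
all; it replaces array `12` only if the vertex is taken. -/
theorem run_branchStepProg (hs : Env n adj w s) (hv : s.nat 34 0 < n) :
    (support n ((branchStepProg.run s).nat 12), support n ((branchStepProg.run s).nat 13)) =
      branchStep adj n {u | 1 ≤ s.nat 11 u} (support n (s.nat 12), support n (s.nat 13))
        (s.nat 34 0) := by
  classical
  simp only [branchStepProg, run_seq]
  set s₁ := reduceProg.run s with h₁
  have hA₁ := agree_run reduceProg s
  set s₂ := (sepCountProg 12 15).run s₁ with h₂
  have hA₂ := agree_run (sepCountProg 12 15) s₁
  set s₃ := (sepCountProg 14 16).run s₂ with h₃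
  have hA₃ := agree_run (sepCountProg 14 16) s₂
  have hs₁ : Env n adj w s₁ := hs.of_agree hA₁ (by decide) (by decide)
  have hs₂ : Env n adj w s₂ := hs₁.of_agree hA₂ (by decide) (by decide)
  have e34 : s₃.nat 34 = s.nat 34 := ((hA₃.nat 34 (by decide)).trans (hA₂.nat 34 (by decide))).trans
    (hA₁.nat 34 (by decide))
  have e11 : s₃.nat 11 = s.nat 11 := ((hA₃.nat 11 (by decide)).trans (hA₂.nat 11 (by decide))).trans
    (hA₁.nat 11 (by decide))
  have e12 : s₃.nat 12 = s.nat 12 := ((hA₃.nat 12 (by decide)).trans (hA₂.nat 12 (by decide))).trans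
    (hA₁.nat 12 (by decide))
  have e13 : s₃.nat 13 = s.nat 13 := ((hA₃.nat 13 (by decide)).trans (hA₂.nat 13 (by decide))).trans
    (hA₁.nat 13 (by decide))
  have e14 : s₃.nat 14 = s₁.nat 14 := (hA₃.nat 14 (by decide)).trans (hA₂.nat 14 (by decide))
  have e0 : s₃.nat 0 0 = n := by
    rw [hA₃.nat 0 (by decide), hs₂.n_eq]
  have c15 : s₃.nat 15 0 = sepCount adj n (support n (s.nat 12)) := by
    rw [hA₃.nat 15 (by decide), run_sepCountProg (by decide) (by decide) (by decide) hs₁,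
      hA₁.nat 12 (by decide)]
  have c16 : s₃.nat 16 0 =
      sepCount adj n (removeNbhd adj (support n (s.nat 12)) (s.nat 34 0)) := by
    rw [run_sepCountProg (by decide) (by decide) (by decide) hs₂,
      hA₂.nat 14 (by decide), run_reduceProg hs hv]
  have hb : (Cond.and (.mem 12 (.var 34)) (.and (.le (.const 1) (.var 15))
      (.le (.add (.var 16) (.var 16)) (.var 15)))).Holds s₃ ↔
      Branches adj n (support n (s.nat 12)) (s.nat 34 0) := by
    simp [Branches, e34, e12, c15, c16, mem_support, hv, two_mul, Nat.one_le_iff_ne_zero,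
      Nat.pos_iff_ne_zero]
  rw [run_ite]
  unfold branchStep
  simp only [hb]
  split_ifs with h4 h5
  · rw [run_ite, if_pos (by simpa [e11, e34] using h5), run_seq]
    rw [support_copy (by decide) (by decide) (by decide), run_nat_of_notMem (a := 13) (h := by decide),
      support_store_one (v := s.nat 34 0) (by simp [e34]) hv, e13,
      run_nat_of_notMem (a := 14) (h := by decide), e14, run_reduceProg hs hv]
    rw [run_nat_of_notMem (h := by decide), e0]
  · rw [run_ite, if_neg (by simpa [e11, e34] using h5)]
    rw [run_nat_of_notMem (a := 13) (h := by decide), e13,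
      support_store_zero (v := s.nat 34 0) (by simp [e34]), e12]
  · rw [run_skip, e12, e13]

theorem run_branchProg (hs : Env n adj w s) :
    (support n ((branchProg.run s).nat 12), support n ((branchProg.run s).nat 13)) =
      (branchPass adj n {u | 1 ≤ s.nat 11 u})^[n + 1] (Finset.range n, ∅) := by
  rw [branchProg, run_seq]
  set p₀ : ForProg := .seq (.store 12 (.var 34) (.const 1)) (.store 13 (.var 34) (.const 0))
  set s₀ := (ForProg.forLoop 34 0 p₀).run s with h₀
  have hA₀ := agree_run (ForProg.forLoop 34 0 p₀) s
  have hs₀ : Env n adj w s₀ := hs.of_agree hA₀ (by decide) (by decide)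
  have e12 : support n (s₀.nat 12) = Finset.range n := by
    ext u
    rw [mem_support, forLoop_nat_map hs.n_eq (fun _ => 1) (by decide)
      fun i s' hi hA hctr j => by simp [p₀, hctr]]
    simp +contextual
  have e13 : support n (s₀.nat 13) = ∅ := by
    ext u
    rw [mem_support, forLoop_nat_map hs.n_eq (fun _ => 0) (by decide)
      fun i s' hi hA hctr j => by simp [p₀, hctr]]
    simp +contextual
  have e11 : s₀.nat 11 = s.nat 11 := hA₀.nat _ (by decide)
  rw [← e12, ← e13, ← foldl_range_const, ← e11]
  refine forLoop_foldl (abs := fun s => (support n (s.nat 12), support n (s.nat 13)))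
    hs₀.n_succ _ (fun s' x => by simp [State.setNat]) fun i s₁ hi hA₁ hctr₁ => ?_
  have hs₁ : Env n adj w s₁ := hs₀.of_agree hA₁ (by decide) (by decide)
  have e11' : s₁.nat 11 = s₀.nat 11 := hA₁.nat _ (by decide)
  refine forLoop_foldl (abs := fun s => (support n (s.nat 12), support n (s.nat 13)))
    hs₁.n_eq _ (fun s' x => by simp [State.setNat]) fun v s₂ hv hA₂ hctr₂ => ?_
  have hs₂ : Env n adj w s₂ := hs₁.of_agree hA₂ (by decide) (by decide)
  have e11'' : s₂.nat 11 = s₁.nat 11 := hA₂.nat _ (by decide)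
  have := run_branchStepProg hs₂ (by omega)
  rw [hctr₂, e11'', e11'] at this
  exact this

end ForProg

end WeightRAM

namespace WeightRAM

variable {n : ℕ} {adj : ℕ → ℕ → Prop} {w : ℕ → ℚ} {s : State}

/-- The preflow that a memory state describes. -/
def flowState (n : ℕ) (s : State) : Preflow (Fin (n + 1)) where
  ex u := s.wt 2 u
  res u v := s.wt 3 (u * (n + 1) + v)
  ht u := s.nat 17 u

theorem row_add_inj {n : ℕ} (a b u v : Fin (n + 1)) :
    (a : ℕ) * (n + 1) + b = u * (n + 1) + v ↔ a = u ∧ b = v := by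
  constructor
  · intro h
    have h1 : ((b : ℕ) + (n + 1) * a) / (n + 1) = ((v : ℕ) + (n + 1) * u) / (n + 1) := by
      rw [mul_comm, add_comm, mul_comm (n + 1) (u : ℕ), add_comm (v : ℕ), ← h]
    have h2 : ((b : ℕ) + (n + 1) * a) % (n + 1) = ((v : ℕ) + (n + 1) * u) % (n + 1) := by
      rw [mul_comm, add_comm, mul_comm (n + 1) (u : ℕ), add_comm (v : ℕ), ← h]
    rw [Nat.add_mul_div_left _ _ (by omega), Nat.add_mul_div_left _ _ (by omega),
      Nat.div_eq_of_lt b.2, Nat.div_eq_of_lt v.2, zero_add, zero_add] at h1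
    rw [Nat.add_mul_mod_self_left, Nat.add_mul_mod_self_left, Nat.mod_eq_of_lt b.2,
      Nat.mod_eq_of_lt v.2] at h2
    exact ⟨Fin.ext h1, Fin.ext h2⟩
  · rintro ⟨rfl, rfl⟩
    rfl

namespace ForProg

/-- A loop that clears a flag if some round finds a witness. -/
theorem forLoop_flag {a b c : ℕ} {p : ForProg} {s : State} {m : ℕ} (hm : s.nat b 0 = m)
    (P : ℕ → Prop) (hca : c ≠ a)
    (h : ∀ i s', i < m → Agree (a :: p.natWrites) p.wtWrites s s' → s'.nat a 0 = i →
      (1 ≤ (p.run s').nat c 0 ↔ 1 ≤ s'.nat c 0 ∧ ¬ P i)) :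
    1 ≤ ((forLoop a b p).run s).nat c 0 ↔ 1 ≤ s.nat c 0 ∧ ∀ i < m, ¬ P i := by
  subst hm
  refine forLoop_induction rfl
    (I := fun j s' => 1 ≤ s'.nat c 0 ↔ 1 ≤ s.nat c 0 ∧ ∀ i < j, ¬ P i)
    (by simp [hca]) fun i s' hi hA hc hI => ?_
  have := h i s' hi hA hc
  simp only [State.setNat_nat, hca, false_and, if_false, this, hI]
  constructor
  · rintro ⟨⟨h1, h2⟩, h3⟩
    refine ⟨h1, fun j hj => ?_⟩
    rcases Nat.lt_succ_iff_lt_or_eq.1 hj with hj | rfl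
    · exact h2 j hj
    · exact h3
  · rintro ⟨h1, h2⟩
    exact ⟨⟨h1, fun j hj => h2 j (by omega)⟩, h2 i (by omega)⟩

/-! ### The network -/

/-- The position of the residual capacity of the arc between the vertices in two variables. -/
abbrev resIndex (a b : ℕ) : NExp := .add (.get 5 (.var a)) (.var b)

/-- Compute the weights of the vertices that are left. -/
def flowWeightProg : ForProg :=
  .forLoop 38 3 (.ite (.and (.lt (.var 38) (.var 0)) (.mem 12 (.var 38)))
    (.wstore 6 (.var 38) (.get 0 (.var 38))) (.wstore 6 (.var 38) .zero))

/-- Compute the capacity of the arc between the vertices in the variables `38` and `39`. -/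
def capacityProg : ForProg :=
  .ite (.and (.and (.lt (.var 38) (.var 37)) (.and (.le (.var 37) (.var 39))
      (.lt (.var 39) (.var 0)))) (.adj (.var 38) (.var 39)))
    (.wstore 3 (resIndex 38 39) (.add (.get 6 (.var 38)) (.get 6 (.var 38))))
    (.ite (.and (.eq (.var 39) (.var 0)) (.and (.le (.var 37) (.var 38))
        (.lt (.var 38) (.var 0))))
      (.wstore 3 (resIndex 38 39) (.get 6 (.var 38)))
      (.wstore 3 (resIndex 38 39) .zero))

/-- Set up the network for the cut in the variable `37`. -/
def flowInitProg : ForProg :=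
  .forLoop 38 3 (.seq (.store 17 (.var 38) (.const 0))
    (.seq (.ite (.lt (.var 38) (.var 37)) (.wstore 2 (.var 38) (.get 6 (.var 38)))
        (.wstore 2 (.var 38) .zero))
      (.forLoop 39 3 capacityProg)))

theorem run_flowWeightProg (hs : Env n adj w s) {u : ℕ} (hu : u < n + 1) :
    (flowWeightProg.run s).wt 6 u = if u ∈ support n (s.nat 12) then w u else 0 := by
  have := forLoop_wt_map hs.n_succ (p := (.ite (.and (.lt (.var 38) (.var 0)) (.mem 12 (.var 38)))
      (.wstore 6 (.var 38) (.get 0 (.var 38))) (.wstore 6 (.var 38) .zero))) (a := 38) (c := 6)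
    (fun u => if u ∈ support n (s.nat 12) then w u else 0) 0 (fun i s' hi hA hctr j => by
      have hs' : Env n adj w s' := hs.of_agree hA (by decide) (by decide)
      have e12 : s'.nat 12 = s.nat 12 := hA.nat _ (by decide)
      rw [run_ite]
      simp only [Cond.holds_and, Cond.holds_not, Cond.holds_le, NExp.eval_get, NExp.eval_const,
        hctr, hs'.n_eq, e12, not_le, mem_support]
      split_ifs <;> simp_all [hs'.w_eq]) u
  rw [flowWeightProg, this, if_pos (by omega)]
  rfl

theorem run_capacityProg (hs : Env n adj w s) {u v : Fin (n + 1)} (hu : s.nat 38 0 = u)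
    (hv : s.nat 39 0 = v) (hp : s.nat 37 0 ≤ n) (j : ℕ) :
    (capacityProg.run s).wt 3 j = if j = u * (n + 1) + v then
      Preflow.bipCapacity (fun u : Fin (n + 1) => (u : ℕ) < s.nat 37 0)
        (fun u : Fin (n + 1) => s.nat 37 0 ≤ u ∧ (u : ℕ) < n) (fun u v => adj u v)
        (fun u => s.wt 6 u) (Fin.last n) u v else s.wt 3 j := by
  have hu' := u.2
  have hv' := v.2
  have h1 : (Cond.and (.and (.lt (.var 38) (.var 37)) (.and (.le (.var 37) (.var 39))
      (.lt (.var 39) (.var 0)))) (.adj (.var 38) (.var 39))).Holds s ↔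
      ((u : ℕ) < s.nat 37 0 ∧ (s.nat 37 0 ≤ v ∧ (v : ℕ) < n) ∧ adj u v) := by
    rw [Cond.holds_and]
    have h2 : (Cond.and (.lt (.var 38) (.var 37)) (.and (.le (.var 37) (.var 39))
        (.lt (.var 39) (.var 0)))).Holds s ↔
        ((u : ℕ) < s.nat 37 0 ∧ (s.nat 37 0 ≤ v ∧ (v : ℕ) < n)) := by
      simp [hu, hv, hs.n_eq]
    rw [h2, and_assoc]
    refine and_congr_right fun h3 => and_congr_right fun h4 => ?_
    rw [hs.holds_adj (by simp [hu]; omega) (by simp [hv]; omega)]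
    simp [hu, hv]
  have h3 : (Cond.and (.eq (.var 39) (.var 0)) (.and (.le (.var 37) (.var 38))
        (.lt (.var 38) (.var 0)))).Holds s ↔
      ((s.nat 37 0 ≤ u ∧ (u : ℕ) < n) ∧ v = Fin.last n) := by
    simp only [Cond.holds_and, Cond.holds_not, Cond.holds_le, NExp.eval_get, NExp.eval_const,
      hu, hv, hs.n_eq, not_le, Fin.ext_iff, Fin.val_last]
    omega
  unfold capacityProg Preflow.bipCapacity
  rw [run_ite, run_ite]
  simp only [h1, h3]
  split_ifs <;> simp_all [hs.row_succ u hu']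

theorem run_flowInitProg (hs : Env n adj w s) (hp : s.nat 37 0 ≤ n) :
    flowState n (flowInitProg.run s) =
      Preflow.bipStart (fun u : Fin (n + 1) => (u : ℕ) < s.nat 37 0)
        (fun u : Fin (n + 1) => s.nat 37 0 ≤ u ∧ (u : ℕ) < n) (fun u v => adj u v)
        (fun u => s.wt 6 u) (Fin.last n) := by
  set c := Preflow.bipCapacity (fun u : Fin (n + 1) => (u : ℕ) < s.nat 37 0)
        (fun u : Fin (n + 1) => s.nat 37 0 ≤ u ∧ (u : ℕ) < n) (fun u v => adj u v)
        (fun u => s.wt 6 u) (Fin.last n) with hc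
  have key : ∀ u : Fin (n + 1), (u : ℕ) < n + 1 → (flowInitProg.run s).nat 17 u = 0 ∧
      (flowInitProg.run s).wt 2 u = (if (u : ℕ) < s.nat 37 0 then s.wt 6 u else 0) ∧
      ∀ v : Fin (n + 1), (flowInitProg.run s).wt 3 (u * (n + 1) + v) = c u v := by
    refine forLoop_induction hs.n_succ (I := fun i s' => ∀ u : Fin (n + 1), (u : ℕ) < i → s'.nat 17 u = 0 ∧
      s'.wt 2 u = (if (u : ℕ) < s.nat 37 0 then s.wt 6 u else 0) ∧
      ∀ v : Fin (n + 1), s'.wt 3 (u * (n + 1) + v) = c u v) (fun u hu => by omega) ?_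
    intro i s₁ hi hA₁ hctr₁ hI u hu
    have hs₁ : Env n adj w s₁ := hs.of_agree hA₁ (by decide) (by decide)
    have e37 : s₁.nat 37 = s.nat 37 := hA₁.nat _ (by decide)
    have e6 : s₁.wt 6 = s.wt 6 := hA₁.wt _ (by decide)
    rw [run_seq, run_seq]
    set s₂ := (store 17 (.var 38) (.const 0)).run s₁ with h₂
    have hA₂ := agree_run (store 17 (.var 38) (.const 0)) s₁
    have hs₂ : Env n adj w s₂ := hs₁.of_agree hA₂ (by decide) (by decide)
    set q : ForProg := .ite (.lt (.var 38) (.var 37)) (.wstore 2 (.var 38) (.get 6 (.var 38)))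
        (.wstore 2 (.var 38) .zero) with hq
    set s₃ := q.run s₂ with h₃
    have hA₃ := agree_run q s₂
    have hs₃ : Env n adj w s₃ := hs₂.of_agree hA₃ (by decide) (by decide)
    set s₄ := (forLoop 39 3 capacityProg).run s₃ with h₄
    have hA₄ := agree_run (forLoop 39 3 capacityProg) s₃
    have e17 : s₄.nat 17 u = if (u : ℕ) = i then 0 else s₁.nat 17 u := by
      rw [hA₄.nat 17 (by decide), hA₃.nat 17 (by decide), h₂]
      simp [hctr₁]
    have c38 : s₂.nat 38 0 = i := by rw [hA₂.nat 38 (by decide), hctr₁]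
    have c37 : s₂.nat 37 = s.nat 37 := by rw [hA₂.nat 37 (by decide), e37]
    have c6 : s₂.wt 6 = s.wt 6 := by rw [hA₂.wt 6 (by decide), e6]
    have c2 : s₂.wt 2 = s₁.wt 2 := hA₂.wt 2 (by decide)
    have e2 : s₄.wt 2 u = if (u : ℕ) = i then (if (u : ℕ) < s.nat 37 0 then s.wt 6 u else 0)
        else s₁.wt 2 u := by
      rw [hA₄.wt 2 (by decide), h₃, hq, run_ite]
      by_cases h1 : i < s.nat 37 0
      · rw [if_pos (by simpa [c38, c37] using h1)]
        by_cases hui : (u : ℕ) = i <;> simp [hui, h1, c38, c6, c2]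
      · rw [if_neg (by simpa [c38, c37] using h1)]
        by_cases hui : (u : ℕ) = i <;> simp [hui, h1, c38, c2]
    have c38' : s₃.nat 38 0 = i := by rw [hA₃.nat 38 (by decide), c38]
    have c37' : s₃.nat 37 = s.nat 37 := by rw [hA₃.nat 37 (by decide), c37]
    have c6' : s₃.wt 6 = s.wt 6 := by rw [hA₃.wt 6 (by decide), c6]
    have c3' : s₃.wt 3 = s₁.wt 3 := by rw [hA₃.wt 3 (by decide), hA₂.wt 3 (by decide)]
    have hi' : i < n + 1 := hi
    -- The inner loop fills exactly row i, that is, `n + 1` consecutive cells. `Fin.ofNat` changes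
    -- nothing on indices in range.
    have e3 : ∀ j, s₄.wt 3 j = if i * (n + 1) ≤ j ∧ j < i * (n + 1) + (n + 1) then
        c (Fin.ofNat (n + 1) i) (Fin.ofNat (n + 1) (j - i * (n + 1))) else s₃.wt 3 j := by
      refine forLoop_wt_map hs₃.n_succ
        (fun v => c (Fin.ofNat (n + 1) i) (Fin.ofNat (n + 1) v)) (i * (n + 1)) ?_
      intro v s₅ hv hA₅ hctr₅ j
      have hs₅ : Env n adj w s₅ := hs₃.of_agree hA₅ (by decide) (by decide)
      have d37 : s₅.nat 37 = s.nat 37 := by rw [hA₅.nat 37 (by decide), c37']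
      have d6 : s₅.wt 6 = s.wt 6 := by rw [hA₅.wt 6 (by decide), c6']
      have d38 : s₅.nat 38 0 = i := by rw [hA₅.nat 38 (by decide), c38']
      have vi : ((Fin.ofNat (n + 1) i : Fin (n + 1)) : ℕ) = i := Nat.mod_eq_of_lt hi'
      have vv : ((Fin.ofNat (n + 1) v : Fin (n + 1)) : ℕ) = v := Nat.mod_eq_of_lt hv
      have := run_capacityProg hs₅ (u := Fin.ofNat (n + 1) i) (v := Fin.ofNat (n + 1) v)
        (by rw [d38, vi]) (by rw [hctr₅, vv]) (by rw [d37]; exact hp) j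
      rw [this, vi, vv, d37, d6]
    simp only [State.setNat_nat, State.setNat_wt, show ¬ (17 = 38) by decide, false_and, if_false]
    have hrange : ∀ v : Fin (n + 1), (i * (n + 1) ≤ (u : ℕ) * (n + 1) + v ∧
        (u : ℕ) * (n + 1) + v < i * (n + 1) + (n + 1)) ↔ (u : ℕ) = i := by
      intro v
      have hv := v.2
      constructor
      · rintro ⟨h1, h2⟩
        rcases lt_trichotomy (u : ℕ) i with h | h | h
        · have := Nat.mul_le_mul_right (n + 1) (Nat.succ_le_of_lt h)
          rw [Nat.succ_mul] at this
          omega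
        · exact h
        · have := Nat.mul_le_mul_right (n + 1) (Nat.succ_le_of_lt h)
          rw [Nat.succ_mul] at this
          omega
      · intro h
        rw [h]
        omega
    by_cases hui : (u : ℕ) = i
    · refine ⟨by rw [e17, if_pos hui], by rw [e2, if_pos hui], fun v => ?_⟩
      rw [e3, if_pos ((hrange v).2 hui)]
      have h1 : Fin.ofNat (n + 1) i = u := by
        rw [← hui]; exact Fin.ext (Nat.mod_eq_of_lt u.2)
      have h2 : Fin.ofNat (n + 1) ((u : ℕ) * (n + 1) + v - i * (n + 1)) = v := by
        rw [← hui, Nat.add_sub_cancel_left]; exact Fin.ext (Nat.mod_eq_of_lt v.2)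
      rw [h1, h2]
    · obtain ⟨h1, h2, h3⟩ := hI u (by omega)
      refine ⟨by rw [e17, if_neg hui, h1], by rw [e2, if_neg hui, h2], fun v => ?_⟩
      rw [e3, if_neg (fun h => hui ((hrange v).1 h)), c3', h3]
  ext u v
  · exact (key u u.2).2.1.trans (by simp [Preflow.bipStart, Preflow.bipSupply])
  · exact (key u u.2).2.2 v
  · exact (key u u.2).1

/-! ### Push and relabel -/

/-- The arc between the vertices in the variables `38` and `39` is admissible. -/
def admissibleCond : Cond :=
  .and (.wlt .zero (.get 3 (resIndex 38 39)))
    (.eq (.get 17 (.var 38)) (.add (.get 17 (.var 39)) (.const 1)))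

/-- Push from the vertex in the variable `38` to the vertex in the variable `39`. -/
def pushProg : ForProg :=
  .ite (.and (.wlt .zero (.get 2 (.var 38))) admissibleCond)
    (.seq (.wstore 4 (.const 0) (.get 2 (.var 38)))
    (.seq (.ite (.wlt (.get 3 (resIndex 38 39)) (.var 4))
      (.wstore 4 (.const 0) (.get 3 (resIndex 38 39))) .skip)
    (.seq (.wstore 3 (resIndex 38 39) (.sub (.get 3 (resIndex 38 39)) (.var 4)))
    (.seq (.wstore 3 (resIndex 39 38) (.add (.get 3 (resIndex 39 38)) (.var 4)))
    (.seq (.wstore 2 (.var 38) (.sub (.get 2 (.var 38)) (.var 4)))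
      (.wstore 2 (.var 39) (.add (.get 2 (.var 39)) (.var 4)))))))) .skip

/-- Lift the vertex in the variable `38`, if this is appropriate. -/
def relabelProg : ForProg :=
  .seq (.store 18 (.const 0) (.const 1))
    (.seq (.forLoop 39 3 (.ite admissibleCond (.store 18 (.const 0) (.const 0)) .skip))
      (.ite (.and (.le (.const 1) (.var 18)) (.and (.wlt .zero (.get 2 (.var 38)))
          (.lt (.get 17 (.var 38)) (.var 3))))
        (.store 17 (.var 38) (.add (.get 17 (.var 38)) (.const 1))) .skip))

/-- Discharge all vertices. -/
def passProg : ForProg := .forLoop 38 0 (.seq (.forLoop 39 3 pushProg) relabelProg)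

/-- The push-relabel method. -/
def flowProg : ForProg := .seq flowInitProg (.forLoop 40 9 passProg)

theorem holds_admissibleCond (hs : Env n adj w s) {u v : Fin (n + 1)} (hu : s.nat 38 0 = u)
    (hv : s.nat 39 0 = v) :
    admissibleCond.Holds s ↔ (flowState n s).Admissible u v := by
  simp [admissibleCond, Preflow.Admissible, flowState, hu, hv, hs.row_succ u u.2, le_antisymm_iff]

theorem run_pushProg (hs : Env n adj w s) {u v : Fin (n + 1)} (hu : s.nat 38 0 = u)
    (hv : s.nat 39 0 = v) :
    flowState n (pushProg.run s) = (flowState n s).push u v := by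
  have hcond : (Cond.and (.wlt .zero (.get 2 (.var 38))) admissibleCond).Holds s ↔
      0 < (flowState n s).ex u ∧ (flowState n s).Admissible u v := by
    rw [Cond.holds_and, holds_admissibleCond hs hu hv]
    simp [flowState, hu]
  unfold pushProg Preflow.push
  rw [run_ite]
  by_cases h : 0 < (flowState n s).ex u ∧ (flowState n s).Admissible u v
  swap
  · rw [if_neg (mt hcond.1 h), if_neg h, run_skip]
  rw [if_pos (hcond.2 h), if_pos h]
  have hd : (min ((flowState n s).ex u) ((flowState n s).res u v)) =
      if s.wt 3 (u * (n + 1) + v) < s.wt 2 u then s.wt 3 (u * (n + 1) + v) else s.wt 2 u := by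
    simp only [flowState]
    rw [min_def]
    split_ifs with h1 h2 h2
    · exact absurd h1 (not_le.2 h2)
    · rfl
    · rfl
    · exact absurd (not_lt.1 h2) h1
  set s₁ := (wstore 4 (.const 0) (.get 2 (.var 38))).run s with h₁
  set s₂ := (ite (.wlt (.get 3 (resIndex 38 39)) (.var 4))
      (.wstore 4 (.const 0) (.get 3 (resIndex 38 39))) .skip).run s₁ with h₂
  rw [run_seq, run_seq]
  have hA₁ := agree_run (wstore 4 (.const 0) (.get 2 (.var 38))) s
  have hA₂ := agree_run (ite (.wlt (.get 3 (resIndex 38 39)) (.var 4))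
      (.wstore 4 (.const 0) (.get 3 (resIndex 38 39))) .skip) s₁
  have hn : s₂.nat = s.nat := by
    funext c
    rw [hA₂.nat c (by simp [natWrites]), hA₁.nat c (by simp [natWrites])]
  have w2 : s₂.wt 2 = s.wt 2 := by rw [hA₂.wt 2 (by decide), hA₁.wt 2 (by decide)]
  have w3 : s₂.wt 3 = s.wt 3 := by rw [hA₂.wt 3 (by decide), hA₁.wt 3 (by decide)]
  have w4 : s₂.wt 4 0 = min ((flowState n s).ex u) ((flowState n s).res u v) := by
    rw [hd, h₂, h₁, run_ite]
    simp only [run_wstore, Cond.holds_not, Cond.holds_wle, WExp.eval_get, NExp.eval_get,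
      NExp.eval_const, NExp.eval_add, State.setWt_wt, State.setWt_nat, hu, hv,
      hs.row_succ u u.2, not_le]
    simp only [show ¬ ((3 : ℕ) = 4) by decide, false_and, if_false, and_self, if_true]
    split_ifs <;> simp
  rw [← h₁, ← h₂]
  set d := min ((flowState n s).ex u) ((flowState n s).res u v)
  have hru : s₂.nat 5 u = u * (n + 1) := by rw [hn]; exact hs.row_succ u u.2
  have hrv : s₂.nat 5 v = v * (n + 1) := by rw [hn]; exact hs.row_succ v v.2
  have hu₂ : s₂.nat 38 0 = u := by rw [hn]; exact hu
  have hv₂ : s₂.nat 39 0 = v := by rw [hn]; exact hv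
  simp only [run_seq, run_wstore, NExp.eval_get, NExp.eval_add, NExp.eval_const, WExp.eval_sub,
    WExp.eval_add, WExp.eval_get, State.setWt_nat, State.setWt_wt, hu₂, hv₂, hru, hrv, w4]
  ext a b
  · simp only [flowState, Preflow.send, State.setWt_wt, w2, Fin.val_inj]
    simp only [show ¬ ((2 : ℕ) = 3) by decide, show ¬ ((4 : ℕ) = 2) by decide,
      show ¬ ((4 : ℕ) = 3) by decide, false_and, if_false, true_and]
    by_cases h1 : a = u <;> by_cases h2 : a = v <;> by_cases h3 : v = u <;> simp_all
  · simp only [flowState, Preflow.send, State.setWt_wt, w3, row_add_inj]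
    simp only [show ¬ ((3 : ℕ) = 2) by decide, show ¬ ((4 : ℕ) = 2) by decide,
      show ¬ ((4 : ℕ) = 3) by decide, false_and, if_false, true_and]
    -- Admissibility forces u ≠ v, so the two writes to the residual matrix hit different cells.
    have huv : u ≠ v := by
      rintro rfl
      exact absurd h.2.2 (by omega)
    by_cases h1 : a = u ∧ b = v
    · obtain ⟨rfl, rfl⟩ := h1
      simp [huv]
    · by_cases h2 : a = v ∧ b = u
      · obtain ⟨rfl, rfl⟩ := h2
        simp [huv.symm]
      · simp [h1, h2]
  · simp only [flowState, Preflow.send, State.setWt_nat, hn]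

theorem run_relabelProg (hs : Env n adj w s) {u : Fin (n + 1)} (hu : s.nat 38 0 = u)
    (hun : (u : ℕ) < n) :
    flowState n (relabelProg.run s) = (flowState n s).relabel (Fin.last n) u := by
  classical
  unfold relabelProg
  rw [run_seq, run_seq]
  set q : ForProg := .ite admissibleCond (.store 18 (.const 0) (.const 0)) .skip with hq
  set s₁ := (store 18 (.const 0) (.const 1)).run s with h₁
  have hA₁ := agree_run (store 18 (.const 0) (.const 1)) s
  have hs₁ : Env n adj w s₁ := hs.of_agree hA₁ (by decide) (by decide)
  set s₂ := (forLoop 39 3 q).run s₁ with h₂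
  have hA₂ := agree_run (forLoop 39 3 q) s₁
  have hs₂ : Env n adj w s₂ := hs₁.of_agree hA₂ (by decide) (by decide)
  have hflow : ∀ s', s'.wt 2 = s.wt 2 → s'.wt 3 = s.wt 3 → s'.nat 17 = s.nat 17 →
      flowState n s' = flowState n s := by
    intro s' h1 h2 h3
    simp only [flowState, h1, h2, h3]
  have f₂ : flowState n s₂ = flowState n s := by
    refine hflow _ ?_ ?_ ?_
    · rw [hA₂.wt 2 (by decide), hA₁.wt 2 (by decide)]
    · rw [hA₂.wt 3 (by decide), hA₁.wt 3 (by decide)]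
    · rw [hA₂.nat 17 (by decide), hA₁.nat 17 (by decide)]
  have e38 : s₂.nat 38 0 = u := by rw [hA₂.nat 38 (by decide), hA₁.nat 38 (by decide), hu]
  -- The flag is set before the loop and survives exactly if no arc out of u is admissible.
  have flag : 1 ≤ s₂.nat 18 0 ↔ ∀ v, ¬ (flowState n s).Admissible u v := by
    have := forLoop_flag (a := 39) (c := 18) (p := q) hs₁.n_succ
      (fun v => (flowState n s).Admissible u (Fin.ofNat (n + 1) v)) (by decide) ?_
    · rw [h₂, this]
      have h18 : s₁.nat 18 0 = 1 := by simp [h₁]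
      simp only [h18, le_refl, true_and]
      constructor
      · intro h v
        have := h v v.2
        rwa [show Fin.ofNat (n + 1) (v : ℕ) = v from Fin.ext (Nat.mod_eq_of_lt v.2)] at this
      · exact fun h v _ => h _
    · intro v s₃ hv hA₃ hctr₃
      have hs₃ : Env n adj w s₃ := hs₁.of_agree hA₃ (by decide) (by decide)
      have f₃ : flowState n s₃ = flowState n s := by
        refine hflow _ ?_ ?_ ?_
        · rw [hA₃.wt 2 (by decide), hA₁.wt 2 (by decide)]
        · rw [hA₃.wt 3 (by decide), hA₁.wt 3 (by decide)]
        · rw [hA₃.nat 17 (by decide), hA₁.nat 17 (by decide)]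
      have := holds_admissibleCond hs₃ (u := u) (v := Fin.ofNat (n + 1) v)
        (by rw [hA₃.nat 38 (by decide), hA₁.nat 38 (by decide), hu])
        (by rw [hctr₃]; exact (Nat.mod_eq_of_lt hv).symm)
      rw [hq, run_ite]
      simp only [this, f₃]
      split_ifs with h1
      · exact iff_of_false (by simp) fun h => h.2 h1
      · exact ⟨fun h => ⟨h, h1⟩, And.left⟩
  have hex : s₂.wt 2 u = (flowState n s).ex u := by rw [← f₂]; rfl
  have hht : s₂.nat 17 u = (flowState n s).ht u := by rw [← f₂]; rfl
  have hcond : (Cond.and (.le (.const 1) (.var 18)) (.and (.wlt .zero (.get 2 (.var 38)))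
          (.lt (.get 17 (.var 38)) (.var 3)))).Holds s₂ ↔
      (u ≠ Fin.last n ∧ 0 < (flowState n s).ex u ∧ (flowState n s).ht u < Fintype.card (Fin (n + 1)) ∧
        ∀ v, ¬ (flowState n s).Admissible u v) := by
    have hne : u ≠ Fin.last n := by
      rintro rfl
      simp at hun
    simp only [Cond.holds_and, Cond.holds_not, Cond.holds_le, Cond.holds_wle, NExp.eval_get,
      NExp.eval_const, WExp.eval_get, WExp.eval_zero, flag, e38, hs₂.n_succ, hex, hht, not_le,
      Fintype.card_fin, ne_eq, hne, not_false_eq_true, true_and]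
    tauto
  unfold Preflow.relabel
  rw [run_ite]
  simp only [hcond]
  split_ifs with h
  · rw [← f₂]
    ext a b
    · rfl
    · rfl
    · simp [flowState, e38, Fin.val_inj]
  · rw [run_skip, f₂]

/-- All vertices of the network, as a list. -/
def vertexList (n m : ℕ) : List (Fin (n + 1)) := (List.range m).map (Fin.ofNat (n + 1))

theorem mem_vertexList {n m : ℕ} {u : Fin (n + 1)} (h : (u : ℕ) < m) : u ∈ vertexList n m :=
  List.mem_map.2 ⟨u, List.mem_range.2 h, Fin.ext (Nat.mod_eq_of_lt u.2)⟩

theorem flowState_setNat {a : ℕ} (ha : a ≠ 17) (s : State) (x : ℕ) :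
    flowState n (s.setNat a 0 x) = flowState n s := by
  simp only [flowState, State.setNat_nat_of_ne _ _ _ ha.symm, State.setNat_wt]

/-- The sink is vertex n. It is a target of pushes but is never discharged, hence the lists of
lengths `n + 1` and `n`. -/
theorem run_passProg (hs : Env n adj w s) :
    flowState n (passProg.run s) =
      (flowState n s).pass (Fin.last n) (vertexList n (n + 1)) (vertexList n n) := by
  unfold passProg Preflow.pass
  rw [show vertexList n n = (List.range n).map (Fin.ofNat (n + 1)) from rfl, List.foldl_map]
  refine forLoop_foldl hs.n_eq _ _ (fun s' x => flowState_setNat (by decide) s' x)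
    fun i s₁ hi hA₁ hctr₁ => ?_
  have hs₁ : Env n adj w s₁ := hs.of_agree hA₁ (by decide) (by decide)
  have vi : ((Fin.ofNat (n + 1) i : Fin (n + 1)) : ℕ) = i := Nat.mod_eq_of_lt (by omega)
  rw [run_seq]
  have hA₂ := agree_run (forLoop 39 3 pushProg) s₁
  have hs₂ : Env n adj w ((forLoop 39 3 pushProg).run s₁) :=
    hs₁.of_agree hA₂ (by decide) (by decide)
  rw [run_relabelProg hs₂ (u := Fin.ofNat (n + 1) i)
    (by rw [hA₂.nat 38 (by decide), hctr₁, vi]) (by rw [vi]; exact hi)]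
  unfold Preflow.discharge
  congr 1
  rw [vertexList, List.foldl_map]
  refine forLoop_foldl hs₁.n_succ _ _ (fun s' x => flowState_setNat (by decide) s' x)
    fun v s₃ hv hA₃ hctr₃ => ?_
  have hs₃ : Env n adj w s₃ := hs₁.of_agree hA₃ (by decide) (by decide)
  exact run_pushProg hs₃ (by rw [hA₃.nat 38 (by decide), hctr₁, vi])
    (by rw [hctr₃]; exact (Nat.mod_eq_of_lt hv).symm)

theorem run_flowProg (hs : Env n adj w s) (hp : s.nat 37 0 ≤ n) {m : ℕ} (hm : s.nat 9 0 = m) :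
    flowState n (flowProg.run s) =
      (Preflow.pass (Fin.last n) (vertexList n (n + 1)) (vertexList n n))^[m]
        (Preflow.bipStart (fun u : Fin (n + 1) => (u : ℕ) < s.nat 37 0)
          (fun u : Fin (n + 1) => s.nat 37 0 ≤ u ∧ (u : ℕ) < n) (fun u v => adj u v)
          (fun u => s.wt 6 u) (Fin.last n)) := by
  unfold flowProg
  rw [run_seq, ← run_flowInitProg hs hp, ← foldl_range_const]
  have hA₁ := agree_run flowInitProg s
  have hs₁ : Env n adj w (flowInitProg.run s) := hs.of_agree hA₁ (by decide) (by decide)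
  refine forLoop_foldl (by rw [hA₁.nat 9 (by decide), hm]) _ _
    (fun s' x => flowState_setNat (by decide) s' x) fun i s₂ hi hA₂ hctr₂ => ?_
  exact run_passProg (hs₁.of_agree hA₂ (by decide) (by decide))

end ForProg

end WeightRAM

namespace WeightRAM

variable {n : ℕ} {adj : ℕ → ℕ → Prop} {w : ℕ → ℚ} {s : State}

/-! ### Candidates -/

open Classical in
/-- The candidate obtained from taken vertices `S`, remaining vertices `X`, a cut `p`, heights `h`
and a threshold `k`. -/
noncomputable def candidate (n : ℕ) (S X : Finset ℕ) (p k : ℕ) (h : ℕ → ℕ) : Finset ℕ :=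
  (Finset.range n).filter fun v =>
    v ∈ S ∨ (v ∈ X ∧ ((v < p ∧ k < h v) ∨ (p ≤ v ∧ h v ≤ k)))

/-- The set has no edges. -/
def IsIndep (adj : ℕ → ℕ → Prop) (I : Finset ℕ) : Prop := ∀ u ∈ I, ∀ v ∈ I, ¬ adj u v

/-- The memory contains an independent set together with its weight. -/
structure Best (n : ℕ) (adj : ℕ → ℕ → Prop) (w : ℕ → ℚ) (s : State) : Prop where
  indep : IsIndep adj (support n (s.nat 2))
  weight : s.wt 1 0 = ∑ v ∈ support n (s.nat 2), w v

theorem Best.congr (h : Best n adj w s) {s' : State} (h2 : s'.nat 2 = s.nat 2)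
    (h1 : s'.wt 1 = s.wt 1) : Best n adj w s' :=
  ⟨by rw [h2]; exact h.indep, by rw [h1, h2]; exact h.weight⟩

/-- The range is extended by one to match sums over the vertices of the network, which include the
sink. -/
theorem sum_eq_sum_ite {I : Finset ℕ} (hI : I ⊆ Finset.range n) (w : ℕ → ℚ) :
    ∑ v ∈ I, w v = ∑ v ∈ Finset.range (n + 1), if v ∈ I then w v else 0 := by
  rw [Finset.sum_ite_mem, Finset.inter_eq_right.2]
  exact hI.trans (Finset.range_subset_range.2 (Nat.le_succ n))

open Classical in
/-- For a suitable threshold, the candidate is independent and at least as heavy as `I`. -/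
theorem exists_candidate (hsymm : ∀ u v, adj u v → adj v u) (hirr : ∀ u, ¬ adj u u)
    (hw : ∀ v < n, 0 < w v) {I X S : Finset ℕ} (hI : IsIndep adj I) (hIn : I ⊆ Finset.range n)
    (hX : X ⊆ Finset.range n) (hinv : BranchInv adj n I (X, S)) {p : ℕ} (hp : p ≤ n)
    (hcut : ∀ u v, u ∈ X → v ∈ X → u < v → adj u v → u < p ∧ p ≤ v)
    {x : Preflow (Fin (n + 1))} {h : ℕ → ℕ} (hh : ∀ u : Fin (n + 1), x.ht u = h u)
    (hx : x.Valid (Preflow.bipCapacity (fun u : Fin (n + 1) => (u : ℕ) < p)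
        (fun u : Fin (n + 1) => p ≤ u ∧ (u : ℕ) < n) (fun u v => adj u v)
        (fun u => if (u : ℕ) ∈ X then w u else 0) (Fin.last n))
      (Preflow.bipSupply (fun u : Fin (n + 1) => (u : ℕ) < p)
        (fun u => if (u : ℕ) ∈ X then w u else 0)) (Fin.last n))
    (hterm : ∀ u, u ≠ Fin.last n → 0 < x.ex u → Fintype.card (Fin (n + 1)) ≤ x.ht u) :
    ∃ k < n + 1, IsIndep adj (candidate n S X p k h) ∧
      ∑ v ∈ I, w v ≤ ∑ v ∈ candidate n S X p k h, w v := by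
  obtain ⟨k, hk, hsat, hex⟩ := Preflow.exists_saturated_cut hx hterm
  rw [Fintype.card_fin] at hk
  have hlr : ∀ u : Fin (n + 1), (u : ℕ) < p → ¬ (p ≤ (u : ℕ) ∧ (u : ℕ) < n) := by omega
  have hlt : ¬ ((Fin.last n : Fin (n + 1)) : ℕ) < p := by simp; omega
  have hSI := hinv.taken_subset
  have hSX := Finset.disjoint_left.1 hinv.disjoint
  dsimp only at hSI hSX
  -- Vertices of X have positive weight in the network, so no edge inside X goes from the left part
  -- of the cut set to the right part of its complement.
  have hcross : ∀ a b, a ∈ X → b ∈ X → a < b → k < h a → h b ≤ k → ¬ adj a b := by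
    intro a b ha hb hlt' hka hkb hab
    obtain ⟨h1, h2⟩ := hcut a b ha hb hlt' hab
    have han := Finset.mem_range.1 (hX ha)
    have hbn := Finset.mem_range.1 (hX hb)
    refine Preflow.Valid.not_adj_of_cut hlr hlt hx (U := fun u => k < x.ht u) hsat
      (a := ⟨a, by omega⟩) (b := ⟨b, by omega⟩) h1 ⟨h2, hbn⟩ ?_ ?_ ?_ hab
    · rw [hh]; exact hka
    · rw [hh]; exact not_lt.2 hkb
    · rw [if_pos (show ((⟨a, by omega⟩ : Fin (n + 1)) : ℕ) ∈ X from ha)]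
      exact hw a han
  refine ⟨k, hk, ?_, ?_⟩
  · have hXX : ∀ a b, a < b → a ∈ X → b ∈ X →
        ((a < p ∧ k < h a) ∨ (p ≤ a ∧ h a ≤ k)) → ((b < p ∧ k < h b) ∨ (p ≤ b ∧ h b ≤ k)) →
        ¬ adj a b := by
      intro a b hlt' ha hb hca hcb hab
      obtain ⟨h1, h2⟩ := hcut a b ha hb hlt' hab
      exact hcross a b ha hb hlt' (by omega) (by omega) hab
    intro u hu v hv huv
    simp only [candidate, Finset.mem_filter] at hu hv
    rcases hu.2 with h1 | ⟨h1, h2⟩ <;> rcases hv.2 with h3 | ⟨h3, h4⟩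
    · exact hI u (hSI h1) v (hSI h3) huv
    · exact hinv.not_adj u h1 v h3 huv
    · exact hinv.not_adj v h3 u h1 (hsymm _ _ huv)
    · rcases lt_trichotomy u v with h5 | h5 | h5
      · exact hXX u v h5 h1 h3 h2 h4 huv
      · subst h5; exact hirr u huv
      · exact hXX v u h5 h3 h1 h4 h2 (hsymm _ _ huv)
  -- The competitor is I ∩ X. Vertices outside X stay in the network with weight zero.
  · have key := Preflow.Valid.sum_le_of_cut hlr hlt
      (show ¬ (p ≤ ((Fin.last n : Fin (n + 1)) : ℕ) ∧ ((Fin.last n : Fin (n + 1)) : ℕ) < n) by simp)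
      (fun u hu => by
        have : (u : ℕ) ≠ n := fun e => hu (Fin.ext e)
        have := u.2
        omega)
      (fun u => by
        split_ifs with h1
        · exact (hw u (Finset.mem_range.1 (hX h1))).le
        · exact le_rfl) hx
      (U := fun u => k < x.ht u) (by rw [hx.ht_sink]; omega) hsat hex
      (T := fun u => (u : ℕ) ∈ I ∧ (u : ℕ) ∈ X)
      (fun h1 => by simpa using hIn h1.1)
      (fun a b ha hb _ _ => hI a ha.1 b hb.1)
    simp only [hh] at key
    have k1 := Fin.sum_univ_eq_sum_range
      (fun v => if v ∈ I ∧ v ∈ X then if v ∈ X then w v else 0 else 0) (n + 1)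
    have k2 := Fin.sum_univ_eq_sum_range
      (fun v => if (v < p ∧ k < h v) ∨ ((p ≤ v ∧ v < n) ∧ ¬ k < h v) then
        if v ∈ X then w v else 0 else 0) (n + 1)
    have k3 : ∑ v ∈ Finset.range (n + 1),
          (if v ∈ I ∧ v ∈ X then if v ∈ X then w v else 0 else 0) ≤
        ∑ v ∈ Finset.range (n + 1),
          (if (v < p ∧ k < h v) ∨ ((p ≤ v ∧ v < n) ∧ ¬ k < h v) then
            if v ∈ X then w v else 0 else 0) := by
      rw [← k1, ← k2]
      convert key
    have hsub : candidate n S X p k h ⊆ Finset.range n := Finset.filter_subset _ _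
    rw [sum_eq_sum_ite hIn, sum_eq_sum_ite hsub]
    -- Both I and the candidate consist of all of S and a part inside X, so only the parts inside X
    -- need to be compared.
    have e1 : ∀ v, (if v ∈ I then w v else 0) = (if v ∈ S then w v else 0) +
        (if v ∈ I ∧ v ∈ X then if v ∈ X then w v else 0 else 0) := by
      intro v
      by_cases h1 : v ∈ S
      · simp [h1, hSI h1, hSX h1]
      · by_cases h2 : v ∈ I
        · have h3 : v ∈ X := by
            rcases Finset.mem_union.1 (hinv.subset_union h2) with h | h
            · exact absurd h h1
            · exact h
          simp [h1, h2, h3]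
        · simp [h1, h2]
    have e2 : ∀ v, (if v ∈ candidate n S X p k h then w v else 0) = (if v ∈ S then w v else 0) +
        (if (v < p ∧ k < h v) ∨ ((p ≤ v ∧ v < n) ∧ ¬ k < h v) then
            if v ∈ X then w v else 0 else 0) := by
      intro v
      simp only [candidate, Finset.mem_filter, Finset.mem_range, not_lt]
      by_cases h1 : v ∈ S
      · have := Finset.mem_range.1 (hIn (hSI h1))
        simp [h1, hSX h1, this]
      · by_cases h2 : v ∈ X
        · have := Finset.mem_range.1 (hX h2)
          simp [h1, h2, this]
        · simp [h1, h2]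
    simp only [e1, e2, Finset.sum_add_distrib]
    exact add_le_add le_rfl k3

namespace ForProg

/-- Compute the candidate for the cut in the variable `37` and the threshold in the
variable `41`. -/
def candidateProg : ForProg :=
  .forLoop 42 0 (.ite (.or (.mem 13 (.var 42)) (.and (.mem 12 (.var 42))
      (.or (.and (.lt (.var 42) (.var 37)) (.lt (.var 41) (.get 17 (.var 42))))
        (.and (.le (.var 37) (.var 42)) (.le (.get 17 (.var 42)) (.var 41))))))
    (.store 19 (.var 42) (.const 1)) (.store 19 (.var 42) (.const 0)))

/-- Test whether the candidate is independent. -/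
def independenceProg : ForProg :=
  .seq (.store 20 (.const 0) (.const 1))
    (.forLoop 42 0 (.forLoop 43 0
      (.ite (.and (.and (.mem 19 (.var 42)) (.mem 19 (.var 43))) (.adj (.var 42) (.var 43)))
        (.store 20 (.const 0) (.const 0)) .skip)))

/-- Compute the weight of the candidate. -/
def weighProg : ForProg :=
  .seq (.wstore 5 (.const 0) .zero)
    (.forLoop 42 0 (.ite (.mem 19 (.var 42))
      (.wstore 5 (.const 0) (.add (.var 5) (.get 0 (.var 42)))) .skip))

/-- Keep the candidate, if it is independent and better than the best set so far. -/
def keepProg : ForProg :=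
  .ite (.and (.le (.const 1) (.var 20)) (.wlt (.var 1) (.var 5)))
    (.seq (.wstore 1 (.const 0) (.var 5))
      (.forLoop 42 0 (.store 2 (.var 42) (.get 19 (.var 42))))) .skip

/-- Compute a candidate and keep it, if it is better. -/
def tryProg : ForProg :=
  .seq candidateProg (.seq independenceProg (.seq weighProg keepProg))

theorem run_candidateProg (hs : Env n adj w s) :
    support n ((candidateProg.run s).nat 19) =
      candidate n (support n (s.nat 13)) (support n (s.nat 12)) (s.nat 37 0) (s.nat 41 0)
        (s.nat 17) := by
  classical
  ext v
  have h := forLoop_nat_map (a := 42) (b := 0) (c := 19) (s := s)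
    (p := (.ite (.or (.mem 13 (.var 42)) (.and (.mem 12 (.var 42))
      (.or (.and (.lt (.var 42) (.var 37)) (.lt (.var 41) (.get 17 (.var 42))))
        (.and (.le (.var 37) (.var 42)) (.le (.get 17 (.var 42)) (.var 41))))))
    (.store 19 (.var 42) (.const 1)) (.store 19 (.var 42) (.const 0)))) hs.n_eq
    (fun v => if 1 ≤ s.nat 13 v ∨ (1 ≤ s.nat 12 v ∧ ((v < s.nat 37 0 ∧ s.nat 41 0 < s.nat 17 v) ∨
      (s.nat 37 0 ≤ v ∧ s.nat 17 v ≤ s.nat 41 0))) then 1 else 0)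
    (by decide) (fun i s' hi hA hctr j => by
      have e13 : s'.nat 13 = s.nat 13 := hA.nat _ (by decide)
      have e12 : s'.nat 12 = s.nat 12 := hA.nat _ (by decide)
      have e17 : s'.nat 17 = s.nat 17 := hA.nat _ (by decide)
      have e37 : s'.nat 37 = s.nat 37 := hA.nat _ (by decide)
      have e41 : s'.nat 41 = s.nat 41 := hA.nat _ (by decide)
      have hcond : (Cond.or (.mem 13 (.var 42)) (.and (.mem 12 (.var 42))
          (.or (.and (.lt (.var 42) (.var 37)) (.lt (.var 41) (.get 17 (.var 42))))
            (.and (.le (.var 37) (.var 42)) (.le (.get 17 (.var 42)) (.var 41)))))).Holds s' ↔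
          1 ≤ s.nat 13 i ∨ (1 ≤ s.nat 12 i ∧ ((i < s.nat 37 0 ∧ s.nat 41 0 < s.nat 17 i) ∨
            (s.nat 37 0 ≤ i ∧ s.nat 17 i ≤ s.nat 41 0))) := by
        simp only [Cond.holds_and, Cond.holds_not, Cond.holds_le, NExp.eval_const,
          NExp.eval_get, hctr, e13, e12, e17, e37, e41, ← not_or, not_not, not_le]
        omega
      rw [run_ite]
      simp only [hcond]
      split_ifs <;> simp [*]) v
  rw [mem_support, candidateProg, h]
  by_cases hv : v < n
  · simp [hv, candidate, mem_support, one_le_ite]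
  · simp [hv, candidate]

theorem run_independenceProg (hs : Env n adj w s) :
    1 ≤ (independenceProg.run s).nat 20 0 ↔ IsIndep adj (support n (s.nat 19)) := by
  classical
  rw [independenceProg, run_seq]
  set s₁ := (store 20 (.const 0) (.const 1)).run s with h₁
  have hA₁ := agree_run (store 20 (.const 0) (.const 1)) s
  have hs₁ : Env n adj w s₁ := hs.of_agree hA₁ (by decide) (by decide)
  have e19 : s₁.nat 19 = s.nat 19 := hA₁.nat _ (by decide)
  rw [forLoop_flag hs₁.n_eq
    (fun u => ¬ ∀ v < n, ¬ ((1 ≤ s.nat 19 u ∧ 1 ≤ s.nat 19 v) ∧ adj u v)) (by decide)]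
  · have h20 : s₁.nat 20 0 = 1 := by simp [h₁]
    simp only [h20, le_refl, true_and, IsIndep, mem_support, not_not]
    constructor
    · exact fun h u hu v hv huv => h u hu.1 v hv.1 ⟨⟨hu.2, hv.2⟩, huv⟩
    · exact fun h u hu v hv huv => h u ⟨hu, huv.1.1⟩ v ⟨hv, huv.1.2⟩ huv.2
  · intro i s₂ hi hA₂ hctr₂
    have hs₂ : Env n adj w s₂ := hs₁.of_agree hA₂ (by decide) (by decide)
    have e19' : s₂.nat 19 = s₁.nat 19 := hA₂.nat _ (by decide)
    rw [not_not]
    refine forLoop_flag hs₂.n_eq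
      (fun v => (1 ≤ s.nat 19 i ∧ 1 ≤ s.nat 19 v) ∧ adj i v) (by decide) ?_
    intro j s₃ hj hA₃ hctr₃
    have hs₃ : Env n adj w s₃ := hs₂.of_agree hA₃ (by decide) (by decide)
    have e19'' : s₃.nat 19 = s₂.nat 19 := hA₃.nat _ (by decide)
    have e42 : s₃.nat 42 0 = i := by rw [hA₃.nat 42 (by decide), hctr₂]
    have hcond : (Cond.and (.and (.mem 19 (.var 42)) (.mem 19 (.var 43)))
        (.adj (.var 42) (.var 43))).Holds s₃ ↔ (1 ≤ s.nat 19 i ∧ 1 ≤ s.nat 19 j) ∧ adj i j := by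
      rw [Cond.holds_and, hs₃.holds_adj (by simpa [e42] using hi) (by simpa [hctr₃] using hj)]
      simp [e42, hctr₃, e19'', e19', e19]
    rw [run_ite]
    simp only [hcond]
    split_ifs with h
    · exact iff_of_false (by simp) fun h' => h'.2 h
    · exact ⟨fun h' => ⟨h', h⟩, And.left⟩

theorem run_weighProg (hs : Env n adj w s) :
    (weighProg.run s).wt 5 0 = ∑ v ∈ support n (s.nat 19), w v := by
  rw [weighProg, run_seq]
  set s₁ := (wstore 5 (.const 0) .zero).run s with h₁
  have hA₁ := agree_run (wstore 5 (.const 0) .zero) s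
  have hs₁ : Env n adj w s₁ := hs.of_agree hA₁ (by decide) (by decide)
  have e19 : s₁.nat 19 = s.nat 19 := hA₁.nat _ (by decide)
  rw [forLoop_wt_sum hs₁.n_eq (fun v => if 1 ≤ s.nat 19 v then w v else 0)]
  · rw [support, Finset.sum_filter]
    simp [h₁]
  · intro i s₂ hi hA₂ hctr₂
    have hs₂ : Env n adj w s₂ := hs₁.of_agree hA₂ (by decide) (by decide)
    have e19' : s₂.nat 19 = s₁.nat 19 := hA₂.nat _ (by decide)
    rw [run_ite]
    simp only [Cond.holds_le, NExp.eval_const, NExp.eval_get, hctr₂, e19', e19]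
    split_ifs <;> simp [hctr₂, hs₂.w_eq]

/-- Nothing is assumed about the guess, the cut or the threshold: the independence test alone
protects `Best`, and the stored weight never decreases. -/
theorem run_tryProg (hs : Env n adj w s) (hb : Best n adj w s) :
    Best n adj w (tryProg.run s) ∧ s.wt 1 0 ≤ (tryProg.run s).wt 1 0 ∧
      (IsIndep adj (candidate n (support n (s.nat 13)) (support n (s.nat 12)) (s.nat 37 0)
          (s.nat 41 0) (s.nat 17)) →
        ∑ v ∈ candidate n (support n (s.nat 13)) (support n (s.nat 12)) (s.nat 37 0)
          (s.nat 41 0) (s.nat 17), w v ≤ (tryProg.run s).wt 1 0) := by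
  classical
  rw [← run_candidateProg hs]
  simp only [tryProg, run_seq]
  set s₁ := candidateProg.run s
  have hA₁ := agree_run candidateProg s
  have hs₁ : Env n adj w s₁ := hs.of_agree hA₁ (by decide) (by decide)
  set s₂ := independenceProg.run s₁ with h₂
  have hA₂ := agree_run independenceProg s₁
  have hs₂ : Env n adj w s₂ := hs₁.of_agree hA₂ (by decide) (by decide)
  set s₃ := weighProg.run s₂ with h₃
  have hA₃ := agree_run weighProg s₂
  have hs₃ : Env n adj w s₃ := hs₂.of_agree hA₃ (by decide) (by decide)
  have e2 : s₃.nat 2 = s.nat 2 := by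
    rw [hA₃.nat 2 (by decide), hA₂.nat 2 (by decide), hA₁.nat 2 (by decide)]
  have e1 : s₃.wt 1 = s.wt 1 := by
    rw [hA₃.wt 1 (by decide), hA₂.wt 1 (by decide), hA₁.wt 1 (by decide)]
  have e19 : s₃.nat 19 = s₁.nat 19 := by rw [hA₃.nat 19 (by decide), hA₂.nat 19 (by decide)]
  have e19' : s₂.nat 19 = s₁.nat 19 := hA₂.nat 19 (by decide)
  have e20 : 1 ≤ s₃.nat 20 0 ↔ IsIndep adj (support n (s₁.nat 19)) := by
    rw [hA₃.nat 20 (by decide), h₂, run_independenceProg hs₁]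
  have e5 : s₃.wt 5 0 = ∑ v ∈ support n (s₁.nat 19), w v := by
    rw [h₃, run_weighProg hs₂, e19']
  have hcond : (Cond.and (.le (.const 1) (.var 20)) (.wlt (.var 1) (.var 5))).Holds s₃ ↔
      IsIndep adj (support n (s₁.nat 19)) ∧ s.wt 1 0 < ∑ v ∈ support n (s₁.nat 19), w v := by
    simp [e20, e5, e1]
  unfold keepProg
  rw [run_ite]
  simp only [hcond]
  split_ifs with h
  · rw [run_seq]
    set s₄ := (wstore 1 (.const 0) (.var 5)).run s₃ with h₄
    have hA₄ := agree_run (wstore 1 (.const 0) (.var 5)) s₃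
    set q : ForProg := .forLoop 42 0 (.store 2 (.var 42) (.get 19 (.var 42))) with hq
    have hA₅ := agree_run q s₄
    have f2 : support n ((q.run s₄).nat 2) = support n (s₁.nat 19) := by
      rw [hq, support_copy (by decide) (by decide) (by decide), hA₄.nat 19 (by decide), e19]
      rw [hA₄.nat 0 (by decide), hs₃.n_eq]
    have f1 : (q.run s₄).wt 1 0 = ∑ v ∈ support n (s₁.nat 19), w v := by
      rw [hA₅.wt 1 (by decide), h₄, ← e5]
      simp
    exact ⟨⟨by rw [f2]; exact h.1, by rw [f1, f2]⟩, by rw [f1]; exact h.2.le,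
      fun _ => by rw [f1]⟩
  · rw [run_skip]
    refine ⟨hb.congr e2 e1, by rw [e1], fun h' => ?_⟩
    rw [e1]
    exact not_lt.1 fun h'' => h ⟨h', h''⟩

/-! ### The search -/

/-- A loop that improves the best set: the invariant `J` is maintained, and some round reaches
the weight `θ`. -/
theorem forLoop_best {a b : ℕ} {p : ForProg} {m : ℕ} (hm : s.nat b 0 = m) (J : ℕ → State → Prop)
    {i₀ : ℕ} {θ : ℚ} (ha2 : 2 ≠ a) (hJ : ∀ i s' x, J i s' → J i (s'.setNat a 0 x))
    (h : ∀ i s', i < m → Agree (a :: p.natWrites) p.wtWrites s s' → s'.nat a 0 = i →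
      J i s' → Best n adj w s' → J (i + 1) (p.run s') ∧ Best n adj w (p.run s') ∧
        s'.wt 1 0 ≤ (p.run s').wt 1 0 ∧ (i = i₀ → θ ≤ (p.run s').wt 1 0))
    (hJ0 : J 0 s) (hb : Best n adj w s) :
    Best n adj w ((forLoop a b p).run s) ∧ s.wt 1 0 ≤ ((forLoop a b p).run s).wt 1 0 ∧
      (i₀ < m → θ ≤ ((forLoop a b p).run s).wt 1 0) := by
  have hset : ∀ s' x, Best n adj w s' → Best n adj w (s'.setNat a 0 x) := fun s' x h =>
    h.congr (State.setNat_nat_of_ne _ _ _ ha2) rfl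
  refine (forLoop_induction hm (I := fun i s' => J i s' ∧ Best n adj w s' ∧
    s.wt 1 0 ≤ s'.wt 1 0 ∧ (i₀ < i → θ ≤ s'.wt 1 0))
    ⟨hJ _ _ _ hJ0, hset _ _ hb, le_rfl, fun h => by omega⟩ ?_).2
  intro i s' hi hA hctr ⟨h1, h2, h3, h4⟩
  obtain ⟨k1, k2, k3, k4⟩ := h i s' hi hA hctr h1 h2
  refine ⟨hJ _ _ _ k1, hset _ _ k2, h3.trans k3, fun h5 => ?_⟩
  rcases Nat.lt_succ_iff_lt_or_eq.1 h5 with h5 | h5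
  · exact (h4 h5).trans k3
  · exact k4 h5.symm

/-- Try all thresholds, for all cuts. -/
def cutProg : ForProg :=
  .forLoop 37 3 (.seq flowWeightProg (.seq flowProg (.forLoop 41 3 tryProg)))

theorem run_thresholds (hs : Env n adj w s) (hb : Best n adj w s) :
    Best n adj w ((forLoop 41 3 tryProg).run s) ∧
      s.wt 1 0 ≤ ((forLoop 41 3 tryProg).run s).wt 1 0 ∧
      ∀ k < n + 1, IsIndep adj (candidate n (support n (s.nat 13)) (support n (s.nat 12))
          (s.nat 37 0) k (s.nat 17)) →
        ∑ v ∈ candidate n (support n (s.nat 13)) (support n (s.nat 12)) (s.nat 37 0)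
          k (s.nat 17), w v ≤ ((forLoop 41 3 tryProg).run s).wt 1 0 := by
  -- `forLoop_best` follows a single round k. The alternative n + 1 ≤ k stands for a round that
  -- never occurs, and still yields the first two conclusions.
  have key : ∀ (k : ℕ) (θ : ℚ), (IsIndep adj (candidate n (support n (s.nat 13))
      (support n (s.nat 12)) (s.nat 37 0) k (s.nat 17)) ∧
        θ ≤ ∑ v ∈ candidate n (support n (s.nat 13)) (support n (s.nat 12)) (s.nat 37 0)
          k (s.nat 17), w v ∨ n + 1 ≤ k) →
      Best n adj w ((forLoop 41 3 tryProg).run s) ∧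
      s.wt 1 0 ≤ ((forLoop 41 3 tryProg).run s).wt 1 0 ∧
      (k < n + 1 → θ ≤ ((forLoop 41 3 tryProg).run s).wt 1 0) := by
    intro k θ hk
    refine forLoop_best hs.n_succ (fun _ _ => True) (by decide) (fun _ _ _ _ => trivial)
      (fun i s' hi hA hctr _ hb' => ⟨trivial, ?_⟩) trivial hb
    have hs' : Env n adj w s' := hs.of_agree hA (by decide) (by decide)
    obtain ⟨h1, h2, h3⟩ := run_tryProg hs' hb'
    refine ⟨h1, h2, fun hik => ?_⟩
    rw [hA.nat 13 (by decide), hA.nat 12 (by decide), hA.nat 37 (by decide),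
      hA.nat 17 (by decide), hctr, hik] at h3
    rcases hk with hk | hk
    · exact hk.2.trans (h3 hk.1)
    · omega
  obtain ⟨h1, h2, -⟩ := key (n + 1) 0 (Or.inr le_rfl)
  exact ⟨h1, h2, fun k hk hind => (key k _ (Or.inl ⟨hind, le_rfl⟩)).2.2 hk⟩

/-- The program does not look for the right cut p but tries every p ≤ n; the outcome of the flow
matters only in the round of a p that all remaining edges cross. -/
theorem run_cutProg (hsymm : ∀ u v, adj u v → adj v u) (hirr : ∀ u, ¬ adj u u)
    (hw : ∀ v < n, 0 < w v) (hs : Env n adj w s)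
    (hm : ((n + 1) ^ 2 + 1) ^ 3 ≤ s.nat 9 0) (hb : Best n adj w s) :
    Best n adj w (cutProg.run s) ∧ s.wt 1 0 ≤ (cutProg.run s).wt 1 0 ∧
      ∀ I, IsIndep adj I → I ⊆ Finset.range n →
        BranchInv adj n I (support n (s.nat 12), support n (s.nat 13)) →
        sepCount adj n (support n (s.nat 12)) = 0 → ∑ v ∈ I, w v ≤ (cutProg.run s).wt 1 0 := by
  classical
  have key : ∀ (p : ℕ) (θ : ℚ), ((∃ I, IsIndep adj I ∧ I ⊆ Finset.range n ∧ θ = ∑ v ∈ I, w v ∧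
        BranchInv adj n I (support n (s.nat 12), support n (s.nat 13)) ∧
        ∀ u v, u ∈ support n (s.nat 12) → v ∈ support n (s.nat 12) → u < v → adj u v →
          u < p ∧ p ≤ v) ∨ n + 1 ≤ p) →
      Best n adj w (cutProg.run s) ∧ s.wt 1 0 ≤ (cutProg.run s).wt 1 0 ∧
        (p < n + 1 → θ ≤ (cutProg.run s).wt 1 0) := by
    intro p θ hp
    refine forLoop_best hs.n_succ (fun _ _ => True) (by decide) (fun _ _ _ _ => trivial)
      (fun i s' hi hA hctr _ hb' => ⟨trivial, ?_⟩) trivial hb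
    have hs' : Env n adj w s' := hs.of_agree hA (by decide) (by decide)
    rw [run_seq, run_seq]
    set s₁ := flowWeightProg.run s' with h₁
    have hA₁ := agree_run flowWeightProg s'
    have hs₁ : Env n adj w s₁ := hs'.of_agree hA₁ (by decide) (by decide)
    set s₂ := flowProg.run s₁ with h₂
    have hA₂ := agree_run flowProg s₁
    have hs₂ : Env n adj w s₂ := hs₁.of_agree hA₂ (by decide) (by decide)
    have e1 : s₂.wt 1 = s'.wt 1 := by rw [hA₂.wt 1 (by decide), hA₁.wt 1 (by decide)]
    have e2 : s₂.nat 2 = s'.nat 2 := by rw [hA₂.nat 2 (by decide), hA₁.nat 2 (by decide)]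
    have hb₂ : Best n adj w s₂ := hb'.congr e2 e1
    obtain ⟨h1, h2, h3⟩ := run_thresholds hs₂ hb₂
    refine ⟨h1, by rw [← e1]; exact h2, fun hip => ?_⟩
    rcases hp with ⟨I, hI, hIn, hθ, hinv, hcut⟩ | hp
    swap
    · omega
    have e12 : s₁.nat 12 = s.nat 12 := by rw [hA₁.nat 12 (by decide), hA.nat 12 (by decide)]
    have e12' : s₂.nat 12 = s.nat 12 := by rw [hA₂.nat 12 (by decide), e12]
    have e13 : s₂.nat 13 = s.nat 13 := by
      rw [hA₂.nat 13 (by decide), hA₁.nat 13 (by decide), hA.nat 13 (by decide)]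
    have e37 : s₁.nat 37 0 = p := by rw [hA₁.nat 37 (by decide), hctr, hip]
    have e37' : s₂.nat 37 0 = p := by rw [hA₂.nat 37 (by decide), e37]
    have e9 : s₁.nat 9 0 = s.nat 9 0 := by rw [hA₁.nat 9 (by decide), hA.nat 9 (by decide)]
    have hflow := run_flowProg hs₁ (by rw [e37]; omega) e9
    have hw6 : (fun u : Fin (n + 1) => s₁.wt 6 u) =
        fun u : Fin (n + 1) => if (u : ℕ) ∈ support n (s.nat 12) then w u else 0 := by
      funext u
      rw [h₁, run_flowWeightProg hs' u.2, hA.nat 12 (by decide)]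
    rw [e37, hw6] at hflow
    obtain ⟨hV, hterm⟩ := Preflow.iterate_pass (l := vertexList n (n + 1)) (l' := vertexList n n)
      (t := Fin.last n) (fun v => mem_vertexList v.2)
      (fun u hu => mem_vertexList (by
        have : (u : ℕ) ≠ n := fun e => hu (Fin.ext e)
        omega))
      (Preflow.valid_bipStart (left := fun u : Fin (n + 1) => (u : ℕ) < p)
        (right := fun u : Fin (n + 1) => p ≤ u ∧ (u : ℕ) < n) (adj := fun u v => adj u v)
        (w := fun u : Fin (n + 1) => if (u : ℕ) ∈ support n (s.nat 12) then w u else 0) (fun u => by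
          split_ifs with h4
          · exact (hw u (mem_support.1 h4).1).le
          · exact le_rfl))
      (m := s.nat 9 0) (by rw [Fintype.card_fin]; exact hm)
    rw [← hflow] at hV hterm
    obtain ⟨k, hk, hind, hle⟩ := exists_candidate hsymm hirr hw hI hIn (support_subset _ _) hinv
      (by omega) hcut (h := s₂.nat 17) (fun u => rfl) hV hterm
    rw [e12', e13, e37'] at h3
    rw [hθ]
    exact hle.trans (h3 k hk hind)
  obtain ⟨h1, h2, -⟩ := key (n + 1) 0 (Or.inr le_rfl)
  refine ⟨h1, h2, fun I hI hIn hinv hzero => ?_⟩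
  obtain ⟨p, hp, hcut⟩ := exists_cut_of_sepCount_eq_zero (support_subset _ _) hzero
  exact (key p _ (Or.inl ⟨I, hI, hIn, rfl, hinv, hcut⟩)).2.2 (by omega)

/-- Turn the guess into a set. -/
def guessProg : ForProg :=
  .seq (.forLoop 42 3 (.store 11 (.var 42) (.const 0)))
    (.forLoop 42 6 (.store 11 (.get 10 (.var 42)) (.const 1)))

/-- Proceed to the next guess. -/
def nextProg : ForProg :=
  .seq (.store 21 (.const 0) (.const 1))
    (.forLoop 42 6 (.ite (.le (.const 1) (.var 21))
      (.ite (.lt (.add (.get 10 (.var 42)) (.const 1)) (.var 3))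
        (.seq (.store 10 (.var 42) (.add (.get 10 (.var 42)) (.const 1)))
          (.store 21 (.const 0) (.const 0)))
        (.store 10 (.var 42) (.const 0))) .skip))

/-- Go through all guesses. -/
def searchProg : ForProg :=
  .forLoop 45 7 (.seq guessProg (.seq branchProg (.seq cutProg nextProg)))

theorem run_guessProg (hs : Env n adj w s) {u : ℕ} (hu : u < n + 1) :
    1 ≤ (guessProg.run s).nat 11 u ↔ ∃ j < s.nat 6 0, s.nat 10 j = u := by
  rw [guessProg, run_seq]
  set q : ForProg := .forLoop 42 3 (.store 11 (.var 42) (.const 0)) with hq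
  have hA₁ := agree_run q s
  have e11 : (q.run s).nat 11 u = 0 := by
    rw [hq, forLoop_nat_map hs.n_succ (fun _ => 0) (by decide)
      fun i s' hi hA hctr j => by simp [hctr], if_pos hu]
  refine forLoop_induction (m := s.nat 6 0) (hA₁.nat 6 (by decide) ▸ rfl)
    (I := fun i s' => 1 ≤ s'.nat 11 u ↔ ∃ j < i, s.nat 10 j = u) (by simp [e11]) ?_
  intro i s' hi hA hctr hI
  have e10 : s'.nat 10 = s.nat 10 := by rw [hA.nat 10 (by decide), hA₁.nat 10 (by decide)]
  simp only [State.setNat_nat, run_store, NExp.eval_get, NExp.eval_const, hctr, e10,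
    show ¬ ((11 : ℕ) = 42) by decide, false_and, if_false, true_and]
  by_cases h : u = s.nat 10 i
  · simp only [h, if_true, le_refl, true_iff]
    exact ⟨i, by omega, rfl⟩
  · rw [if_neg h, hI]
    constructor
    · rintro ⟨j, hj, hj'⟩
      exact ⟨j, by omega, hj'⟩
    · rintro ⟨j, hj, hj'⟩
      rcases Nat.lt_succ_iff_lt_or_eq.1 hj with hj | rfl
      · exact ⟨j, hj, hj'⟩
      · exact absurd hj'.symm h

/-! ### Counting through the guesses in base n + 1 -/

theorem succ_div_of_not_dvd {g m : ℕ} (h : ¬ m ∣ g + 1) : (g + 1) / m = g / m := by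
  rw [Nat.succ_div, if_neg h, add_zero]

theorem succ_div_of_dvd {g m : ℕ} (h : m ∣ g + 1) : (g + 1) / m = g / m + 1 := by
  rw [Nat.succ_div, if_pos h]

/-- The guess holds the base n + 1 digits of g, lowest first. The carry is alive at position i
exactly if all lower digits are maximal, that is, if (n + 1) ^ i divides g + 1. -/
theorem run_nextProg (hs : Env n adj w s) {g : ℕ}
    (hg : ∀ j < s.nat 6 0, s.nat 10 j = g / (n + 1) ^ j % (n + 1)) :
    ∀ j < s.nat 6 0, (nextProg.run s).nat 10 j = (g + 1) / (n + 1) ^ j % (n + 1) := by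
  rw [nextProg, run_seq]
  set s₁ := (store 21 (.const 0) (.const 1)).run s with h₁
  have hA₁ := agree_run (store 21 (.const 0) (.const 1)) s
  have e10 : s₁.nat 10 = s.nat 10 := hA₁.nat 10 (by decide)
  have e21 : s₁.nat 21 0 = 1 := by simp [h₁]
  refine (forLoop_induction (m := s.nat 6 0) (by rw [hA₁.nat 6 (by decide)])
    (I := fun i s' => (1 ≤ s'.nat 21 0 ↔ (n + 1) ^ i ∣ g + 1) ∧
      (∀ j, i ≤ j → j < s.nat 6 0 → s'.nat 10 j = g / (n + 1) ^ j % (n + 1)) ∧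
      ∀ j < i, s'.nat 10 j = (g + 1) / (n + 1) ^ j % (n + 1)) ?_ ?_).2.2
  · refine ⟨by simp [e21], fun j _ hj => ?_, fun j hj => by omega⟩
    simp [e10, hg j hj]
  intro i s' hi hA hctr ⟨hI1, hI2, hI3⟩
  have e3 : s'.nat 3 0 = n + 1 := by
    rw [hA.nat 3 (by decide), hA₁.nat 3 (by decide), hs.n_succ]
  have hd := hI2 i le_rfl hi
  have hpow : (n + 1) ^ (i + 1) ∣ g + 1 → (n + 1) ^ i ∣ g + 1 := fun h =>
    (pow_dvd_pow _ (Nat.le_succ i)).trans h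
  have hpos : 0 < (n + 1) ^ i := by positivity
  rw [run_ite]
  by_cases hc : 1 ≤ s'.nat 21 0
  · have hdvd := hI1.1 hc
    have hdvd' : (n + 1) ^ (i + 1) ∣ g + 1 ↔ (g / (n + 1) ^ i + 1) % (n + 1) = 0 := by
      rw [← Nat.dvd_iff_mod_eq_zero, ← succ_div_of_dvd hdvd, pow_succ]
      exact (Nat.dvd_div_iff_mul_dvd hdvd).symm
    have hmod : (g / (n + 1) ^ i + 1) % (n + 1) = (s'.nat 10 i + 1) % (n + 1) := by
      rw [hd, Nat.mod_add_mod]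
    have hdlt : s'.nat 10 i < n + 1 := by rw [hd]; exact Nat.mod_lt _ (by omega)
    rw [if_pos (by simpa using hc), run_ite]
    have hdig : (g + 1) / (n + 1) ^ i % (n + 1) = (s'.nat 10 i + 1) % (n + 1) := by
      rw [succ_div_of_dvd hdvd, hmod]
    rw [hmod] at hdvd'
    by_cases hlt : s'.nat 10 i + 1 < n + 1
    · rw [if_pos (by simpa [hctr, e3] using hlt)]
      rw [Nat.mod_eq_of_lt hlt] at hdvd' hdig
      refine ⟨?_, fun j hj hj' => ?_, fun j hj => ?_⟩
      · rw [hdvd']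
        simp
      · have : j ≠ i := by omega
        simpa [hctr, this] using hI2 j (by omega) hj'
      · rcases Nat.lt_succ_iff_lt_or_eq.1 hj with hj | rfl
        · simpa [hctr, hj.ne] using hI3 j hj
        · simp [hctr, hdig]
    · rw [if_neg (by simpa [hctr, e3] using hlt)]
      rw [show s'.nat 10 i + 1 = n + 1 by omega, Nat.mod_self] at hdvd' hdig
      refine ⟨?_, fun j hj hj' => ?_, fun j hj => ?_⟩
      · rw [hdvd']
        simpa [hctr] using hc
      · have : j ≠ i := by omega
        simpa [hctr, this] using hI2 j (by omega) hj'
      · rcases Nat.lt_succ_iff_lt_or_eq.1 hj with hj | rfl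
        · simpa [hctr, hj.ne] using hI3 j hj
        · simp [hctr, hdig]
  · rw [if_neg (by simpa using hc), run_skip]
    have hnd : ¬ (n + 1) ^ i ∣ g + 1 := fun h => hc (hI1.2 h)
    refine ⟨?_, fun j hj hj' => ?_, fun j hj => ?_⟩
    · simp only [State.setNat_nat, show ¬ ((21 : ℕ) = 42) by decide, false_and, if_false]
      exact iff_of_false hc fun h => hnd (hpow h)
    · simpa using hI2 j (by omega) hj'
    · simp only [State.setNat_nat, show ¬ ((10 : ℕ) = 42) by decide, false_and, if_false]
      rcases Nat.lt_succ_iff_lt_or_eq.1 hj with hj | rfl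
      · exact hI3 j hj
      · rw [hd, succ_div_of_not_dvd hnd]

theorem branchPass_congr {K K' : Set ℕ} (h : ∀ v < n, v ∈ K ↔ v ∈ K') :
    branchPass adj n K = branchPass adj n K' := by
  classical
  funext x
  refine List.foldl_ext _ _ _ fun y v hv => ?_
  simp only [branchStep, h v (List.mem_range.1 hv)]

/-- Every small set occurs as a guess. -/
theorem exists_code {K : Finset ℕ} (hK : K ⊆ Finset.range n) {L : ℕ} (hL : K.card ≤ L) :
    ∃ g < (n + 1) ^ L, ∀ u < n, (∃ j < L, g / (n + 1) ^ j % (n + 1) = u) ↔ u ∈ K := by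
  -- Unused positions are filled with the digit n, which is not a vertex.
  have hlt : ∀ j, K.toList.getD j n < n + 1 := by
    intro j
    by_cases hj : j < K.toList.length
    · rw [List.getD_eq_getElem _ _ hj]
      have := hK (Finset.mem_toList.1 (List.getElem_mem hj))
      rw [Finset.mem_range] at this
      omega
    · rw [List.getD_eq_default _ _ (not_lt.1 hj)]
      omega
  set d : Fin L → Fin (n + 1) := fun j => ⟨K.toList.getD j n, hlt j⟩ with hd
  have hdig : ∀ j : Fin L, (finFunctionFinEquiv d : ℕ) / (n + 1) ^ (j : ℕ) % (n + 1) = d j := by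
    intro j
    have := finFunctionFinEquiv_symm_apply_val (finFunctionFinEquiv d) j
    rw [Equiv.symm_apply_apply] at this
    exact this.symm
  refine ⟨finFunctionFinEquiv d, (finFunctionFinEquiv d).2, fun u hu => ⟨?_, fun huK => ?_⟩⟩
  · rintro ⟨j, hj, rfl⟩
    have h1 := hdig ⟨j, hj⟩
    dsimp only at h1
    rw [h1] at hu ⊢
    simp only [hd] at hu ⊢
    by_cases hj' : j < K.toList.length
    · rw [List.getD_eq_getElem _ _ hj']
      exact Finset.mem_toList.1 (List.getElem_mem hj')
    · rw [List.getD_eq_default _ _ (not_lt.1 hj')] at hu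
      exact absurd hu (lt_irrefl _)
  · obtain ⟨j, hj, rfl⟩ := List.getElem_of_mem (Finset.mem_toList.2 huK)
    have hj' : j < L := by
      rw [Finset.length_toList] at hj
      omega
    refine ⟨j, hj', ?_⟩
    have h1 := hdig ⟨j, hj'⟩
    dsimp only at h1
    rw [h1]
    simp only [hd]
    rw [List.getD_eq_getElem _ _ hj]

/-- Round g, whose digits spell the guide K of `exists_guide`, replays the branching guided by I.
The other rounds only have to preserve `Best` and the counter. -/
theorem run_searchProg (hsymm : ∀ u v, adj u v → adj v u) (hirr : ∀ u, ¬ adj u u)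
    (hfree : SepFree adj) (hw : ∀ v < n, 0 < w v) (hs : Env n adj w s) (hn : 0 < n)
    (hm : ((n + 1) ^ 2 + 1) ^ 3 ≤ s.nat 9 0) (hb : Best n adj w s) {k : ℕ}
    (hL : s.nat 6 0 = 4 * k) (hk : n < 2 ^ k) (hM : s.nat 7 0 = (n + 1) ^ (4 * k))
    (h10 : ∀ j, s.nat 10 j = 0) {I : Finset ℕ} (hI : IsIndep adj I) (hIn : I ⊆ Finset.range n) :
    Best n adj w (searchProg.run s) ∧ ∑ v ∈ I, w v ≤ (searchProg.run s).wt 1 0 := by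
  obtain ⟨K, hKI, hcard, hinv⟩ := exists_guide hsymm hI hIn hn
  -- From 2 ^ |K| ≤ 2 n⁴ and n < 2 ^ k, so 4 k digits are enough.
  have hKL : K.card ≤ 4 * k := by
    have h1 : n ^ 4 < (2 ^ k) ^ 4 := Nat.pow_lt_pow_left hk (by omega)
    have h2 : 2 ^ K.card < 2 ^ (4 * k + 1) := by
      calc 2 ^ K.card ≤ 2 * n ^ 4 := hcard
        _ < 2 * (2 ^ k) ^ 4 := by linarith
        _ = 2 ^ (4 * k + 1) := by rw [← pow_mul]; ring
    have := (Nat.pow_lt_pow_iff_right (by omega)).1 h2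
    omega
  obtain ⟨g, hg, hgK⟩ := exists_code (hKI.trans hIn) hKL
  have key := forLoop_best (n := n) (adj := adj) (w := w) (s := s) (a := 45) (b := 7)
    (p := .seq guessProg (.seq branchProg (.seq cutProg nextProg))) hM
    (fun i s' => ∀ j < 4 * k, s'.nat 10 j = i / (n + 1) ^ j % (n + 1))
    (i₀ := g) (θ := ∑ v ∈ I, w v) (by decide)
    (fun i s' x h j hj => by
      rw [State.setNat_nat_of_ne _ _ _ (by decide)]
      exact h j hj) ?_ (by simp [h10]) hb
  · exact ⟨key.1, key.2.2 hg⟩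
  intro i s' hi hA hctr hJ hb'
  have hs' : Env n adj w s' := hs.of_agree hA (by decide) (by decide)
  have e6 : s'.nat 6 0 = 4 * k := by rw [hA.nat 6 (by decide), hL]
  simp only [run_seq]
  set s₁ := guessProg.run s' with h₁
  have hA₁ := agree_run guessProg s'
  have hs₁ : Env n adj w s₁ := hs'.of_agree hA₁ (by decide) (by decide)
  set s₂ := branchProg.run s₁ with h₂
  have hA₂ := agree_run branchProg s₁
  have hs₂ : Env n adj w s₂ := hs₁.of_agree hA₂ (by decide) (by decide)
  have hb₂ : Best n adj w s₂ := hb'.congr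
    (by rw [hA₂.nat 2 (by decide), hA₁.nat 2 (by decide)])
    (by rw [hA₂.wt 1 (by decide), hA₁.wt 1 (by decide)])
  have e1 : s₂.wt 1 = s'.wt 1 := by rw [hA₂.wt 1 (by decide), hA₁.wt 1 (by decide)]
  obtain ⟨c1, c2, c3⟩ := run_cutProg hsymm hirr hw hs₂ (by
    rw [hA₂.nat 9 (by decide), hA₁.nat 9 (by decide), hA.nat 9 (by decide)]
    exact hm) hb₂
  set s₃ := cutProg.run s₂ with h₃
  have hA₃ := agree_run cutProg s₂
  have hs₃ : Env n adj w s₃ := hs₂.of_agree hA₃ (by decide) (by decide)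
  have hA₄ := agree_run nextProg s₃
  have e6' : s₃.nat 6 0 = 4 * k := by
    rw [hA₃.nat 6 (by decide), hA₂.nat 6 (by decide), hA₁.nat 6 (by decide), e6]
  have e10 : s₃.nat 10 = s'.nat 10 := by
    rw [hA₃.nat 10 (by decide), hA₂.nat 10 (by decide), hA₁.nat 10 (by decide)]
  have f1 : (nextProg.run s₃).wt 1 = s₃.wt 1 := hA₄.wt 1 (by decide)
  refine ⟨?_, c1.congr (hA₄.nat 2 (by decide)) f1, ?_, fun hig => ?_⟩
  · have := run_nextProg hs₃ (g := i) (by rw [e6', e10]; exact hJ)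
    rwa [e6'] at this
  · rw [f1, ← e1]
    exact c2
  · rw [f1]
    have hbr := run_branchProg hs₁
    rw [branchPass_congr (K' := ↑K) (fun v hv => by
      rw [Set.mem_ofPred_eq, run_guessProg hs' (by omega), e6, Finset.mem_coe, ← hgK v hv, ← hig]
      refine exists_congr fun j => and_congr_right fun hj => ?_
      rw [hJ j hj])] at hbr
    have hz := (sepCount_iterate_branchPass hsymm hfree (↑K) (x := (Finset.range n, ∅))
      Finset.Subset.rfl).1
    rw [← hbr] at hinv hz
    exact c3 I hI hIn hinv hz

end ForProg

end WeightRAM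

namespace WeightRAM

variable {n : ℕ} {adj : ℕ → ℕ → Prop} {w : ℕ → ℚ} {s : State}

namespace ForProg

/-! ### Initialization -/

/-- Compute the starting points of the rows of a square matrix. -/
def rowsProg (dst b : ℕ) : ForProg :=
  .seq (.store 22 (.const 0) (.const 0))
    (.forLoop 30 b (.seq (.store dst (.var 30) (.var 22))
      (.store 22 (.const 0) (.add (.var 22) (.var b)))))

/-- Compute the number of guessed vertices. -/
def lengthProg : ForProg :=
  .seq (.store 22 (.const 0) (.const 1))
    (.forLoop 30 0 (.ite (.le (.var 22) (.var 0))
      (.seq (.store 22 (.const 0) (.add (.var 22) (.var 22)))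
        (.store 6 (.const 0) (.add (.var 6) (.const 4)))) .skip))

/-- Compute a power of the variable `3`. -/
def powProg (e dst : ℕ) : ForProg :=
  .seq (.store dst (.const 0) (.const 1))
    (.forLoop 30 e (.seq (.store 22 (.const 0) (.const 0))
      (.seq (.forLoop 31 3 (.store 22 (.const 0) (.add (.var 22) (.var dst))))
        (.store dst (.const 0) (.var 22)))))

/-- Compute the number of columns of the residual matrix. -/
def sizeProg : ForProg := .store 3 (.const 0) (.add (.var 0) (.const 1))

/-- Compute the tables and exponents. -/
def tableProg : ForProg :=
  .seq (rowsProg 4 0) (.seq (rowsProg 5 3) (.seq lengthProg (.store 8 (.const 0) (.const 9))))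

/-- Compute the lengths of the main loops. -/
def powersProg : ForProg := .seq (powProg 6 7) (powProg 8 9)

/-- The machine cannot multiply, so the products are accumulated by repeated addition in variable
`22`. -/
theorem run_rowsProg {dst b m : ℕ} (hd : dst < 22) (hb : b < 22) (hdb : dst ≠ b)
    (hm : s.nat b 0 = m) : ∀ u < m, ((rowsProg dst b).run s).nat dst u = u * m := by
  rw [rowsProg, run_seq]
  set s₁ := (store 22 (.const 0) (.const 0)).run s with h₁
  have hA₁ := agree_run (store 22 (.const 0) (.const 0)) s
  have hm₁ : s₁.nat b 0 = m := by rw [hA₁.nat b (by simp [natWrites]; omega), hm]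
  refine (forLoop_induction hm₁
    (I := fun i s' => s'.nat 22 0 = i * m ∧ ∀ u < i, s'.nat dst u = u * m) ?_ ?_).2
  · simp [h₁]
  intro i s' hi hA hctr ⟨hI1, hI2⟩
  have hmb : s'.nat b 0 = m := by rw [hA.nat b (by simp [natWrites]; omega), hm₁]
  have n1 : 22 ≠ dst := by omega
  have n2 : dst ≠ 30 := by omega
  have n3 : b ≠ dst := hdb.symm
  refine ⟨?_, fun u hu => ?_⟩
  · simp [hI1, hmb, n1, n3]
    ring
  · simp only [run_seq, run_store, State.setNat_nat, NExp.eval_get, NExp.eval_const,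
      NExp.eval_add, hctr, n2, n1.symm, false_and, if_false, true_and, hI1]
    rcases Nat.lt_succ_iff_lt_or_eq.1 hu with hu | rfl
    · rw [if_neg hu.ne, hI2 u hu]
    · rw [if_pos rfl]

/-- Variable `22` is doubled as long as it is at most n, and n rounds suffice since n < 2 ^ n. Each
doubling grants four guessed vertices, four being the exponent in the bound n⁴ on separated pairs.
-/
theorem run_lengthProg (hn : s.nat 0 0 = n) (h6 : s.nat 6 0 = 0) :
    ∃ k, (lengthProg.run s).nat 6 0 = 4 * k ∧ n < 2 ^ k ∧ 2 ^ k ≤ 2 * n + 1 := by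
  rw [lengthProg, run_seq]
  set s₁ := (store 22 (.const 0) (.const 1)).run s with h₁
  have hA₁ := agree_run (store 22 (.const 0) (.const 1)) s
  have hn₁ : s₁.nat 0 0 = n := by rw [hA₁.nat 0 (by decide), hn]
  have h6₁ : s₁.nat 6 0 = 0 := by rw [hA₁.nat 6 (by decide), h6]
  have h22 : s₁.nat 22 0 = 1 := by simp [h₁]
  obtain ⟨k, -, h2, h3, h4⟩ := forLoop_induction hn₁ (a := 30)
    (p := .ite (.le (.var 22) (.var 0))
      (.seq (.store 22 (.const 0) (.add (.var 22) (.var 22)))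
        (.store 6 (.const 0) (.add (.var 6) (.const 4)))) .skip)
    (I := fun i s' => ∃ k, s'.nat 22 0 = 2 ^ k ∧ s'.nat 6 0 = 4 * k ∧ 2 ^ k ≤ 2 * n + 1 ∧
      (n < 2 ^ k ∨ k = i)) ⟨0, by simp [h22], by simp [h6₁], by simp, Or.inr rfl⟩ (by
    intro i s' hi hA hctr ⟨k, hk1, hk2, hk3, hk4⟩
    have hn' : s'.nat 0 0 = n := by rw [hA.nat 0 (by decide), hn₁]
    rw [run_ite]
    by_cases hc : 2 ^ k ≤ n
    · rw [if_pos (by simpa [hk1, hn'] using hc)]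
      refine ⟨k + 1, ?_, ?_, ?_, ?_⟩
      · simp [hk1]; ring
      · simp [hk2]; ring
      · rw [pow_succ]; omega
      · right; omega
    · rw [if_neg (by simpa [hk1, hn'] using hc), run_skip]
      exact ⟨k, by simpa using hk1, by simpa using hk2, hk3, Or.inl (not_le.1 hc)⟩)
  refine ⟨k, h2, ?_, h3⟩
  rcases h4 with h4 | rfl
  · exact h4
  · exact Nat.lt_two_pow_self

theorem run_powProg {e dst m l : ℕ} (hd : dst < 22) (hde : e ≠ dst) (hd3 : dst ≠ 3)
    (hm : s.nat 3 0 = m) (hl : s.nat e 0 = l) : ((powProg e dst).run s).nat dst 0 = m ^ l := by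
  rw [powProg, run_seq]
  set s₁ := (store dst (.const 0) (.const 1)).run s with h₁
  have hA₁ := agree_run (store dst (.const 0) (.const 1)) s
  have hm₁ : s₁.nat 3 0 = m := by rw [hA₁.nat 3 (by simpa [natWrites] using hd3.symm), hm]
  have hl₁ : s₁.nat e 0 = l := by rw [hA₁.nat e (by simpa [natWrites] using hde), hl]
  refine forLoop_induction hl₁ (I := fun i s' => s'.nat dst 0 = m ^ i) ?_ ?_
  · have : dst ≠ 30 := by omega
    simp [h₁, this]
  intro i s' hi hA hctr hI
  rw [run_seq, run_seq]
  set s₂ := (store 22 (.const 0) (.const 0)).run s' with h₂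
  have hA₂ := agree_run (store 22 (.const 0) (.const 0)) s'
  have hm₂ : s₂.nat 3 0 = m := by
    rw [hA₂.nat 3 (by decide), hA.nat 3 (by simp [natWrites]; omega), hm₁]
  have hd₂ : s₂.nat dst 0 = m ^ i := by rw [hA₂.nat dst (by simp [natWrites]; omega), hI]
  have hsum := forLoop_nat_sum (a := 31) (c := 22) (s := s₂)
    (p := .store 22 (.const 0) (.add (.var 22) (.var dst))) hm₂ (fun _ => m ^ i) (by decide)
    fun j s₃ hj hA₃ hctr₃ => by
      have : s₃.nat dst 0 = m ^ i := by rw [hA₃.nat dst (by simp [natWrites]; omega), hd₂]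
      simp [this]
  have h22 : s₂.nat 22 0 = 0 := by simp [h₂]
  have : dst ≠ 30 := by omega
  simp only [State.setNat_nat, this, false_and, if_false, run_store, NExp.eval_const, true_and,
    NExp.eval_get, if_true]
  rw [hsum, h22]
  simp [pow_succ, mul_comm]

/-- The complete algorithm, in four parts. -/
def mwisParts : ForProg := .seq sizeProg (.seq tableProg (.seq powersProg searchProg))

/-- The intermediate values are recorded because they are the loop bounds of the later parts. -/
theorem run_init (h0 : s.nat 0 0 = n) (h6 : s.nat 6 0 = 0)
    (hadj : ∀ u < n, ∀ v < n, 1 ≤ s.nat 1 (u * n + v) ↔ adj u v) (hw : s.wt 0 = w) :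
    let s₁ := sizeProg.run s
    let s₂ := tableProg.run s₁
    let s₃ := powersProg.run s₂
    s₁.nat 0 0 = n ∧ s₁.nat 3 0 = n + 1 ∧ s₂.nat 3 0 = n + 1 ∧ s₂.nat 8 0 = 9 ∧
      Env n adj w s₃ ∧ ∃ k, s₂.nat 6 0 = 4 * k ∧ s₃.nat 6 0 = 4 * k ∧ n < 2 ^ k ∧
        2 ^ k ≤ 2 * n + 1 ∧ s₃.nat 7 0 = (n + 1) ^ (4 * k) ∧ s₃.nat 9 0 = (n + 1) ^ 9 := by
  intro s₁ s₂ s₃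
  have hA₁ := agree_run sizeProg s
  have hA₂ := agree_run tableProg s₁
  have hA₃ := agree_run powersProg s₂
  have a0 : s₁.nat 0 0 = n := by rw [hA₁.nat 0 (by decide), h0]
  have a3 : s₁.nat 3 0 = n + 1 := by simp [s₁, sizeProg, h0]
  have a6 : s₁.nat 6 0 = 0 := by rw [hA₁.nat 6 (by decide), h6]
  have b3 : s₂.nat 3 0 = n + 1 := by rw [hA₂.nat 3 (by decide), a3]
  have hA₄ := agree_run (rowsProg 4 0) s₁
  set s₄ := (rowsProg 4 0).run s₁ with h₄
  have hA₅ := agree_run (rowsProg 5 3) s₄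
  set s₅ := (rowsProg 5 3).run s₄ with h₅
  have hA₆ := agree_run lengthProg s₅
  set s₆ := lengthProg.run s₅ with h₆
  have hA₇ := agree_run (store 8 (.const 0) (.const 9)) s₆
  have h₂ : s₂ = (store 8 (.const 0) (.const 9)).run s₆ := rfl
  have b8 : s₂.nat 8 0 = 9 := by simp [h₂]
  have row4 : ∀ u < n, s₂.nat 4 u = u * n := by
    intro u hu
    rw [h₂, hA₇.nat 4 (by decide), hA₆.nat 4 (by decide), hA₅.nat 4 (by decide)]
    exact run_rowsProg (by decide) (by decide) (by decide) a0 u hu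
  have row5 : ∀ u < n + 1, s₂.nat 5 u = u * (n + 1) := by
    intro u hu
    rw [h₂, hA₇.nat 5 (by decide), hA₆.nat 5 (by decide)]
    exact run_rowsProg (by decide) (by decide) (by decide)
      (by rw [hA₄.nat 3 (by decide), a3]) u hu
  obtain ⟨k, hk1, hk2, hk3⟩ := run_lengthProg (s := s₅) (n := n)
    (by rw [hA₅.nat 0 (by decide), hA₄.nat 0 (by decide), a0])
    (by rw [hA₅.nat 6 (by decide), hA₄.nat 6 (by decide), a6])
  have b6 : s₂.nat 6 0 = 4 * k := by rw [h₂, hA₇.nat 6 (by decide), hk1]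
  have hA₈ := agree_run (powProg 6 7) s₂
  have hA₉ := agree_run (powProg 8 9) ((powProg 6 7).run s₂)
  have h₃ : s₃ = (powProg 8 9).run ((powProg 6 7).run s₂) := rfl
  refine ⟨a0, a3, b3, b8, ⟨?_, ?_, ?_, ?_, ?_, ?_⟩, k, b6, ?_, hk2, hk3, ?_, ?_⟩
  · rw [hA₃.nat 0 (by decide), hA₂.nat 0 (by decide), a0]
  · rw [hA₃.nat 1 (by decide), hA₂.nat 1 (by decide), hA₁.nat 1 (by decide)]
    exact hadj
  · rw [hA₃.nat 3 (by decide), b3]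
  · rw [hA₃.nat 4 (by decide)]
    exact row4
  · rw [hA₃.nat 5 (by decide)]
    exact row5
  · rw [hA₃.wt 0 (by decide), hA₂.wt 0 (by decide), hA₁.wt 0 (by decide), hw]
  · rw [hA₃.nat 6 (by decide), b6]
  · rw [h₃, hA₉.nat 7 (by decide)]
    exact run_powProg (by decide) (by decide) (by decide) b3 b6
  · exact run_powProg (by decide) (by decide) (by decide)
      (by rw [hA₈.nat 3 (by decide), b3]) (by rw [hA₈.nat 8 (by decide), b8])

/-- A bound for all loop lengths. -/
def loopBound (n : ℕ) : ℕ :=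
  (n + 1) ^ (4 * (Nat.log 2 n + 1)) + (n + 1) ^ 9 + 4 * (Nat.log 2 n + 1) + n + 10

/-- A well-formed program does not write to its own loop bounds. The algorithm is therefore cut into
four parts, so that every bound is computed in an earlier part than the one that uses it. -/
theorem runs_mwisParts (h0 : s.nat 0 0 = n) (h6 : s.nat 6 0 = 0)
    (hadj : ∀ u < n, ∀ v < n, 1 ≤ s.nat 1 (u * n + v) ↔ adj u v) (hw : s.wt 0 = w) :
    ∃ t, Runs mwisParts.compile s (mwisParts.run s) t ∧ t ≤ mwisParts.cost (loopBound n) := by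
  obtain ⟨a0, a3, b3, b8, hs, k, b6, c6, hk, hk', c7, c9⟩ := run_init h0 h6 hadj hw
  -- Because 2 ^ k ≤ 2 n + 1 < 2 ^ (log n + 2).
  have hkl : k ≤ Nat.log 2 n + 1 := by
    have h1 := Nat.lt_pow_succ_log_self (b := 2) (by omega) n
    have h2 : 2 ^ k < 2 ^ (Nat.log 2 n + 2) := by
      rw [pow_succ 2 (Nat.log 2 n + 1)]
      omega
    have := (Nat.pow_lt_pow_iff_right (by omega)).1 h2
    omega
  have hpow : (n + 1) ^ (4 * k) ≤ (n + 1) ^ (4 * (Nat.log 2 n + 1)) :=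
    Nat.pow_le_pow_right (by omega) (by omega)
  obtain ⟨t₁, r₁, ht₁⟩ := runs_compile (p := sizeProg) (F := []) (by decide) (s := s)
    (B := loopBound n) (by simp)
  obtain ⟨t₂, r₂, ht₂⟩ := runs_compile (p := tableProg) (F := [0, 3]) (by decide)
    (s := sizeProg.run s) (B := loopBound n) (by
      simp only [List.mem_cons, List.not_mem_nil, or_false, forall_eq_or_imp, forall_eq, a0, a3,
        loopBound]
      omega)
  obtain ⟨t₃, r₃, ht₃⟩ := runs_compile (p := powersProg) (F := [3, 6, 8]) (by decide)
    (s := tableProg.run (sizeProg.run s)) (B := loopBound n) (by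
      simp only [List.mem_cons, List.not_mem_nil, or_false, forall_eq_or_imp, forall_eq, b3, b6,
        b8, loopBound]
      omega)
  obtain ⟨t₄, r₄, ht₄⟩ := runs_compile (p := searchProg) (F := [0, 3, 6, 7, 9]) (by decide)
    (s := powersProg.run (tableProg.run (sizeProg.run s))) (B := loopBound n) (by
      simp only [List.mem_cons, List.not_mem_nil, or_false, forall_eq_or_imp, forall_eq, hs.n_eq,
        hs.n_succ, c6, c7, c9, loopBound]
      omega)
  refine ⟨_, .seq r₁ (.seq r₂ (.seq r₃ r₄)), ?_⟩
  simp only [mwisParts, cost]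
  omega

theorem loopBound_le (hn : 2 ≤ n) : loopBound n ≤ n ^ (40 * Nat.log 2 n) := by
  set l := Nat.log 2 n with hl
  have hl1 : 1 ≤ l := Nat.log_pos (by omega) hn
  have hln : l ≤ n := Nat.log_le_self 2 n
  have hN : 10 ≤ (n + 1) ^ 9 := by
    calc 10 ≤ 3 ^ 9 := by norm_num
      _ ≤ (n + 1) ^ 9 := Nat.pow_le_pow_left (by omega) 9
  have h1 : (n + 1) ^ (4 * (l + 1)) ≤ (n + 1) ^ (9 * (l + 1)) :=
    Nat.pow_le_pow_right (by omega) (by omega)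
  have h2 : (n + 1) ^ 9 ≤ (n + 1) ^ (9 * (l + 1)) := Nat.pow_le_pow_right (by omega) (by omega)
  have h3 : 5 * (n + 1) ≤ (n + 1) ^ 9 := by
    calc 5 * (n + 1) ≤ (n + 1) ^ 8 * (n + 1) := by
          gcongr
          calc 5 ≤ 3 ^ 8 := by norm_num
            _ ≤ (n + 1) ^ 8 := Nat.pow_le_pow_left (by omega) 8
      _ = (n + 1) ^ 9 := by ring
  have h4 : n + 1 ≤ n ^ 2 := by nlinarith
  have h5 : 4 ≤ n ^ 2 := by nlinarith
  -- One copy each for the two powers, for 4 (l + 1) + n ≤ 5 (n + 1), and for the constant 10.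
  calc loopBound n ≤ 4 * (n + 1) ^ (9 * (l + 1)) := by
        unfold loopBound
        rw [← hl]
        omega
    _ ≤ n ^ 2 * (n ^ 2) ^ (9 * (l + 1)) := by gcongr
    _ = n ^ (18 * l + 20) := by rw [← pow_mul, ← pow_add]; congr 1; ring
    -- Uses 18 l + 20 ≤ 40 l, which holds as l ≥ 1.
    _ ≤ n ^ (40 * l) := Nat.pow_le_pow_right (by omega) (by omega)

theorem exists_cost_loopBound_le (p : ForProg) :
    ∃ c : ℝ, ∀ n : ℕ, 2 ≤ n → (p.cost (loopBound n) : ℝ) ≤ (n : ℝ) ^ (c * Real.logb 2 n) := by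
  obtain ⟨C, D, hCD⟩ := p.exists_cost_le
  refine ⟨(C + 40 * D : ℕ), fun n hn => ?_⟩
  have hl1 : 1 ≤ Nat.log 2 n := Nat.log_pos (by omega) hn
  have h1 : p.cost (loopBound n) ≤ n ^ ((C + 40 * D) * Nat.log 2 n) := by
    calc p.cost (loopBound n) ≤ C * loopBound n ^ D := hCD _ (by unfold loopBound; omega)
      _ ≤ n ^ (C * Nat.log 2 n) * (n ^ (40 * Nat.log 2 n)) ^ D := by
          refine Nat.mul_le_mul ?_ (Nat.pow_le_pow_left (loopBound_le hn) _)
          -- The constant factor is absorbed into the exponent, which is possible as n ≥ 2.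
          calc C ≤ 2 ^ C := Nat.lt_two_pow_self.le
            _ ≤ n ^ C := Nat.pow_le_pow_left hn C
            _ ≤ n ^ (C * Nat.log 2 n) :=
              Nat.pow_le_pow_right (by omega) (Nat.le_mul_of_pos_right _ hl1)
      _ = _ := by rw [← pow_mul, ← pow_add]; congr 1; ring
  have hn1 : (1 : ℝ) ≤ n := by exact_mod_cast (by omega : 1 ≤ n)
  calc (p.cost (loopBound n) : ℝ) ≤ ((n ^ ((C + 40 * D) * Nat.log 2 n) : ℕ) : ℝ) := by
        exact_mod_cast h1
    _ = (n : ℝ) ^ (((C + 40 * D : ℕ) : ℝ) * (Nat.log 2 n : ℝ)) := by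
        rw [← Nat.cast_mul, Real.rpow_natCast, Nat.cast_pow]
    _ ≤ _ := by
        refine Real.rpow_le_rpow_of_exponent_le hn1 ?_
        gcongr
        exact_mod_cast Real.natLog_le_logb n 2

end ForProg

/-! ### Correctness -/

/-- Adjacency in a graph on `Fin n`, as a relation on the natural numbers. -/
def natAdj {n : ℕ} (G : SimpleGraph (Fin n)) (u v : ℕ) : Prop :=
  ∃ (hu : u < n) (hv : v < n), G.Adj ⟨u, hu⟩ ⟨v, hv⟩

theorem natAdj_coe {n : ℕ} (G : SimpleGraph (Fin n)) (u v : Fin n) :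
    natAdj G u v ↔ G.Adj u v := ⟨fun ⟨_, _, h⟩ => h, fun h => ⟨u.2, v.2, h⟩⟩

theorem sepFree_natAdj {n : ℕ} {G : SimpleGraph (Fin n)} (hG : OrderedFree aabb G) :
    SepFree (natAdj G) := by
  rintro a b c d hab hbc hcd ⟨ha, hb, h1⟩ ⟨hc, hd, h2⟩
  by_contra! hne
  obtain ⟨n1, n2, n3, n4⟩ := hne
  have k1 : ¬ G.Adj ⟨a, ha⟩ ⟨c, hc⟩ := fun h => n1 ⟨ha, hc, h⟩
  have k2 : ¬ G.Adj ⟨a, ha⟩ ⟨d, hd⟩ := fun h => n2 ⟨ha, hd, h⟩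
  have k3 : ¬ G.Adj ⟨b, hb⟩ ⟨c, hc⟩ := fun h => n3 ⟨hb, hc, h⟩
  have k4 : ¬ G.Adj ⟨b, hb⟩ ⟨d, hd⟩ := fun h => n4 ⟨hb, hd, h⟩
  refine hG ⟨OrderEmbedding.ofStrictMono ![⟨a, ha⟩, ⟨b, hb⟩, ⟨c, hc⟩, ⟨d, hd⟩] ?_, ?_⟩
  · rw [Fin.strictMono_iff_lt_succ]
    intro i
    fin_cases i
    · exact hab
    · exact hbc
    · exact hcd
  · intro x y
    fin_cases x <;> fin_cases y <;>
      simp [aabb, h1, h2, k1, k2, k3, k4, h1.symm, h2.symm, G.adj_comm ⟨c, hc⟩ ⟨a, ha⟩,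
        G.adj_comm ⟨d, hd⟩ ⟨a, ha⟩, G.adj_comm ⟨c, hc⟩ ⟨b, hb⟩, G.adj_comm ⟨d, hd⟩ ⟨b, hb⟩]

theorem inputState_adj {n : ℕ} (G : SimpleGraph (Fin n)) (w : Fin n → ℚ) :
    ∀ u < n, ∀ v < n, 1 ≤ (inputState G w).nat 1 (u * n + v) ↔ natAdj G u v := by
  intro u hu v hv
  have h : (∃ u' v' : Fin n, u * n + v = (u' : ℕ) * n + v' ∧ G.Adj u' v') ↔ natAdj G u v := by
    constructor
    · rintro ⟨u', v', h, hadj⟩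
      obtain ⟨m, rfl⟩ : ∃ m, n = m + 1 := ⟨n - 1, by omega⟩
      obtain ⟨rfl, rfl⟩ := (row_add_inj (⟨u, hu⟩ : Fin (m + 1)) ⟨v, hv⟩ u' v').1 h
      exact ⟨hu, hv, hadj⟩
    · rintro ⟨hu, hv, hadj⟩
      exact ⟨_, _, rfl, hadj⟩
  simp only [inputState, show ¬ ((1 : ℕ) = 0) by decide, false_and, if_false, true_and, h]
  rw [← h]
  split_ifs with hh
  · simpa using hh
  · simpa using hh

theorem map_outputSet (n : ℕ) (s : State) :
    (outputSet n s).map Fin.valEmbedding = support n (s.nat 2) := by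
  ext u
  simp only [outputSet, Finset.mem_map, Finset.mem_filter, Finset.mem_univ, true_and,
    Fin.valEmbedding_apply, mem_support, Nat.one_le_iff_ne_zero]
  constructor
  · rintro ⟨v, hv, rfl⟩
    exact ⟨v.2, hv⟩
  · rintro ⟨hu, hu'⟩
    exact ⟨⟨u, hu⟩, hu', rfl⟩

theorem isIndepSet_iff_map {n : ℕ} (G : SimpleGraph (Fin n)) (T : Finset (Fin n)) :
    G.IsIndepSet (T : Set (Fin n)) ↔ IsIndep (natAdj G) (T.map Fin.valEmbedding) := by
  simp only [IsIndep, Finset.mem_map, Fin.valEmbedding_apply, forall_exists_index, and_imp,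
    forall_apply_eq_imp_iff₂, natAdj_coe]
  constructor
  · intro h u hu v hv huv
    exact h hu hv huv.ne huv
  · intro h u hu v hv _
    exact h u hu v hv

theorem sum_map_val {n : ℕ} (w : Fin n → ℚ) (T : Finset (Fin n)) :
    ∑ v ∈ T.map Fin.valEmbedding, (if h : v < n then w ⟨v, h⟩ else 0) = ∑ v ∈ T, w v := by
  rw [Finset.sum_map]
  exact Finset.sum_congr rfl fun v _ => by simp

/-- The algorithm finds an independent set of maximum weight. -/
theorem isMaxWeightIndepSet_mwisParts {n : ℕ} {G : SimpleGraph (Fin n)} (w : Fin n → ℚ)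
    (hG : OrderedFree aabb G) (hw : ∀ v, 0 < w v) :
    IsMaxWeightIndepSet G w (outputSet n (ForProg.mwisParts.run (inputState G w))) := by
  -- The bound 2 ^ |taken| ≤ 2 n⁴ fails for n = 0, so the empty graph is treated apart.
  rcases Nat.eq_zero_or_pos n with rfl | hn
  · refine ⟨fun u => u.elim0, fun T _ => ?_⟩
    rw [Subsingleton.elim T]
  set s := inputState G w with hs
  set w' : ℕ → ℚ := fun v => if h : v < n then w ⟨v, h⟩ else 0 with hw'
  have h0 : s.nat 0 0 = n := by simp [hs, inputState]
  have hzero : ∀ a j, 2 ≤ a → s.nat a j = 0 := by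
    intro a j ha
    simp [hs, inputState, show a ≠ 0 by omega, show a ≠ 1 by omega]
  have hwt0 : s.wt 0 = w' := by
    funext i
    simp [hs, inputState, hw']
  have hwt1 : s.wt 1 0 = 0 := by simp [hs, inputState]
  obtain ⟨-, -, -, -, henv, k, -, c6, hk, -, c7, c9⟩ :=
    ForProg.run_init h0 (hzero 6 0 (by omega)) (inputState_adj G w) hwt0
  set s₁ := ForProg.sizeProg.run s
  set s₂ := ForProg.tableProg.run s₁
  set s₃ := ForProg.powersProg.run s₂
  have hA₁ := ForProg.agree_run ForProg.sizeProg s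
  have hA₂ := ForProg.agree_run ForProg.tableProg s₁
  have hA₃ := ForProg.agree_run ForProg.powersProg s₂
  have e2 : s₃.nat 2 = s.nat 2 := by
    rw [hA₃.nat 2 (by decide), hA₂.nat 2 (by decide), hA₁.nat 2 (by decide)]
  have e10 : s₃.nat 10 = s.nat 10 := by
    rw [hA₃.nat 10 (by decide), hA₂.nat 10 (by decide), hA₁.nat 10 (by decide)]
  have e1 : s₃.wt 1 = s.wt 1 := by
    rw [hA₃.wt 1 (by decide), hA₂.wt 1 (by decide), hA₁.wt 1 (by decide)]
  have hsupp : support n (s₃.nat 2) = ∅ := by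
    ext v
    simp [mem_support, e2, hzero 2 v le_rfl]
  have hbest : Best n (natAdj G) w' s₃ := by
    refine ⟨by simp [hsupp, IsIndep], by rw [hsupp, e1, hwt1]; rfl⟩
  -- The bound on `measure` for n + 1 vertices is below (n + 1) ^ 9, since (n + 1)² + 1 ≤ (n + 1)³
  -- for n ≥ 1; hence the exponent 9 in `tableProg`.
  have hpasses : ((n + 1) ^ 2 + 1) ^ 3 ≤ s₃.nat 9 0 := by
    rw [c9]
    calc ((n + 1) ^ 2 + 1) ^ 3 ≤ ((n + 1) ^ 3) ^ 3 := Nat.pow_le_pow_left (by nlinarith) 3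
      _ = (n + 1) ^ 9 := by rw [← pow_mul]
  have hmain : ∀ I, IsIndep (natAdj G) I → I ⊆ Finset.range n →
      Best n (natAdj G) w' (ForProg.searchProg.run s₃) ∧
        ∑ v ∈ I, w' v ≤ (ForProg.searchProg.run s₃).wt 1 0 := fun I hI hIn =>
    ForProg.run_searchProg (fun u v ⟨hu, hv, h⟩ => ⟨hv, hu, h.symm⟩)
      (fun u ⟨_, _, h⟩ => G.irrefl h) (sepFree_natAdj hG)
      (fun v hv => by rw [hw']; simpa [hv] using hw _) henv hn hpasses hbest c6 hk c7
      (fun j => by rw [e10]; exact hzero 10 j (by omega)) hI hIn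
  have hrun : ForProg.mwisParts.run s = ForProg.searchProg.run s₃ := rfl
  rw [hrun]
  -- The empty set serves only to obtain that the output is independent and has the stored weight.
  obtain ⟨⟨hind, hweight⟩, -⟩ := hmain ∅ (by simp [IsIndep]) (by simp)
  refine ⟨?_, fun T hT => ?_⟩
  · rw [isIndepSet_iff_map, map_outputSet]
    exact hind
  · rw [isIndepSet_iff_map] at hT
    have := (hmain _ hT (fun v hv => by
      obtain ⟨u, -, rfl⟩ := Finset.mem_map.1 hv
      simp)).2
    rw [hweight, ← map_outputSet, sum_map_val, sum_map_val] at this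
    exact this

end WeightRAM

theorem mainTheorem2 :
    ∃ (p : WeightRAM.Prog) (T : ℕ → ℕ) (c : ℝ),
      WeightRAM.SolvesMWISInTime (fun _ G => OrderedFree aabb G) p T ∧
      ∀ n : ℕ, 2 ≤ n → (T n : ℝ) ≤ (n : ℝ) ^ (c * Real.logb 2 (n : ℝ)) := by
  obtain ⟨c, hc⟩ := WeightRAM.ForProg.exists_cost_loopBound_le WeightRAM.ForProg.mwisParts
  refine ⟨WeightRAM.ForProg.mwisParts.compile,
    fun n => WeightRAM.ForProg.mwisParts.cost (WeightRAM.ForProg.loopBound n), c,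
    fun n G w hG hw => ?_, hc⟩
  obtain ⟨t, ht, hle⟩ := WeightRAM.ForProg.runs_mwisParts
    (s := WeightRAM.inputState G w) (n := n) (adj := WeightRAM.natAdj G)
    (by simp [WeightRAM.inputState]) (by simp [WeightRAM.inputState])
    (WeightRAM.inputState_adj G w) rfl
  exact ⟨_, t, ht, hle, WeightRAM.isMaxWeightIndepSet_mwisParts w hG hw⟩
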